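/- Let $d,l,m\in\mathbb N$ with $d\ge D^2$, where $D=l+m$. Let $A=(A_i)_{i=1}^d$ be $l\times l$ and $B=(B_i)_{i=1}^d$ be $m\times m$ complex matrices such that $C=A\oplus B$ is in standard form, that is: the matrices $A_i\oplus B_i$ span all of $\mathcal M_l\oplus\mathcal M_m$, and for $T\in\{A,B\}$ the map $\mathcal E_T(X)=\sum_i T_iXT_i^*$ has spectral radius one with $1$ as its only eigenvalue of modulus one, $\mathcal E_T(\mathbb I)=\mathbb I$, and $\sum_i T_i^*\Lambda_T T_i=\Lambda_T$ for some $\Lambda_T>0$ with $\operatorname{tr}\Lambda_T=1$. For a family $T=(T_i)_{i=1}^d$ of square matrices let $h(T)$ be the orthogonal projector in $\mathbb C^d\otimes\mathbb C^d$ onto the orthogonal complement of $\{\sum_{i,j}\operatorname{tr}[T_iT_jX]\,|i,j\rangle : X\}$, and on a periodic chain of $n$ sites let $\hat H_n(T)=\sum_{k=1}^{n} h(T)_{k,k+1}$ (with $n+1\equiv 1$). For a perturbation $P=(P_i)_{i=1}^d$, $P_i=\begin{pmatrix}P^A_i&R_i\\L_i&P^B_i\end{pmatrix}\in\mathcal M_D$,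 the uncle Hamiltonian is $H'_{P}=\lim_{\varepsilon\to0}\hat H_n(C+\varepsilon P)$, if the limit exists. Call $P$ injective if the matrices $\begin{pmatrix}A_i&R_i\\L_i&B_i\end{pmatrix}$ span $\mathcal M_D$. "Almost every $P$" means: all $P$ outside a set of Lebesgue measure zero, where moreover the exceptional set is contained in the zero set of a polynomial in the entries of $P$ that is not identically zero. For a chain of $6N+1$ sites with positions $-3N,\dots,3N$ let $|\phi_N\rangle=\sum_{-2N\le i\le -N,\;N\le j\le 2N}|\zeta_{i,j}\rangle$, where $|\zeta_{i,j}\rangle=\sum_{s}\operatorname{tr}[A_{s_{-3N}}\cdots A_{s_{i-1}}R_{s_i}B_{s_{i+1}}\cdots B_{s_{j-1}}L_{s_j}A_{s_{j+1}}\cdots A_{s_{3N}}]\,|s_{-3N},\dots,s_{3N}\rangle$, and let $|M(T)\rangle=\sum_s\operatorname{tr}[T_{s_{-3N}}\cdots T_{s_{3N}}]\,|s_{-3N},\dots,s_{3N}\rangle$. Then for almost every $P$ the following holds: $P$ is injective, the uncle Hamiltonian $H'_P$ exists on the periodic chain of $n$ sites for every $n\ge2$, and 1. $H'_P$ is gapless: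 there is a sequence $\delta_N\to0$ such that for every $N\ge1$, on $6N+1$ sites, the smallest eigenvalue of $H'_P$ is $0$ and $H'_P$ has at least one eigenvalue in $(0,\delta_N)$; 2. $\langle\phi_N|\phi_N\rangle=\Theta(N^2)$; there is a constant $c>0$ such that $\langle M(A)|\phi_N\rangle=O(e^{-cN})$ and $\langle M(B)|\phi_N\rangle=O(e^{-cN})$; and $\langle\phi_N|H'_P|\phi_N\rangle=O(N)$, as $N\to\infty$ (with constants depending on $A,B,P$). -/

import Mathlib

open Filter Topology MeasureTheory Asymptotics
open scoped ComplexOrder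

noncomputable section

namespace MPS

/-- A matrix product tensor `(T_i)_{αβ}` with physical index `i : κ` and virtual indices
`α β : n`, i.e. a family of matrices `T_i`. -/
abbrev Tensor (κ n : Type) : Type := κ → Matrix n n ℂ

/-- The state space `(ℂ^d)^{⊗ n}` of a chain of `n` sites, in the product basis `|s_1,…,s_n⟩`. -/
abbrev ChainSpace (d n : ℕ) : Type := EuclideanSpace ℂ (Fin n → Fin d)

/-- Operators on a chain of `n` sites. -/
abbrev ChainOperator (d n : ℕ) : Type := ChainSpace d n →L[ℂ] ChainSpace d n

/-- Contraction of two copies of `T` along a virtual index, `(T — T)_{(i,j)} = T_i T_j`. -/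
def twoSite {κ n : Type} [Fintype n] (T : Tensor κ n) : Tensor (κ × κ) n :=
  fun p => T p.1 * T p.2

/-- The span of a tensor: the span of the vectors `∑_i tr[T_i X] |i⟩` over all matrices `X`. -/
def tensorSpan {κ n : Type} [Fintype κ] [Fintype n] (T : Tensor κ n) :
    Submodule ℂ (EuclideanSpace ℂ κ) :=
  Submodule.span ℂ
    (Set.range fun X : Matrix n n ℂ => WithLp.toLp 2 fun i => (T i * X).trace)

/-- `Π[T]`: the orthogonal projector onto the orthogonal complement of the span of `T`. -/
def tensorProjector {κ n : Type} [Fintype κ] [Fintype n] (T : Tensor κ n) :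
    EuclideanSpace ℂ κ →L[ℂ] EuclideanSpace ℂ κ :=
  (tensorSpan T)ᗮ.starProjection

/-- The two-site operator `h` acting on the (distinct) sites `a`, `b` of a chain, tensored with the
identity on all other sites. -/
def localTerm {d n : ℕ}
    (h : EuclideanSpace ℂ (Fin d × Fin d) →L[ℂ] EuclideanSpace ℂ (Fin d × Fin d))
    (a b : Fin n) : ChainOperator d n :=
  LinearMap.toContinuousLinearMap
    { toFun := fun ψ => WithLp.toLp 2 fun s : Fin n → Fin d =>
        h (WithLp.toLp 2 fun p : Fin d × Fin d =>
          ψ (Function.update (Function.update s a p.1) b p.2)) (s a, s b)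
      map_add' := fun ψ χ => by
        ext s
        have e : (WithLp.toLp 2 fun p : Fin d × Fin d =>
            (ψ + χ) (Function.update (Function.update s a p.1) b p.2)) =
            (WithLp.toLp 2 fun p : Fin d × Fin d =>
              ψ (Function.update (Function.update s a p.1) b p.2)) +
            (WithLp.toLp 2 fun p : Fin d × Fin d =>
              χ (Function.update (Function.update s a p.1) b p.2)) := by
          ext p; simp
        exact (congrArg (fun v => (h v) (s a, s b)) e).trans (by rw [map_add]; rfl)
      map_smul' := fun c ψ => by
        ext s
        have e : (WithLp.toLp 2 fun p : Fin d × Fin d =>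
            (c • ψ) (Function.update (Function.update s a p.1) b p.2)) =
            c • (WithLp.toLp 2 fun p : Fin d × Fin d =>
              ψ (Function.update (Function.update s a p.1) b p.2)) := by
          ext p; simp
        exact (congrArg (fun v => (h v) (s a, s b)) e).trans (by rw [map_smul]; rfl) }

/-- The Hamiltonian `∑_i h_{i,i+1}`, `h = Π[T — T]`, on a periodic chain of `n` sites
(`finRotate n i` is the site following `i`, cyclically). -/
def parentHamiltonian {d : ℕ} {ι : Type} [Fintype ι] (T : Tensor (Fin d) ι) (n : ℕ) :
    ChainOperator d n :=
  ∑ i : Fin n, localTerm (tensorProjector (twoSite T)) i (finRotate n i)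

/-- `H` is the uncle Hamiltonian of the tensor `T` induced by the perturbation `P` on a periodic
chain of `n` sites: the limit of the parent Hamiltonians of `T + ε P` as `ε → 0`, `ε ≠ 0`. -/
def IsUncleHamiltonian {d : ℕ} {ι : Type} [Fintype ι] (T P : Tensor (Fin d) ι) (n : ℕ)
    (H : ChainOperator d n) : Prop :=
  Tendsto (fun ε : ℂ => parentHamiltonian (T + ε • P) n) (𝓝[≠] 0) (𝓝 H)

/-- The unnormalized vector `∑_s tr[T^1_{s_1} ⋯ T^n_{s_n}] |s_1,…,s_n⟩` for site-dependent
tensors `T^k`. -/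
def siteState {d n : ℕ} {ι : Type} [Fintype ι] [DecidableEq ι]
    (T : Fin n → Tensor (Fin d) ι) : ChainSpace d n :=
  WithLp.toLp 2 fun s => (List.ofFn fun k => T k (s k)).prod.trace

/-- The matrix product state `|M(T)⟩` on `n` sites. -/
def mpsState {d : ℕ} {ι : Type} [Fintype ι] [DecidableEq ι] (T : Tensor (Fin d) ι) (n : ℕ) :
    ChainSpace d n :=
  siteState fun _ : Fin n => T

/-- The transfer operator `E(X) = ∑_i T_i X T_i^*`. -/
def transfer {κ ι : Type} [Fintype κ] [Fintype ι] (T : Tensor κ ι) :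
    Module.End ℂ (Matrix ι ι ℂ) where
  toFun X := ∑ i, T i * X * (T i).conjTranspose
  map_add' X Y := by simp [mul_add, add_mul, Finset.sum_add_distrib]
  map_smul' c X := by simp [Finset.smul_sum]

/-- Normalization of one block in the standard form: the transfer operator `E` has spectral radius
one, `1` is its only eigenvalue of modulus one, `E(𝟙) = 𝟙`, and the adjoint `E^*` has a positive
definite fixed point of trace one. -/
structure IsNormalBlock {κ ι : Type} [Fintype κ] [Fintype ι] [DecidableEq ι]
    (T : Tensor κ ι) : Prop where
  spectralRadius_eq : spectralRadius ℂ (transfer T) = 1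
  eq_one : ∀ μ : ℂ, (transfer T).HasEigenvalue μ → ‖μ‖ = 1 → μ = 1
  unital : transfer T 1 = 1
  exists_fixed : ∃ Λ : Matrix ι ι ℂ, Λ.PosDef ∧ Λ.trace = 1 ∧
    ∑ i, (T i).conjTranspose * Λ * T i = Λ

/-- The two-block tensor `A ⊕ B` is in standard form: it is block-injective, i.e. the matrices
`A_i ⊕ B_i` span all block-diagonal matrices, and both blocks are normalized. -/
structure IsStandardForm {d l m : ℕ} (A : Tensor (Fin d) (Fin l)) (B : Tensor (Fin d) (Fin m)) :
    Prop where
  blockInjective : Submodule.span ℂ (Set.range fun i => (A i, B i)) = ⊤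
  left : IsNormalBlock A
  right : IsNormalBlock B

/-- A tensor is injective if its matrices span the whole matrix algebra. -/
def IsInjectiveTensor {κ ι : Type} (T : Tensor κ ι) : Prop :=
  Submodule.span ℂ (Set.range T) = ⊤

/-- The direct sum tensor `A ⊕ B`. -/
def directSum {d l m : ℕ} (A : Tensor (Fin d) (Fin l)) (B : Tensor (Fin d) (Fin m)) :
    Tensor (Fin d) (Fin l ⊕ Fin m) :=
  fun i => Matrix.fromBlocks (A i) 0 0 (B i)

/-- A perturbation `P = (P^A, R; L, P^B)` of `A ⊕ B` is injective if the tensor `(A, R; L, B)` is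
injective. -/
def IsInjectivePerturbation {d l m : ℕ} (A : Tensor (Fin d) (Fin l)) (B : Tensor (Fin d) (Fin m))
    (P : Tensor (Fin d) (Fin l ⊕ Fin m)) : Prop :=
  IsInjectiveTensor fun i =>
    Matrix.fromBlocks (A i) (P i).toBlocks₁₂ (P i).toBlocks₂₁ (B i)

/-- The domain wall state `|ζ_{i,j}⟩ = tr[A ⋯ A R B ⋯ B L A ⋯ A]` on a chain of `6N+1` sites whose
positions are numbered `-3N, …, 3N`: `R` (upper right block of `P`) sits at position `i`, `L`
(lower left block of `P`) at position `j`, `B` between them and `A` elsewhere. The rectangular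
matrices are written as blocks of square matrices. -/
def domainWall {d l m : ℕ} (A : Tensor (Fin d) (Fin l)) (B : Tensor (Fin d) (Fin m))
    (P : Tensor (Fin d) (Fin l ⊕ Fin m)) (N : ℕ) (i j : ℤ) : ChainSpace d (6 * N + 1) :=
  siteState fun (k : Fin (6 * N + 1)) (x : Fin d) =>
    let pos : ℤ := (k : ℤ) - 3 * N
    if pos = i then Matrix.fromBlocks 0 (P x).toBlocks₁₂ 0 0
    else if pos = j then Matrix.fromBlocks 0 0 (P x).toBlocks₂₁ 0
    else if i < pos ∧ pos < j then Matrix.fromBlocks 0 0 0 (B x)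
    else Matrix.fromBlocks (A x) 0 0 0

/-- The trial state `|φ_N⟩ = ∑_{-2N ≤ i ≤ -N, N ≤ j ≤ 2N} |ζ_{i,j}⟩`. -/
def trialState {d l m : ℕ} (A : Tensor (Fin d) (Fin l)) (B : Tensor (Fin d) (Fin m))
    (P : Tensor (Fin d) (Fin l ⊕ Fin m)) (N : ℕ) : ChainSpace d (6 * N + 1) :=
  ∑ i ∈ Finset.Icc (-2 * N : ℤ) (-N), ∑ j ∈ Finset.Icc (N : ℤ) (2 * N), domainWall A B P N i j

/-- The real numbers that are eigenvalues of an operator on a chain. -/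
def realEigenvalues {d n : ℕ} (H : ChainOperator d n) : Set ℝ :=
  {t | Module.End.HasEigenvalue (H : ChainSpace d n →ₗ[ℂ] ChainSpace d n) (t : ℂ)}

/-- A family of Hamiltonians with ground state energy `0` is gapless (along chains of `6N+1` sites):
there is `δ_N → 0` such that on `6N+1` sites there is an eigenvalue in `(0, δ_N)`. -/
def IsGapless {d : ℕ} (H : ∀ n : ℕ, ChainOperator d n) : Prop :=
  ∃ δ : ℕ → ℝ, Tendsto δ atTop (𝓝 0) ∧ ∀ N : ℕ, 1 ≤ N →
    IsLeast (realEigenvalues (H (6 * N + 1))) 0 ∧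
    ∃ t ∈ realEigenvalues (H (6 * N + 1)), 0 < t ∧ t < δ N

/-- A property holds for almost every tensor: it holds off a set of Lebesgue measure zero, and
moreover the exceptional tensors lie in the zero set of a polynomial in the entries that does not
vanish identically (a closed algebraic variety of strictly lower dimension). -/
def ForAlmostEveryTensor {d : ℕ} {ι : Type} [Fintype ι] (p : Tensor (Fin d) ι → Prop) : Prop :=
  (∀ᵐ P : Fin d → ι → ι → ℂ, p fun i => Matrix.of (P i)) ∧
  ∃ Q : MvPolynomial (Fin d × ι × ι) ℂ, Q ≠ 0 ∧
    ∀ P : Tensor (Fin d) ι, MvPolynomial.eval (fun x => P x.1 x.2.1 x.2.2) Q ≠ 0 → p P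

end MPS

end

noncomputable section

namespace MPS

/-! ### Null sets and generic tensors -/

/-! Write `C = A ⊕ B`, `D = l + m`, and call `(A, R; L, B)` the wall tensor. Injectivity of `P` is
the nonvanishing of some `D² × D²` minor of the wall tensor, so it is generic once a single
injective `P` exists, and `D² ≤ d` leaves room for one (`exists_polynomial_injectivePerturbation`).
Everything else is proved for every injective `P`.

Existence of the limit: dividing the off-diagonal blocks of `C + εP` by `ε` does not change the
two-site span, and the rescaled tensor converges to the wall tensor. The matrix product turns into a
product that tends, as `ε → 0`, to the contracted product `cmul 0`, in which off-diagonal times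
off-diagonal vanishes. The wall tensor spans and `cmul 0` has a unit, so the span keeps dimension
`D²` in the limit and the projectors converge (`isUncleHamiltonian_ringHamiltonian`).

Ground space: a zero-energy vector on at least three sites is a linear functional of the iterated
contracted product. Closing the ring makes this functional tracial, hence a combination of the two
block traces, so the vector is a combination of `M(A)` and `M(B)` (`exists_eq_mpsState_of_slices`).

Trial state: a superposition of wall positions with locally constant weights is annihilated by the
local terms. Hence `φ_N` pays energy only at the four bonds where a range of positions begins or
ends, and only the `O(N)` configurations with a wall at that end contribute there
(`exists_energy_trialState_le`). All norms come from transfer operators, whose powers converge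
exponentially to the projection onto the span of the two block identities
(`IsTwoBlock.exists_pow_transfer_le`). This gives `‖φ_N‖² = O(N²)` and exponentially small overlaps
with `M(A)` and `M(B)`. Pairing with dual walls, which see only one pair of positions each, gives
the matching lower bound (`exists_le_norm_trialState`).

Gaplessness is then variational: the part of `φ_N` orthogonal to the kernel has squared norm of
order `N²` and energy `O(N)`, so the first positive eigenvalue is `O(1/N)` (`isGapless_uncle`). -/

/-- A measurable set that meets every ray from a point outside it in a countable set is null. -/
theorem measure_eq_zero_of_countable_rays {E : Type*} [NormedAddCommGroup E] [NormedSpace ℝ E]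
    [FiniteDimensional ℝ E] [MeasurableSpace E] [BorelSpace E] (μ : Measure E)
    [μ.IsAddHaarMeasure] {S : Set E} (hS : MeasurableSet S) (x₀ : E) (hx₀ : x₀ ∉ S)
    (h : ∀ u : E, {r : ℝ | x₀ + r • u ∈ S}.Countable) : μ S = 0 := by
  -- After recentring at `x₀`, polar coordinates make the measure a product of a sphere measure and
  -- a radial one. By Fubini it suffices that each radial section is null.
  set S' : Set E := (fun x => x₀ + x) ⁻¹' S with hS'
  have hmS' : MeasurableSet S' := (measurable_const_add x₀) hS
  have hμ : μ S' = μ S := measure_preimage_add μ x₀ S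
  have h0 : (0 : E) ∉ S' := by simpa [hS'] using hx₀
  rw [← hμ]
  have himg : S' = ((↑) : ({(0 : E)}ᶜ : Set E) → E) '' (((↑) : ({(0 : E)}ᶜ : Set E) → E) ⁻¹' S') := by
    rw [Subtype.image_preimage_coe]
    ext x
    constructor
    · intro hx
      exact ⟨fun hx0 => h0 (by simpa using (hx0 : x = 0) ▸ hx), hx⟩
    · exact fun hx => hx.2
  have hmc : MeasurableSet ({(0 : E)}ᶜ : Set E) := (measurableSet_singleton _).compl
  rw [himg, ← comap_subtype_coe_apply hmc]
  have hmp := μ.measurePreserving_homeomorphUnitSphereProd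
  set U : Set ({(0 : E)}ᶜ : Set E) := ((↑) : ({(0 : E)}ᶜ : Set E) → E) ⁻¹' S'
  have hU : MeasurableSet U := measurable_subtype_coe hmS'
  have hUe : U = homeomorphUnitSphereProd E ⁻¹' ((homeomorphUnitSphereProd E).symm ⁻¹' U) := by
    ext x; simp
  have hmV : MeasurableSet ((homeomorphUnitSphereProd E).symm ⁻¹' U) :=
    (homeomorphUnitSphereProd E).symm.measurable hU
  rw [hUe, hmp.measure_preimage hmV.nullMeasurableSet, Measure.measure_prod_null hmV]
  refine Eventually.of_forall fun u => ?_
  change Measure.volumeIoiPow _ _ = 0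
  rw [Measure.volumeIoiPow]
  refine withDensity_absolutelyContinuous _ _ ?_
  rw [comap_subtype_coe_apply measurableSet_Ioi]
  refine Set.Countable.measure_zero ((h (u : E)).mono ?_) _
  rintro _ ⟨r, hr, rfl⟩
  simpa [U, hS'] using hr

/-- The zero set of a nonzero polynomial in the entries of a tensor is a null set. -/
theorem ae_eval_ne_zero {d : ℕ} {ι : Type} [Fintype ι] (Q : MvPolynomial (Fin d × ι × ι) ℂ)
    (hQ : Q ≠ 0) :
    ∀ᵐ P : Fin d → ι → ι → ℂ, MvPolynomial.eval (fun x => P x.1 x.2.1 x.2.2) Q ≠ 0 := by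
  obtain ⟨y, hy⟩ : ∃ y, MvPolynomial.eval y Q ≠ 0 := by
    by_contra! hcon
    exact hQ (MvPolynomial.funext fun x => by simpa using hcon x)
  have hcont : Continuous fun P : Fin d → ι → ι → ℂ =>
      MvPolynomial.eval (fun x => P x.1 x.2.1 x.2.2) Q :=
    (MvPolynomial.continuous_eval Q).comp (by fun_prop)
  have : (volume : Measure (ι → ι → ℂ)).IsAddHaarMeasure := Measure.pi.isAddHaarMeasure _
  have : (volume : Measure (Fin d → ι → ι → ℂ)).IsAddHaarMeasure := Measure.pi.isAddHaarMeasure _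
  rw [ae_iff]
  simp only [ne_eq, not_not]
  refine measure_eq_zero_of_countable_rays _ (isClosed_eq hcont continuous_const).measurableSet
    (fun i a b => y (i, a, b)) (by simpa using hy) fun u => ?_
  -- The restriction of `Q` to the line through `y` in direction `u`: its value at `0` is `Q(y) ≠
  -- 0`, so it has finitely many roots.
  set f : Polynomial ℂ := MvPolynomial.aeval (fun x : Fin d × ι × ι =>
    Polynomial.C (y x) + Polynomial.C (u x.1 x.2.1 x.2.2) * Polynomial.X) Q with hf
  have hev : ∀ r : ℂ, f.eval r = MvPolynomial.eval (fun x => y x + u x.1 x.2.1 x.2.2 * r) Q := by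
    intro r
    have h1 : f.eval r = (Polynomial.evalRingHom r) f := rfl
    rw [h1, hf, MvPolynomial.aeval_def, MvPolynomial.hom_eval₂, MvPolynomial.eval,
      MvPolynomial.coe_eval₂Hom]
    congr 1
    · ext; simp
    · ext x; simp
  have hf0 : f ≠ 0 := by
    intro h0
    have := hev 0
    simp [h0] at this
    exact hy this.symm
  have hfin : ({r : ℂ | f.eval r = 0}).Finite := Polynomial.finite_setOfPred_isRoot hf0
  refine ((hfin.preimage (f := fun r : ℝ => (r : ℂ))
    Complex.ofReal_injective.injOn).subset ?_).countable
  intro r hr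
  simp only [Set.mem_preimage, Set.mem_ofPred_eq, hev] at hr ⊢
  simpa [mul_comm] using hr

theorem forAlmostEveryTensor_of_polynomial {d : ℕ} {ι : Type} [Fintype ι]
    {p : Tensor (Fin d) ι → Prop} (Q : MvPolynomial (Fin d × ι × ι) ℂ) (hQ : Q ≠ 0)
    (h : ∀ P : Tensor (Fin d) ι, MvPolynomial.eval (fun x => P x.1 x.2.1 x.2.2) Q ≠ 0 → p P) :
    ForAlmostEveryTensor p := by
  refine ⟨?_, Q, hQ, h⟩
  filter_upwards [ae_eval_ne_zero Q hQ] with P hP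
  exact h _ (by simpa using hP)

/-- A surjection `g` can be completed by some `h` to a surjection `(g, h)` onto a product, as soon
as the dimension of the source allows it. -/
theorem exists_prod_surjective {V W₁ W₂ : Type*} [AddCommGroup V] [Module ℂ V]
    [AddCommGroup W₁] [Module ℂ W₁] [AddCommGroup W₂] [Module ℂ W₂]
    [FiniteDimensional ℂ V] [FiniteDimensional ℂ W₁] [FiniteDimensional ℂ W₂]
    (g : V →ₗ[ℂ] W₁) (hg : Function.Surjective g)
    (hdim : Module.finrank ℂ W₁ + Module.finrank ℂ W₂ ≤ Module.finrank ℂ V) :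
    ∃ h : V →ₗ[ℂ] W₂, Function.Surjective (g.prod h) := by
  have hrank := LinearMap.finrank_range_add_finrank_ker g
  rw [LinearMap.range_eq_top.2 hg, finrank_top] at hrank
  -- The kernel of `g` contains a copy of `W₂`; projecting onto the kernel and then retracting to
  -- that copy supplies the second component without disturbing the first.
  have hle : Module.finrank ℂ W₂ ≤ Module.finrank ℂ (LinearMap.ker g) := by omega
  obtain ⟨i, hi⟩ : ∃ i : W₂ →ₗ[ℂ] LinearMap.ker g, Function.Injective i :=
    finrank_le_iff_exists_linearMap.mp hle
  obtain ⟨s, hs⟩ := LinearMap.exists_leftInverse_of_injective i (LinearMap.ker_eq_bot.2 hi)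
  obtain ⟨π, hπ⟩ := LinearMap.exists_leftInverse_of_injective (LinearMap.ker g).subtype
    (LinearMap.ker_eq_bot.2 Subtype.val_injective)
  refine ⟨s ∘ₗ π, fun ⟨a, b⟩ => ?_⟩
  obtain ⟨y, rfl⟩ := hg a
  refine ⟨y + (i (b - s (π y)) : V), ?_⟩
  have h1 : π (i (b - s (π y)) : V) = i (b - s (π y)) := LinearMap.congr_fun hπ _
  have h2 : ∀ w, s (i w) = w := fun w => LinearMap.congr_fun hs w
  have h3 : g (i (b - s (π y)) : V) = 0 := (i (b - s (π y))).2
  refine Prod.ext ?_ ?_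
  · change g (y + _) = g y
    rw [map_add, h3, add_zero]
  · change s (π (y + _)) = b
    rw [map_add, h1, map_add, h2, add_sub_cancel]

/-- `P` is replaced by the tensor `(A, R; L, B)`. -/
def wallTensor {d l m : ℕ} (A : Tensor (Fin d) (Fin l)) (B : Tensor (Fin d) (Fin m))
    (P : Tensor (Fin d) (Fin l ⊕ Fin m)) : Tensor (Fin d) (Fin l ⊕ Fin m) :=
  fun i => Matrix.fromBlocks (A i) (P i).toBlocks₁₂ (P i).toBlocks₂₁ (B i)

/-- Dimension count: `l² + m² + 2lm ≤ d`, so the off-diagonal blocks can be chosen to make the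
coefficient vectors reach all four blocks simultaneously. -/
theorem exists_injectivePerturbation {d l m : ℕ}
    (A : Tensor (Fin d) (Fin l)) (B : Tensor (Fin d) (Fin m))
    (hAB : Submodule.span ℂ (Set.range fun i => (A i, B i)) = ⊤) (hd : (l + m) ^ 2 ≤ d) :
    ∃ P, IsInjectivePerturbation A B P := by
  set g : (Fin d → ℂ) →ₗ[ℂ] Matrix (Fin l) (Fin l) ℂ × Matrix (Fin m) (Fin m) ℂ :=
    Fintype.linearCombination ℂ fun i => (A i, B i) with hgdef
  have hg : Function.Surjective g := by
    rw [← LinearMap.range_eq_top, hgdef, Fintype.range_linearCombination, hAB]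
  obtain ⟨h, hh⟩ := exists_prod_surjective
    (W₂ := Matrix (Fin l) (Fin m) ℂ × Matrix (Fin m) (Fin l) ℂ) g hg (by
      simp only [Module.finrank_prod, Module.finrank_matrix, Fintype.card_fin,
        Module.finrank_self, Module.finrank_fintype_fun_eq_card]
      nlinarith)
  refine ⟨fun i => Matrix.fromBlocks 0 (h (Pi.single i 1)).1 (h (Pi.single i 1)).2 0, ?_⟩
  rw [IsInjectivePerturbation, IsInjectiveTensor, eq_top_iff]
  rintro X -
  rw [← Fintype.range_linearCombination]
  obtain ⟨c, hc⟩ := hh ((X.toBlocks₁₁, X.toBlocks₂₂), (X.toBlocks₁₂, X.toBlocks₂₁))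
  refine ⟨c, ?_⟩
  have hgc : g c = ∑ i, c i • (A i, B i) := by
    rw [hgdef, Fintype.linearCombination_apply]
  have hhc : h c = ∑ i, c i • h (Pi.single i 1) := by
    conv_lhs => rw [pi_eq_sum_univ' c]
    simp only [map_sum, map_smul]
  have h1 : ∑ i, c i • (A i, B i) = (X.toBlocks₁₁, X.toBlocks₂₂) := hgc ▸ congrArg Prod.fst hc
  have h2 : ∑ i, c i • h (Pi.single i 1) = (X.toBlocks₁₂, X.toBlocks₂₁) :=
    hhc ▸ congrArg Prod.snd hc
  have a1 := congrArg Prod.fst h1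
  have a2 := congrArg Prod.snd h1
  have a3 := congrArg Prod.fst h2
  have a4 := congrArg Prod.snd h2
  simp only [Prod.fst_sum, Prod.snd_sum, Prod.smul_fst, Prod.smul_snd] at a1 a2 a3 a4
  rw [Fintype.linearCombination_apply]
  simp only [Matrix.toBlocks_fromBlocks₁₂, Matrix.toBlocks_fromBlocks₂₁]
  rw [← Matrix.fromBlocks_toBlocks X, ← a1, ← a2, ← a3, ← a4]
  ext (i | i) (j | j) <;> simp [Matrix.sum_apply]

/-- Injectivity of a perturbation is a generic property. -/
theorem exists_polynomial_injectivePerturbation {d l m : ℕ}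
    (A : Tensor (Fin d) (Fin l)) (B : Tensor (Fin d) (Fin m))
    (hAB : Submodule.span ℂ (Set.range fun i => (A i, B i)) = ⊤) (hd : (l + m) ^ 2 ≤ d) :
    ∃ Q : MvPolynomial (Fin d × (Fin l ⊕ Fin m) × (Fin l ⊕ Fin m)) ℂ, Q ≠ 0 ∧
      ∀ P : Tensor (Fin d) (Fin l ⊕ Fin m),
        MvPolynomial.eval (fun x => P x.1 x.2.1 x.2.2) Q ≠ 0 → IsInjectivePerturbation A B P := by
  classical
  obtain ⟨P₀, hP₀⟩ := exists_injectivePerturbation A B hAB hd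
  let ι := Fin l ⊕ Fin m
  have hinj : ∀ P, IsInjectivePerturbation A B P ↔
      Submodule.span ℂ (Set.range (wallTensor A B P)) = ⊤ := fun P => Iff.rfl
  rw [hinj] at hP₀
  -- Fix `D²` physical indices whose matrices form a basis at the reference point `P₀`. The
  -- determinant of these matrices, with diagonal blocks as constants and off-diagonal entries as
  -- variables, is the required polynomial.
  obtain ⟨b, hbsub, hbspan, hbli⟩ := exists_linearIndependent ℂ (Set.range (wallTensor A B P₀))
  rw [hP₀] at hbspan
  have hbasis : Module.Basis b ℂ (Matrix ι ι ℂ) :=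
    Module.Basis.mk hbli (by simpa using hbspan.ge)
  let e' : (ι × ι) ≃ b := (Matrix.stdBasis ℂ ι ι).indexEquiv hbasis
  choose e he using fun k : ι × ι => hbsub (e' k).2
  let poly : Fin d → ι → ι → MvPolynomial (Fin d × ι × ι) ℂ := fun x i j =>
    match i, j with
    | .inl a, .inl b => MvPolynomial.C (A x a b)
    | .inr a, .inr b => MvPolynomial.C (B x a b)
    | .inl a, .inr b => MvPolynomial.X (x, .inl a, .inr b)
    | .inr a, .inl b => MvPolynomial.X (x, .inr a, .inl b)
  let Mp : Matrix (ι × ι) (ι × ι) (MvPolynomial (Fin d × ι × ι) ℂ) :=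
    Matrix.of fun k ab => poly (e k) ab.1 ab.2
  have hMp : ∀ P : Tensor (Fin d) ι, MvPolynomial.eval (fun x => P x.1 x.2.1 x.2.2) Mp.det =
      (Matrix.of fun (k ab : ι × ι) => wallTensor A B P (e k) ab.1 ab.2).det := by
    intro P
    rw [RingHom.map_det]
    congr 1
    ext k ⟨a | a, b | b⟩ <;>
      simp [Mp, poly, wallTensor, Matrix.toBlocks₁₂, Matrix.toBlocks₂₁]
  have hdet : ∀ P : Tensor (Fin d) ι, IsUnit
      (Matrix.of fun (k ab : ι × ι) => wallTensor A B P (e k) ab.1 ab.2).det ↔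
      LinearIndependent ℂ fun k => wallTensor A B P (e k) := by
    intro P
    rw [← Matrix.isUnit_iff_isUnit_det, ← Matrix.linearIndependent_rows_iff_isUnit]
    let u : Matrix ι ι ℂ →ₗ[ℂ] (ι × ι → ℂ) :=
      { toFun := fun X ab => X ab.1 ab.2
        map_add' := fun X Y => rfl
        map_smul' := fun c X => rfl }
    have hu : LinearMap.ker u = ⊥ := by
      rw [LinearMap.ker_eq_bot]
      intro X Y hXY
      ext a b
      exact congrFun hXY (a, b)
    exact u.linearIndependent_iff hu (v := fun k => wallTensor A B P (e k))
  refine ⟨Mp.det, ?_, fun P hP => ?_⟩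
  · intro h0
    have h1 := hMp P₀
    rw [h0, map_zero] at h1
    have h2 := (hdet P₀).2 (by
      have : (fun k => wallTensor A B P₀ (e k)) = (fun x : b => (x : Matrix ι ι ℂ)) ∘ e' := by
        funext k; exact he k
      rw [this]
      exact hbli.comp _ e'.injective)
    rw [← h1] at h2
    exact not_isUnit_zero h2
  · rw [hMp P] at hP
    have hli := (hdet P).1 (isUnit_iff_ne_zero.2 hP)
    rw [hinj, eq_top_iff, ← hli.span_eq_top_of_card_eq_finrank' (by
      simp [Module.finrank_matrix, ι])]
    refine Submodule.span_mono ?_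
    rintro _ ⟨k, rfl⟩
    exact ⟨e k, rfl⟩

/-! ### Transfer operators and their convergence -/

/-- By cyclicity this is the trace of `Y* Λ Y`: the squared Hilbert–Schmidt norm of `Y` weighted by
`Λ`. -/
theorem trace_posDef_mul_nonneg {n : Type} [Fintype n] {Λ : Matrix n n ℂ} (hΛ : Λ.PosDef) (Y : Matrix n n ℂ) :
    0 ≤ (Λ * (Y * Y.conjTranspose)).trace := by
  have := (hΛ.posSemidef.conjTranspose_mul_mul_same Y).trace_nonneg
  rwa [Matrix.trace_mul_comm, ← Matrix.mul_assoc, Matrix.trace_mul_comm] at this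

theorem trace_posDef_mul_eq_zero {n : Type} [Fintype n] {Λ : Matrix n n ℂ} (hΛ : Λ.PosDef) {Y : Matrix n n ℂ}
    (hY : (Λ * (Y * Y.conjTranspose)).trace = 0) : Y = 0 := by
  have h0 : (Y.conjTranspose * Λ * Y).trace = 0 := by
    rw [Matrix.trace_mul_comm, ← Matrix.mul_assoc, Matrix.trace_mul_comm]; exact hY
  have h1 := (hΛ.posSemidef.conjTranspose_mul_mul_same Y).trace_eq_zero_iff.1 h0
  ext i j
  by_contra hne
  have hv : Y.col j ≠ 0 := fun h => hne (congrFun h i)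
  have h2 := hΛ.dotProduct_mulVec_pos hv
  have h3 : (Y.conjTranspose * Λ * Y) j j = star (Y.col j) ⬝ᵥ (Λ.mulVec (Y.col j)) := by
    simp [Matrix.mul_apply, Matrix.mulVec, dotProduct, Finset.mul_sum, Finset.sum_mul,
      Matrix.col, mul_assoc]
    rw [Finset.sum_comm]
  rw [h1] at h3
  exact h2.ne h3

section Transfer

attribute [local instance] Matrix.normedAddCommGroup Matrix.normedSpace

variable {κ ι : Type} [Fintype κ] [Fintype ι] [DecidableEq ι]

/-- The mixed transfer operator `X ↦ ∑_i T_i X S_i^*`. -/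
def mixedTransfer (T S : Tensor κ ι) : Module.End ℂ (Matrix ι ι ℂ) where
  toFun X := ∑ i, T i * X * (S i).conjTranspose
  map_add' X Y := by simp [mul_add, add_mul, Finset.sum_add_distrib]
  map_smul' c X := by simp [Finset.smul_sum]

theorem mixedTransfer_apply (T S : Tensor κ ι) (X : Matrix ι ι ℂ) :
    mixedTransfer T S X = ∑ i, T i * X * (S i).conjTranspose := rfl

/-- A tensor `C` commuting with complementary block projections `p`, `q`, normalized such that
the fixed points of its transfer operator are spanned by `p` and `q`. -/
structure IsTwoBlock (C : Tensor κ ι) (p q Λ : Matrix ι ι ℂ) : Prop where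
  add_eq : p + q = 1
  pp : p * p = p
  qq : q * q = q
  pq : p * q = 0
  qp : q * p = 0
  p_star : p.conjTranspose = p
  q_star : q.conjTranspose = q
  comm_p : ∀ x, C x * p = p * C x
  comm_q : ∀ x, C x * q = q * C x
  unital : mixedTransfer C C 1 = 1
  posDef : Λ.PosDef
  fixed : ∑ x, (C x).conjTranspose * Λ * C x = Λ
  trace_p : (Λ * p).trace = 1
  trace_q : (Λ * q).trace = 1
  trace_pq : ∀ X, (Λ * (p * X * q)).trace = 0
  trace_qp : ∀ X, (Λ * (q * X * p)).trace = 0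
  one_mem : (1 : Matrix ι ι ℂ) ∈ Submodule.span ℂ (Set.range C)
  commutant : ∀ X, (∀ x, C x * X = X * C x) → ∃ a b : ℂ, X = a • p + b • q

namespace IsTwoBlock

variable {C : Tensor κ ι} {p q Λ : Matrix ι ι ℂ}

theorem symm (h : IsTwoBlock C p q Λ) : IsTwoBlock C q p Λ where
  add_eq := by rw [add_comm, h.add_eq]
  pp := h.qq
  qq := h.pp
  pq := h.qp
  qp := h.pq
  p_star := h.q_star
  q_star := h.p_star
  comm_p := h.comm_q
  comm_q := h.comm_p
  unital := h.unital
  posDef := h.posDef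
  fixed := h.fixed
  trace_p := h.trace_q
  trace_q := h.trace_p
  trace_pq := h.trace_qp
  trace_qp := h.trace_pq
  one_mem := h.one_mem
  commutant := fun X hX => by
    obtain ⟨a, b, hab⟩ := h.commutant X hX
    exact ⟨b, a, by rw [hab, add_comm]⟩

theorem trace_transfer (h : IsTwoBlock C p q Λ) (X : Matrix ι ι ℂ) :
    (Λ * mixedTransfer C C X).trace = (Λ * X).trace := by
  conv_rhs => rw [← h.fixed]
  rw [mixedTransfer_apply, Finset.mul_sum, Finset.sum_mul, Matrix.trace_sum, Matrix.trace_sum]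
  refine Finset.sum_congr rfl fun x _ => ?_
  rw [Matrix.trace_mul_comm, Matrix.mul_assoc, Matrix.mul_assoc, Matrix.trace_mul_comm (C x)]
  simp only [Matrix.mul_assoc]
  rw [Matrix.trace_mul_comm]
  simp only [Matrix.mul_assoc]

theorem comm_star_p (h : IsTwoBlock C p q Λ) (x : κ) :
    (C x).conjTranspose * p = p * (C x).conjTranspose := by
  have := congrArg Matrix.conjTranspose (h.comm_p x)
  simpa [h.p_star] using this.symm

/-- Multiplication by block projections commutes with the transfer operator. -/
theorem transfer_mul_mul (h : IsTwoBlock C p q Λ) (X : Matrix ι ι ℂ) {a b : Matrix ι ι ℂ}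
    (ha : a = p ∨ a = q ∨ a = 1) (hb : b = p ∨ b = q ∨ b = 1) :
    mixedTransfer C C (a * X * b) = a * mixedTransfer C C X * b := by
  have hC : ∀ x, C x * a = a * C x := by
    rcases ha with rfl | rfl | rfl
    · exact h.comm_p
    · exact h.comm_q
    · simp
  have hC' : ∀ x, b * (C x).conjTranspose = (C x).conjTranspose * b := by
    rcases hb with rfl | rfl | rfl
    · exact fun x => (h.comm_star_p x).symm
    · exact fun x => (h.symm.comm_star_p x).symm
    · simp
  rw [mixedTransfer_apply, mixedTransfer_apply, Finset.mul_sum, Finset.sum_mul]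
  refine Finset.sum_congr rfl fun x _ => ?_
  calc C x * (a * X * b) * (C x).conjTranspose
      = (C x * a) * X * (b * (C x).conjTranspose) := by simp only [Matrix.mul_assoc]
    _ = _ := by rw [hC, hC']; simp only [Matrix.mul_assoc]

theorem transfer_p (h : IsTwoBlock C p q Λ) : mixedTransfer C C p = p := by
  have := h.transfer_mul_mul 1 (a := p) (b := 1) (by simp) (by simp)
  simpa [h.unital] using this

theorem pow_transfer_mul_mul (h : IsTwoBlock C p q Λ) (n : ℕ) (X : Matrix ι ι ℂ)
    {a b : Matrix ι ι ℂ} (ha : a = p ∨ a = q ∨ a = 1) (hb : b = p ∨ b = q ∨ b = 1) :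
    (mixedTransfer C C ^ n) (a * X * b) = a * (mixedTransfer C C ^ n) X * b := by
  induction n with
  | zero => simp
  | succ n ih =>
    rw [pow_succ', Module.End.mul_apply, Module.End.mul_apply, ih,
      h.transfer_mul_mul _ ha hb]

end IsTwoBlock

/-- The fixed point projection `X ↦ tr[Λ p X] p + tr[Λ q X] q`. -/
def fixedProj (p q Λ : Matrix ι ι ℂ) : Module.End ℂ (Matrix ι ι ℂ) where
  toFun X := (Λ * (p * X * p)).trace • p + (Λ * (q * X * q)).trace • q
  map_add' X Y := by simp only [mul_add, add_mul, Matrix.trace_add, add_smul]; abel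
  map_smul' c X := by simp [smul_smul]

theorem fixedProj_apply (p q Λ X : Matrix ι ι ℂ) :
    fixedProj p q Λ X = (Λ * (p * X * p)).trace • p + (Λ * (q * X * q)).trace • q := rfl

namespace IsTwoBlock

variable {C : Tensor κ ι} {p q Λ : Matrix ι ι ℂ}

theorem transfer_fixedProj (h : IsTwoBlock C p q Λ) (X : Matrix ι ι ℂ) :
    mixedTransfer C C (fixedProj p q Λ X) = fixedProj p q Λ X := by
  rw [fixedProj_apply, map_add, map_smul, map_smul, h.transfer_p, h.symm.transfer_p]

theorem fixedProj_transfer (h : IsTwoBlock C p q Λ) (X : Matrix ι ι ℂ) :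
    fixedProj p q Λ (mixedTransfer C C X) = fixedProj p q Λ X := by
  rw [fixedProj_apply, fixedProj_apply, ← h.transfer_mul_mul X (a := p) (b := p) (by simp) (by simp),
    ← h.transfer_mul_mul X (a := q) (b := q) (by simp) (by simp), h.trace_transfer, h.trace_transfer]

theorem fixedProj_p (h : IsTwoBlock C p q Λ) : fixedProj p q Λ p = p := by
  rw [fixedProj_apply, h.pp, h.pp, h.qp]
  simp [h.trace_p]

theorem fixedProj_q (h : IsTwoBlock C p q Λ) : fixedProj p q Λ q = q := by
  rw [fixedProj_apply, h.qq, h.qq, h.pq]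
  simp [h.trace_q]

theorem fixedProj_fixedProj (h : IsTwoBlock C p q Λ) (X : Matrix ι ι ℂ) :
    fixedProj p q Λ (fixedProj p q Λ X) = fixedProj p q Λ X := by
  conv_lhs => rw [fixedProj_apply p q Λ X]
  rw [map_add, map_smul, map_smul, h.fixedProj_p, h.fixedProj_q, ← fixedProj_apply]

theorem fixedProj_offDiag (h : IsTwoBlock C p q Λ) (X : Matrix ι ι ℂ) :
    fixedProj p q Λ (p * X * q) = 0 := by
  have h1 : p * (p * X * q) * p = 0 := by
    rw [Matrix.mul_assoc, Matrix.mul_assoc _ q p, h.qp]; simp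
  have h2 : q * (p * X * q) * q = 0 := by
    rw [← Matrix.mul_assoc, ← Matrix.mul_assoc, h.qp]; simp
  rw [fixedProj_apply, h1, h2]; simp

/-- Weighted variance identity: an eigenvector of the transfer operator almost intertwines `C`. -/
theorem intertwine_identity (h : IsTwoBlock C p q Λ) {μ : ℂ} {X : Matrix ι ι ℂ}
    (hX : mixedTransfer C C X = μ • X) :
    ∑ x, (Λ * ((C x * X - μ • (X * C x)) * (C x * X - μ • (X * C x)).conjTranspose)).trace
      = (1 - (‖μ‖ : ℂ) ^ 2) * (Λ * (X * X.conjTranspose)).trace := by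
  have hμ : μ * star μ = (‖μ‖ : ℂ) ^ 2 := by
    rw [Complex.star_def, Complex.mul_conj, Complex.normSq_eq_norm_sq]; push_cast; ring
  have hexp : ∀ x, (C x * X - μ • (X * C x)) * (C x * X - μ • (X * C x)).conjTranspose
      = C x * (X * X.conjTranspose) * (C x).conjTranspose
        - star μ • ((C x * X * (C x).conjTranspose) * X.conjTranspose)
        - μ • (X * (C x * X * (C x).conjTranspose).conjTranspose)
        + (μ * star μ) • (X * (C x * 1 * (C x).conjTranspose) * X.conjTranspose) := by
    intro x
    simp only [Matrix.conjTranspose_sub, Matrix.conjTranspose_smul, Matrix.conjTranspose_mul,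
      Matrix.conjTranspose_conjTranspose, sub_mul, mul_sub, Matrix.smul_mul, Matrix.mul_smul,
      smul_smul, Matrix.mul_assoc, Matrix.one_mul, mul_comm (star μ) μ]
    abel
  have hsum : ∑ x, (C x * X - μ • (X * C x)) * (C x * X - μ • (X * C x)).conjTranspose
      = mixedTransfer C C (X * X.conjTranspose)
        - star μ • (mixedTransfer C C X * X.conjTranspose)
        - μ • (X * (mixedTransfer C C X).conjTranspose)
        + (μ * star μ) • (X * mixedTransfer C C 1 * X.conjTranspose) := by
    simp only [hexp, mixedTransfer_apply, Finset.sum_add_distrib, Finset.sum_sub_distrib,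
      ← Finset.smul_sum, Finset.sum_mul, Finset.mul_sum, Matrix.conjTranspose_sum]
  -- Unitality and invariance of `tr[Λ ·]` reduce the four terms to multiples `1`, `-|μ|²`, `-|μ|²`,
  -- `|μ|²` of the same trace.
  rw [← Matrix.trace_sum, ← Finset.mul_sum, hsum, hX, h.unital]
  simp only [mul_add, mul_sub, Matrix.trace_add, Matrix.trace_sub, h.trace_transfer,
    Matrix.conjTranspose_smul, Matrix.smul_mul, Matrix.mul_smul, smul_smul, Matrix.trace_smul,
    Matrix.mul_one, smul_eq_mul]
  rw [mul_comm (star μ) μ, hμ]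
  ring

/-- A matrix that intertwines `C` with a multiple `μ C` is fixed by `μ`. -/
theorem eq_of_intertwine (h : IsTwoBlock C p q Λ) {μ : ℂ} {X : Matrix ι ι ℂ}
    (hX : ∀ x, C x * X = μ • (X * C x)) : X = μ • X := by
  -- The intertwining relation is linear in the matrix `C x`, hence holds for the identity, which
  -- lies in their span.
  let L : Matrix ι ι ℂ →ₗ[ℂ] Matrix ι ι ℂ :=
    LinearMap.mulRight ℂ X - μ • LinearMap.mulLeft ℂ X
  have hle : Submodule.span ℂ (Set.range C) ≤ LinearMap.ker L := by
    rw [Submodule.span_le]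
    rintro _ ⟨x, rfl⟩
    simp [L, hX]
  have := hle h.one_mem
  simpa [L, sub_eq_zero] using this

/-- Every eigenvalue of the transfer operator off its fixed points lies inside the unit disc. -/
theorem norm_eigenvalue_lt_one (h : IsTwoBlock C p q Λ) {μ : ℂ} {X : Matrix ι ι ℂ} (hX0 : X ≠ 0)
    (hX : (mixedTransfer C C - fixedProj p q Λ) X = μ • X) : ‖μ‖ < 1 := by
  -- For `‖μ‖ ≥ 1` the variance identity equates a sum of nonnegative terms with a nonpositive
  -- number, so `X` intertwines exactly. Then `μ = 1` and `X` lies in the commutant, where the fixed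
  -- point projection acts as the identity although it kills `X`.
  by_contra! hμ
  have hμ0 : μ ≠ 0 := by rintro rfl; norm_num at hμ
  have hP : fixedProj p q Λ X = 0 := by
    have h1 : fixedProj p q Λ ((mixedTransfer C C - fixedProj p q Λ) X) = 0 := by
      rw [LinearMap.sub_apply, map_sub, h.fixedProj_transfer, h.fixedProj_fixedProj,
        sub_self]
    rw [hX, map_smul] at h1
    exact (smul_eq_zero.1 h1).resolve_left hμ0
  rw [LinearMap.sub_apply, hP, sub_zero] at hX
  have hid := h.intertwine_identity hX
  have hnn := trace_posDef_mul_nonneg h.posDef X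
  have hle : (∑ x, (Λ * ((C x * X - μ • (X * C x)) *
      (C x * X - μ • (X * C x)).conjTranspose)).trace) ≤ 0 := by
    rw [hid]
    have : (1 - (‖μ‖ : ℂ) ^ 2) ≤ 0 := by
      rw [sub_nonpos]
      exact_mod_cast one_le_pow₀ hμ
    exact mul_nonpos_of_nonpos_of_nonneg this hnn
  have hz := (Finset.sum_eq_zero_iff_of_nonneg
    fun x _ => trace_posDef_mul_nonneg h.posDef (C x * X - μ • (X * C x))).1
    (le_antisymm hle (Finset.sum_nonneg fun x _ => trace_posDef_mul_nonneg h.posDef _))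
  have hint : ∀ x, C x * X = μ • (X * C x) := fun x =>
    sub_eq_zero.1 (trace_posDef_mul_eq_zero h.posDef (hz x (Finset.mem_univ x)))
  have hμX := h.eq_of_intertwine hint
  have hμ1 : μ = 1 := by
    have : (1 - μ) • X = 0 := by rw [sub_smul, one_smul, ← hμX, sub_self]
    exact (sub_eq_zero.1 ((smul_eq_zero.1 this).resolve_right hX0)).symm
  obtain ⟨a, b, hab⟩ := h.commutant X (by simpa [hμ1] using hint)
  rw [hab, map_add, map_smul, map_smul, h.fixedProj_p, h.fixedProj_q, ← hab] at hP
  exact hX0 hP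

end IsTwoBlock

/-- An operator on a finite-dimensional space all of whose eigenvalues lie inside the unit disc has
exponentially decaying powers. -/
theorem exists_pow_le_of_eigenvalues {V : Type*} [NormedAddCommGroup V] [NormedSpace ℂ V]
    [FiniteDimensional ℂ V] [Nontrivial V] (f : Module.End ℂ V)
    (hf : ∀ (μ : ℂ) (x : V), x ≠ 0 → f x = μ • x → ‖μ‖ < 1) :
    ∃ K r : ℝ, 0 < K ∧ 0 < r ∧ r < 1 ∧ ∀ (n : ℕ) (x : V), ‖(f ^ n) x‖ ≤ K * r ^ n * ‖x‖ := by
  have : CompleteSpace V := FiniteDimensional.complete ℂ V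
  set a : V →L[ℂ] V := LinearMap.toContinuousLinearMap f with hadef
  have ha : ∀ (μ : ℂ) (x : V), x ≠ 0 → a x = μ • x → ‖μ‖ < 1 := hf
  have hpow : ∀ (n : ℕ) (x : V), (f ^ n) x = (a ^ n) x := by
    intro n
    induction n with
    | zero => simp
    | succ n ih =>
      intro x
      rw [pow_succ, pow_succ]
      exact ih (f x)
  have hspec : ∀ k ∈ spectrum ℂ a, ‖k‖₊ < (1 : NNReal) := by
    intro k hk
    have hk' : k ∈ spectrum ℂ (a : V →ₗ[ℂ] V) := by
      rw [spectrum.mem_iff] at hk ⊢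
      contrapose! hk
      rw [Module.End.isUnit_iff] at hk
      rw [ContinuousLinearMap.isUnit_iff_bijective]
      exact hk
    rw [← Module.End.hasEigenvalue_iff_mem_spectrum] at hk'
    obtain ⟨x, hx⟩ := hk'.exists_hasEigenvector
    exact ha k x hx.2 hx.apply_eq_smul
  have hr : spectralRadius ℂ a < (1 : NNReal) := spectrum.spectralRadius_lt_of_forall_lt _ hspec
  obtain ⟨r, hr1, hr2⟩ := ENNReal.lt_iff_exists_nnreal_btwn.1 hr
  have hr2' : (r : ℝ) < 1 := by exact_mod_cast hr2
  have hr0 : 0 < (r : ℝ) := by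
    have : (0 : ENNReal) < r := lt_of_le_of_lt bot_le hr1
    exact_mod_cast this
  -- Gelfand's formula bounds `‖a ^ n‖` by `r ^ n` for large `n`; the constant `K` absorbs the
  -- finitely many remaining powers.
  have hg := spectrum.pow_nnnorm_pow_one_div_tendsto_nhds_spectralRadius a
  have hev : ∀ᶠ n : ℕ in atTop, ‖a ^ n‖ ≤ 1 * ‖(r : ℝ) ^ n‖ := by
    filter_upwards [hg.eventually_lt_const hr1, eventually_gt_atTop 0] with n hn hn0
    have hn0' : (n : ℝ) ≠ 0 := by positivity
    have h1 := ENNReal.rpow_le_rpow hn.le (Nat.cast_nonneg (α := ℝ) n)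
    rw [← ENNReal.rpow_mul, one_div, inv_mul_cancel₀ hn0', ENNReal.rpow_one,
      ENNReal.rpow_natCast] at h1
    have h2 : ‖a ^ n‖₊ ≤ r ^ n := by exact_mod_cast h1
    have h3 : ‖a ^ n‖ ≤ (r : ℝ) ^ n := by exact_mod_cast h2
    rw [Real.norm_of_nonneg (by positivity), one_mul]
    exact h3
  obtain ⟨K, hK0, hK⟩ := bound_of_isBigO_nat_atTop (IsBigO.of_bound 1 hev)
  refine ⟨K, r, hK0, hr0, hr2', fun n x => ?_⟩
  have := hK (x := n) (by positivity)
  rw [Real.norm_of_nonneg (by positivity)] at this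
  rw [hpow]
  exact (a ^ n).le_of_opNorm_le this x

/-- Linear maps between finite-dimensional spaces are bounded. -/
theorem exists_linearMap_bound {V W : Type*} [NormedAddCommGroup V] [NormedSpace ℂ V]
    [FiniteDimensional ℂ V] [NormedAddCommGroup W] [NormedSpace ℂ W] (f : V →ₗ[ℂ] W) :
    ∃ M : ℝ, 0 < M ∧ ∀ x, ‖f x‖ ≤ M * ‖x‖ := by
  refine ⟨‖LinearMap.toContinuousLinearMap f‖ + 1, by positivity, fun x => ?_⟩
  refine ((LinearMap.toContinuousLinearMap f).le_opNorm x).trans ?_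
  gcongr
  linarith

namespace IsTwoBlock

variable {C : Tensor κ ι} {p q Λ : Matrix ι ι ℂ}

/-- With `F` the fixed point projection, `EF = FE = F² = F`. The factor `1 - F` is what makes the
formula correct at `n = 0`. -/
theorem pow_sub_fixedProj (h : IsTwoBlock C p q Λ) (n : ℕ) :
    mixedTransfer C C ^ n - fixedProj p q Λ =
      (mixedTransfer C C - fixedProj p q Λ) ^ n * (1 - fixedProj p q Λ) := by
  set E := mixedTransfer C C
  set F := fixedProj p q Λ
  have h1 : E * F = F := LinearMap.ext h.transfer_fixedProj
  have h2 : F * E = F := LinearMap.ext h.fixedProj_transfer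
  have h3 : F * F = F := LinearMap.ext h.fixedProj_fixedProj
  induction n with
  | zero => simp
  | succ n ih =>
    rw [pow_succ' (E - F), mul_assoc, ← ih, mul_sub, sub_mul, sub_mul, h3, h1, ← pow_succ']
    have h5 : F * E ^ n = F := by
      clear ih
      induction n with
      | zero => simp
      | succ n ih => rw [pow_succ, ← mul_assoc, ih, h2]
    rw [h5]; abel

theorem nontrivial (h : IsTwoBlock C p q Λ) : Nontrivial (Matrix ι ι ℂ) := by
  refine ⟨p, 0, fun h0 => ?_⟩
  have := h.trace_p
  rw [h0] at this
  simp at this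

/-- Exponential convergence of the powers of the transfer operator to the fixed point projection. -/
theorem exists_pow_transfer_le (h : IsTwoBlock C p q Λ) :
    ∃ K r : ℝ, 0 < K ∧ 0 < r ∧ r < 1 ∧ ∀ (n : ℕ) (X : Matrix ι ι ℂ),
      ‖(mixedTransfer C C ^ n) X - fixedProj p q Λ X‖ ≤ K * r ^ n * ‖X‖ := by
  have := h.nontrivial
  obtain ⟨K, r, hK, hr0, hr1, hb⟩ := exists_pow_le_of_eigenvalues
    (mixedTransfer C C - fixedProj p q Λ) fun μ X hX0 hX => h.norm_eigenvalue_lt_one hX0 hX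
  obtain ⟨M, hM0, hM⟩ := exists_linearMap_bound (1 - fixedProj p q Λ)
  refine ⟨K * M, r, by positivity, hr0, hr1, fun n X => ?_⟩
  rw [← LinearMap.sub_apply, h.pow_sub_fixedProj, Module.End.mul_apply]
  calc _ ≤ (K * r ^ n) * (M * ‖X‖) := (hb n _).trans (by gcongr; exact hM X)
    _ = _ := by ring

/-- Powers of the transfer operator are bounded. -/
theorem exists_pow_transfer_bounded (h : IsTwoBlock C p q Λ) :
    ∃ M : ℝ, 0 < M ∧ ∀ (n : ℕ) (X : Matrix ι ι ℂ), ‖(mixedTransfer C C ^ n) X‖ ≤ M * ‖X‖ := by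
  obtain ⟨K, r, hK, hr0, hr1, hb⟩ := h.exists_pow_transfer_le
  obtain ⟨M, hM0, hM⟩ := exists_linearMap_bound (fixedProj p q Λ)
  refine ⟨K + M, by positivity, fun n X => ?_⟩
  calc ‖(mixedTransfer C C ^ n) X‖
      = ‖((mixedTransfer C C ^ n) X - fixedProj p q Λ X) + fixedProj p q Λ X‖ := by
        rw [sub_add_cancel]
    _ ≤ K * r ^ n * ‖X‖ + M * ‖X‖ := (norm_add_le _ _).trans (add_le_add (hb n X) (hM X))
    _ ≤ K * 1 * ‖X‖ + M * ‖X‖ := by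
        gcongr
        exact pow_le_one₀ hr0.le hr1.le
    _ = _ := by ring

/-- On off-diagonal blocks the powers of the transfer operator decay. -/
theorem exists_pow_transfer_offDiag_le (h : IsTwoBlock C p q Λ) :
    ∃ K r : ℝ, 0 < K ∧ 0 < r ∧ r < 1 ∧ ∀ (n : ℕ) (X : Matrix ι ι ℂ),
      p * X * q = X → ‖(mixedTransfer C C ^ n) X‖ ≤ K * r ^ n * ‖X‖ := by
  obtain ⟨K, r, hK, hr0, hr1, hb⟩ := h.exists_pow_transfer_le
  refine ⟨K, r, hK, hr0, hr1, fun n X hX => ?_⟩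
  have h1 : fixedProj p q Λ X = 0 := by rw [← hX, h.fixedProj_offDiag]
  simpa [h1] using hb n X

end IsTwoBlock

end Transfer

/-! ### Amplitudes of matrix product states -/

section Amplitude

theorem sum_fin_succ_fun {κ M : Type} [Fintype κ] [AddCommMonoid M] {n : ℕ}
    (F : (Fin (n + 1) → κ) → M) : ∑ s, F s = ∑ x, ∑ s, F (Fin.cons x s) := by
  rw [← Fintype.sum_prod_type']
  exact (Fintype.sum_equiv (Fin.consEquiv fun _ => κ) _ _ fun _ => rfl).symm

/-- The product `f (n-1) ⋯ f 1 f 0`. -/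
def seqProd {R : Type} [Monoid R] (f : ℕ → R) : ℕ → R
  | 0 => 1
  | n + 1 => f n * seqProd f n

/-- The product `T_{n-1}(s_0) ⋯ T_0(s_{n-1})` of site dependent tensors; sites are numbered from the
right. -/
def amp {κ R : Type} [Monoid R] (T : ℕ → κ → R) : (n : ℕ) → (Fin n → κ) → R
  | 0, _ => 1
  | n + 1, s => T n (s 0) * amp T n (Fin.tail s)

theorem amp_cons {κ R : Type} [Monoid R] (T : ℕ → κ → R) (n : ℕ) (x : κ) (s : Fin n → κ) :
    amp T (n + 1) (Fin.cons x s : Fin (n + 1) → κ) = T n x * amp T n s := rfl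

theorem amp_eq_prod {κ R : Type} [Monoid R] (T : ℕ → κ → R) (n : ℕ) (s : Fin n → κ) :
    (List.ofFn fun k : Fin n => T (n - 1 - k) (s k)).prod = amp T n s := by
  induction n with
  | zero => rfl
  | succ n ih =>
    rw [List.ofFn_succ, List.prod_cons, amp, ← ih]
    congr 3
    funext k
    congr 1
    rw [Fin.val_succ]
    omega

theorem seqProd_add {R : Type} [Monoid R] (f : ℕ → R) (a b : ℕ) :
    seqProd f (a + b) = seqProd (fun t => f (t + b)) a * seqProd f b := by
  induction a with
  | zero => simp [seqProd]
  | succ a ih => rw [Nat.succ_add, seqProd, ih, seqProd, mul_assoc]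

theorem seqProd_const {R : Type} [Monoid R] {f : ℕ → R} {n : ℕ} {c : R} (h : ∀ t < n, f t = c) :
    seqProd f n = c ^ n := by
  induction n with
  | zero => simp [seqProd]
  | succ n ih =>
    rw [seqProd, h n n.lt_succ_self, ih fun t ht => h t (ht.trans n.lt_succ_self), pow_succ']

/-- A product which is constant except at the positions `j < i`. -/
theorem seqProd_two_defects {R : Type} [Monoid R] {f : ℕ → R} {c : R} {i j n : ℕ} (hji : j < i)
    (hin : i < n) (hc : ∀ t, t ≠ i → t ≠ j → f t = c) :
    seqProd f n = c ^ (n - 1 - i) * f i * c ^ (i - 1 - j) * f j * c ^ j := by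
  obtain ⟨a, rfl⟩ : ∃ a, n = a + (i + 1) := ⟨n - (i + 1), by omega⟩
  obtain ⟨b, rfl⟩ : ∃ b, i = b + (j + 1) := ⟨i - (j + 1), by omega⟩
  rw [seqProd_add, seqProd, seqProd_add, seqProd,
    seqProd_const (n := a) (c := c) fun t _ => hc _ (by omega) (by omega),
    seqProd_const (n := b) (c := c) fun t _ => hc _ (by omega) (by omega),
    seqProd_const (n := j) (c := c) fun t _ => hc _ (by omega) (by omega)]
  have h1 : a + (b + (j + 1) + 1) - 1 - (b + (j + 1)) = a := by omega
  have h2 : b + (j + 1) - 1 - j = b := by omega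
  rw [h1, h2]
  simp only [mul_assoc]

theorem seqProd_eq_zero {R : Type} [MonoidWithZero R] {f : ℕ → R} {n t : ℕ} (ht : t < n)
    (h : f t = 0) : seqProd f n = 0 := by
  induction n with
  | zero => omega
  | succ n ih =>
    rw [seqProd]
    rcases Nat.lt_succ_iff_lt_or_eq.1 ht with h' | rfl
    · rw [ih h', mul_zero]
    · rw [h, zero_mul]

variable {κ ι : Type} [Fintype κ] [Fintype ι] [DecidableEq ι]

/-- Summing over the leftmost site wraps one more transfer operator around the rest. Numbering sites
from the right gives both recursions the same shape. -/
theorem sum_amp_mul (T S : ℕ → Tensor κ ι) (n : ℕ) (X : Matrix ι ι ℂ) :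
    ∑ s, amp T n s * X * (amp S n s).conjTranspose =
      seqProd (fun t => mixedTransfer (T t) (S t)) n X := by
  induction n with
  | zero => simp [amp, seqProd]
  | succ n ih =>
    rw [sum_fin_succ_fun, seqProd, Module.End.mul_apply, ← ih, mixedTransfer_apply]
    refine Finset.sum_congr rfl fun x _ => ?_
    rw [Finset.mul_sum, Finset.sum_mul]
    refine Finset.sum_congr rfl fun s _ => ?_
    rw [amp_cons, amp_cons, Matrix.conjTranspose_mul]
    simp only [Matrix.mul_assoc]

/-- The state `∑_s tr[T_{n-1}(s_0) ⋯ T_0(s_{n-1})] |s⟩`. -/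
def chainState {d : ℕ} (T : ℕ → Tensor (Fin d) ι) (n : ℕ) : ChainSpace d n :=
  WithLp.toLp 2 fun s => (amp T n s).trace

theorem siteState_eq_chainState {d n : ℕ} (T : ℕ → Tensor (Fin d) ι)
    (S : Fin n → Tensor (Fin d) ι) (h : ∀ k : Fin n, S k = T (n - 1 - k)) :
    siteState S = chainState T n := by
  ext s
  simp only [siteState, chainState, ← amp_eq_prod, h]

/-- The `(α, β)` entry of the sandwich is `U α α` times the conjugate of `W β β`; this form allows
`sum_amp_mul` to be applied to products of traces. -/
theorem trace_mul_star_trace (U W : Matrix ι ι ℂ) :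
    U.trace * star W.trace =
      ∑ α, ∑ β, (U * Matrix.single α β (1 : ℂ) * W.conjTranspose : Matrix ι ι ℂ) α β := by
  simp only [Matrix.trace, star_sum, Finset.sum_mul_sum]
  refine Finset.sum_congr rfl fun α _ => Finset.sum_congr rfl fun β _ => ?_
  simp [Matrix.mul_apply, Matrix.single_apply, ite_and, Finset.sum_ite_eq]

/-- Inner products of matrix product states as traces of products of transfer operators. -/
theorem inner_chainState {d : ℕ} (S T : ℕ → Tensor (Fin d) ι) (n : ℕ) :
    inner ℂ (chainState S n) (chainState T n) =
      ∑ α, ∑ β, seqProd (fun t => mixedTransfer (T t) (S t)) n (Matrix.single α β 1) α β := by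
  simp only [← sum_amp_mul, Matrix.sum_apply]
  rw [PiLp.inner_apply]
  simp only [chainState, RCLike.inner_apply]
  refine (Finset.sum_congr rfl fun s _ => trace_mul_star_trace (amp T n s) (amp S n s)).trans ?_
  rw [Finset.sum_comm]
  exact Finset.sum_congr rfl fun α _ => Finset.sum_comm

end Amplitude

/-! ### States with two domain walls -/

section Walls

variable {κ ι : Type} [Fintype ι] [DecidableEq ι]

/-- Upper triangular transfer matrices whose products collect the positions of two walls `R`, `L`
with weights `ρ`, `w`. -/
def triSites (C R L : Tensor κ ι) (ρ w : ℕ → ℂ) (t : ℕ) (x : κ) :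
    Matrix (Fin 3) (Fin 3) (Matrix ι ι ℂ) :=
  !![C x, ρ t • R x, 0; 0, C x, w t • L x; 0, 0, C x]

/-- The amplitude of the weighted sum over all positions of the wall `L`. -/
def oneWall (C L : Tensor κ ι) (w : ℕ → ℂ) : (n : ℕ) → (Fin n → κ) → Matrix ι ι ℂ
  | 0, _ => 0
  | n + 1, s => C (s 0) * oneWall C L w n (Fin.tail s)
      + w n • (L (s 0) * amp (fun _ => C) n (Fin.tail s))

/-- The amplitude of the weighted sum over all positions of the walls `R` and `L`, with `R` to the
left of `L`. -/
def twoWall (C R L : Tensor κ ι) (ρ w : ℕ → ℂ) : (n : ℕ) → (Fin n → κ) → Matrix ι ι ℂ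
  | 0, _ => 0
  | n + 1, s => C (s 0) * twoWall C R L ρ w n (Fin.tail s)
      + ρ n • (R (s 0) * oneWall C L w n (Fin.tail s))

variable {C R L : Tensor κ ι}

/-- A path from state `0` to state `2` takes the step `R` once and, further right, the step `L`
once. So the entry `(0, 2)` realizes a whole superposition of walls as one matrix product, to which
bondwise arguments apply. -/
theorem amp_triSites (ρ w : ℕ → ℂ) (n : ℕ) (s : Fin n → κ) :
    amp (triSites C R L ρ w) n s 2 0 = 0 ∧
    amp (triSites C R L ρ w) n s 2 1 = 0 ∧
    amp (triSites C R L ρ w) n s 2 2 = amp (fun _ => C) n s ∧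
    amp (triSites C R L ρ w) n s 1 2 = oneWall C L w n s ∧
    amp (triSites C R L ρ w) n s 0 2 = twoWall C R L ρ w n s := by
  induction n with
  | zero => simp [amp, oneWall, twoWall]
  | succ n ih =>
    obtain ⟨h0, h1, h2, h3, h4⟩ := ih (Fin.tail s)
    simp [amp, oneWall, twoWall, Matrix.mul_apply, Fin.sum_univ_three, triSites,
      h0, h1, h2, h3, h4]

theorem oneWall_sum {J : Type} (S : Finset J) (w : J → ℕ → ℂ) (n : ℕ) (s : Fin n → κ) :
    oneWall C L (fun t => ∑ j ∈ S, w j t) n s = ∑ j ∈ S, oneWall C L (w j) n s := by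
  induction n with
  | zero => simp [oneWall]
  | succ n ih => simp [oneWall, ih, Finset.sum_add_distrib, Finset.mul_sum, Finset.sum_smul]

theorem twoWall_sum_left {J : Type} (S : Finset J) (ρ : J → ℕ → ℂ) (w : ℕ → ℂ) (n : ℕ)
    (s : Fin n → κ) :
    twoWall C R L (fun t => ∑ j ∈ S, ρ j t) w n s = ∑ j ∈ S, twoWall C R L (ρ j) w n s := by
  induction n with
  | zero => simp [twoWall]
  | succ n ih => simp [twoWall, ih, Finset.sum_add_distrib, Finset.mul_sum, Finset.sum_smul]

theorem twoWall_sum_right {J : Type} (S : Finset J) (ρ : ℕ → ℂ) (w : J → ℕ → ℂ) (n : ℕ)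
    (s : Fin n → κ) :
    twoWall C R L ρ (fun t => ∑ j ∈ S, w j t) n s = ∑ j ∈ S, twoWall C R L ρ (w j) n s := by
  induction n with
  | zero => simp [twoWall]
  | succ n ih =>
    simp [twoWall, ih, oneWall_sum, Finset.sum_add_distrib, Finset.mul_sum, Finset.smul_sum]

theorem oneWall_sub (w w' : ℕ → ℂ) (n : ℕ) (s : Fin n → κ) :
    oneWall C L (w - w') n s = oneWall C L w n s - oneWall C L w' n s := by
  induction n with
  | zero => simp [oneWall]
  | succ n ih => simp only [oneWall, ih, mul_sub, sub_smul, Pi.sub_apply]; abel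

theorem twoWall_sub_left (ρ ρ' w : ℕ → ℂ) (n : ℕ) (s : Fin n → κ) :
    twoWall C R L (ρ - ρ') w n s = twoWall C R L ρ w n s - twoWall C R L ρ' w n s := by
  induction n with
  | zero => simp [twoWall]
  | succ n ih => simp only [twoWall, ih, mul_sub, sub_smul, Pi.sub_apply]; abel

theorem twoWall_sub_right (ρ w w' : ℕ → ℂ) (n : ℕ) (s : Fin n → κ) :
    twoWall C R L ρ (w - w') n s = twoWall C R L ρ w n s - twoWall C R L ρ w' n s := by
  induction n with
  | zero => simp [twoWall]
  | succ n ih => simp only [twoWall, ih, oneWall_sub, mul_sub, smul_sub]; abel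

/-- Site tensors with walls `R` and `L` at the sites `i` and `j`. -/
def wallSites (C R L : Tensor κ ι) (i j t : ℕ) : Tensor κ ι :=
  if t = i then R else if t = j then L else C

/-- Single-position weights recover one wall configuration; bilinearity in the weights then gives
arbitrary rectangular sums. The induction runs from the right end through the wall `L` at `j` to the
wall `R` at `i`. -/
theorem twoWall_single {i j n : ℕ} (hji : j < i) (hin : i < n) (s : Fin n → κ) :
    twoWall C R L (Pi.single i 1) (Pi.single j 1) n s = amp (wallSites C R L i j) n s := by
  have h1 : ∀ n ≤ j, ∀ s : Fin n → κ, oneWall C L (Pi.single j 1) n s = 0 := by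
    intro n hn
    induction n with
    | zero => simp [oneWall]
    | succ n ih =>
      intro s
      have : n ≠ j := by omega
      simp [oneWall, ih (by omega), this]
  have h2 : ∀ n ≤ i, ∀ s : Fin n → κ,
      twoWall C R L (Pi.single i 1) (Pi.single j 1) n s = 0 := by
    intro n hn
    induction n with
    | zero => simp [twoWall]
    | succ n ih =>
      intro s
      have : n ≠ i := by omega
      simp [twoWall, ih (by omega), this]
  have h3 : ∀ n ≤ j, ∀ s : Fin n → κ, amp (wallSites C R L i j) n s = amp (fun _ => C) n s := by
    intro n hn
    induction n with
    | zero => simp [amp]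
    | succ n ih =>
      intro s
      have hni : n ≠ i := by omega
      have hnj : n ≠ j := by omega
      simp [amp, wallSites, ih (by omega), hni, hnj]
  have h4 : ∀ n, j < n → n ≤ i → ∀ s : Fin n → κ,
      oneWall C L (Pi.single j 1) n s = amp (wallSites C R L i j) n s := by
    intro n hjn hni
    induction n with
    | zero => omega
    | succ n ih =>
      intro s
      have hni' : n ≠ i := by omega
      rcases Nat.lt_succ_iff_lt_or_eq.1 hjn with h | rfl
      · have hnj : n ≠ j := by omega
        simp [amp, oneWall, wallSites, ih h (by omega), hni', hnj]
      · simp [amp, oneWall, wallSites, h1, h3, hni']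
  induction n with
  | zero => omega
  | succ n ih =>
    rcases Nat.lt_succ_iff_lt_or_eq.1 hin with h | rfl
    · have hni : n ≠ i := by omega
      have hnj : n ≠ j := by omega
      simp [amp, twoWall, wallSites, ih h, hni, hnj]
    · simp [amp, twoWall, wallSites, h2, h4 i hji le_rfl]

/-- The unnormalized superposition of domain wall states with weights `ρ`, `w`. -/
def wallState {d : ℕ} (C R L : Tensor (Fin d) ι) (ρ w : ℕ → ℂ) (n : ℕ) : ChainSpace d n :=
  WithLp.toLp 2 fun s => (twoWall C R L ρ w n s).trace

theorem wallState_indicator {d : ℕ} (C R L : Tensor (Fin d) ι) (I J : Finset ℕ) (n : ℕ)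
    (hIJ : ∀ i ∈ I, ∀ j ∈ J, j < i) (hI : ∀ i ∈ I, i < n) :
    wallState C R L (fun t => if t ∈ I then 1 else 0) (fun t => if t ∈ J then 1 else 0) n =
      ∑ i ∈ I, ∑ j ∈ J, chainState (wallSites C R L i j) n := by
  have e : ∀ K : Finset ℕ, (fun t => if t ∈ K then (1 : ℂ) else 0) =
      fun t => ∑ i ∈ K, (Pi.single i 1 : ℕ → ℂ) t := by
    intro K; funext t; simp [Pi.single_apply]
  ext s
  rw [e I, e J]
  simp only [wallState, WithLp.ofLp_sum, Finset.sum_apply, chainState]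
  rw [twoWall_sum_left, Matrix.trace_sum]
  refine Finset.sum_congr rfl fun i hi => ?_
  rw [twoWall_sum_right, Matrix.trace_sum]
  refine Finset.sum_congr rfl fun j hj => ?_
  rw [twoWall_single (hIJ i hi j hj) (hI i hi)]

end Walls

/-! ### Norm bounds for superpositions of domain walls -/

section GramBound

attribute [local instance] Matrix.normedAddCommGroup Matrix.normedSpace

variable {κ ι : Type} [Fintype κ] [Fintype ι] [DecidableEq ι]

theorem eq_sum_pow_of_recursion {V : Type*} [AddCommGroup V] [Module ℂ V] (E : Module.End ℂ V)
    (x y : ℕ → V) (h0 : x 0 = 0) (h : ∀ n, x (n + 1) = E (x n) + y n) (n : ℕ) :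
    x n = ∑ k ∈ Finset.range n, (E ^ (n - 1 - k)) (y k) := by
  induction n with
  | zero => simp [h0]
  | succ n ih =>
    rw [h, ih, Finset.sum_range_succ, map_sum]
    congr 1
    · refine Finset.sum_congr rfl fun k hk => ?_
      have hk' := Finset.mem_range.1 hk
      have : n + 1 - 1 - k = (n - 1 - k) + 1 := by omega
      rw [this, pow_succ', Module.End.mul_apply]
    · simp

namespace IsTwoBlock

variable {C : Tensor κ ι} {p q Λ : Matrix ι ι ℂ}

theorem mixedTransfer_offDiag (h : IsTwoBlock C p q Λ) {R : Tensor κ ι}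
    (hR : ∀ x, p * R x * q = R x) {X : Matrix ι ι ℂ} (hX : q * X * q = X) :
    p * mixedTransfer R C X * q = mixedTransfer R C X := by
  have hXq : X * q = X := by
    rw [← hX, Matrix.mul_assoc, h.qq]
  have hpR : ∀ x, p * R x = R x := fun x => by
    rw [← hR x, ← Matrix.mul_assoc, ← Matrix.mul_assoc, h.pp]
  rw [mixedTransfer_apply, Finset.mul_sum, Finset.sum_mul]
  refine Finset.sum_congr rfl fun x _ => ?_
  calc p * (R x * X * (C x).conjTranspose) * q
      = (p * R x) * X * ((C x).conjTranspose * q) := by simp only [Matrix.mul_assoc]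
    _ = R x * (X * q) * (C x).conjTranspose := by
        rw [hpR, h.symm.comm_star_p]; simp only [Matrix.mul_assoc]
    _ = _ := by rw [hXq]

/-- A source inserting walls with weights `ρ` into amplitudes of Gram matrix `γ` creates Gram
matrices that grow at most linearly in the total weight. -/
theorem exists_gram_bound (h : IsTwoBlock C p q Λ) {R : Tensor κ ι}
    (hR : ∀ x, p * R x * q = R x) :
    ∃ K : ℝ, 0 < K ∧ ∀ (ρ : ℕ → ℂ) (γ D G : ℕ → Matrix ι ι ℂ) (Γ : ℝ),
      (∀ t, ‖ρ t‖ ≤ 1) → D 0 = 0 → G 0 = 0 → (∀ n, q * γ n * q = γ n) → (∀ n, ‖γ n‖ ≤ Γ) →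
      (∀ n, D (n + 1) = mixedTransfer C C (D n) + ρ n • mixedTransfer R C (γ n)) →
      (∀ n, G (n + 1) = mixedTransfer C C (G n) + (star (ρ n) • mixedTransfer C R (D n)
        + ρ n • mixedTransfer R C (D n).conjTranspose
        + (ρ n * star (ρ n)) • mixedTransfer R R (γ n))) →
      ∀ n, ‖G n‖ ≤ K * Γ * ∑ t ∈ Finset.range n, ‖ρ t‖ := by
  obtain ⟨K₁, r, hK₁, hr0, hr1, hdec⟩ := h.exists_pow_transfer_offDiag_le
  obtain ⟨M, hM0, hM⟩ := h.exists_pow_transfer_bounded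
  obtain ⟨a, ha0, ha⟩ := exists_linearMap_bound (mixedTransfer R C)
  obtain ⟨b, hb0, hb⟩ := exists_linearMap_bound (mixedTransfer C R)
  obtain ⟨c, hc0, hc⟩ := exists_linearMap_bound (mixedTransfer R R)
  have h1r : 0 < 1 - r := by linarith
  set K₂ : ℝ := K₁ * a * (1 - r)⁻¹ with hK₂
  have hK₂0 : 0 < K₂ := by positivity
  refine ⟨M * (b * K₂ + a * K₂ + c), by positivity, ?_⟩
  intro ρ γ D G Γ hρ hD0 hG0 hγq hγ hD hG n
  have hΓ : 0 ≤ Γ := (norm_nonneg _).trans (hγ 0)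
  -- The sources of `D` lie in the off-diagonal block, where transfer powers decay. Summing over
  -- insertion points is a geometric series, so the bound does not depend on `n`.
  have hDb : ∀ n, ‖D n‖ ≤ K₂ * Γ := by
    intro n
    rw [eq_sum_pow_of_recursion _ D _ hD0 hD n]
    calc ‖∑ k ∈ Finset.range n, (mixedTransfer C C ^ (n - 1 - k))
            (ρ k • mixedTransfer R C (γ k))‖
        ≤ ∑ k ∈ Finset.range n, (K₁ * a * Γ) * r ^ (n - 1 - k) := by
          refine norm_sum_le_of_le _ fun k _ => ?_
          rw [map_smul, norm_smul]
          have h1 := hdec (n - 1 - k) _ (h.mixedTransfer_offDiag hR (hγq k))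
          calc ‖ρ k‖ * _ ≤ 1 * (K₁ * r ^ (n - 1 - k) * (a * Γ)) := by
                gcongr
                · exact hρ k
                · refine h1.trans ?_
                  gcongr
                  exact (ha _).trans (by gcongr; exact hγ k)
            _ = _ := by ring
      _ = (K₁ * a * Γ) * ∑ k ∈ Finset.range n, r ^ k := by
          rw [← Finset.mul_sum, Finset.sum_range_reflect (fun k => r ^ k) n]
      _ ≤ (K₁ * a * Γ) * (1 - r)⁻¹ := by
          gcongr
          rw [← tsum_geometric_of_lt_one hr0.le hr1]
          exact (summable_geometric_of_lt_one hr0.le hr1).sum_le_tsum _ fun _ _ => by positivity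
      _ = K₂ * Γ := by rw [hK₂]; ring
  -- Each source of `G` has size `O(‖ρ k‖ Γ)` and later transfer powers are uniformly bounded, so
  -- the contributions add up to the total weight.
  rw [eq_sum_pow_of_recursion _ G _ hG0 hG n, Finset.mul_sum]
  refine norm_sum_le_of_le _ fun k _ => (hM _ _).trans ?_
  have e1 : ‖star (ρ k) • mixedTransfer C R (D k)‖ ≤ ‖ρ k‖ * (b * (K₂ * Γ)) := by
    rw [norm_smul, norm_star]
    gcongr
    exact (hb _).trans (by gcongr; exact hDb k)
  have e2 : ‖ρ k • mixedTransfer R C (D k).conjTranspose‖ ≤ ‖ρ k‖ * (a * (K₂ * Γ)) := by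
    rw [norm_smul]
    gcongr
    exact (ha _).trans (by rw [Matrix.norm_conjTranspose]; gcongr; exact hDb k)
  have e3 : ‖(ρ k * star (ρ k)) • mixedTransfer R R (γ k)‖ ≤ ‖ρ k‖ * (c * Γ) := by
    rw [norm_smul, norm_mul, norm_star]
    calc ‖ρ k‖ * ‖ρ k‖ * _ ≤ ‖ρ k‖ * 1 * (c * Γ) := by
          gcongr
          · exact hρ k
          · exact (hc _).trans (by gcongr; exact hγ k)
      _ = _ := by ring
  calc M * _ ≤ M * (‖ρ k‖ * (b * (K₂ * Γ)) + ‖ρ k‖ * (a * (K₂ * Γ)) + ‖ρ k‖ * (c * Γ)) := by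
        gcongr
        exact (norm_add_le _ _).trans (add_le_add ((norm_add_le _ _).trans (add_le_add e1 e2)) e3)
    _ = _ := by ring

end IsTwoBlock

/-- The mixed Gram matrix of two families of matrices. -/
def gramSum {n : ℕ} (p : Matrix ι ι ℂ) (f g : (Fin n → κ) → Matrix ι ι ℂ) : Matrix ι ι ℂ :=
  ∑ s, f s * p * (g s).conjTranspose

theorem gramSum_conjTranspose {κ ι : Type} [Fintype κ] [Fintype ι] {n : ℕ} {p : Matrix ι ι ℂ} (hp : p.conjTranspose = p)
    (f g : (Fin n → κ) → Matrix ι ι ℂ) :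
    (gramSum p f g).conjTranspose = gramSum p g f := by
  simp [gramSum, Matrix.conjTranspose_sum, hp, Matrix.mul_assoc]

theorem gramSum_succ {n : ℕ} (p : Matrix ι ι ℂ) (S₁ S₂ T₁ T₂ : Tensor κ ι) (a b : ℂ)
    (f f' g g' : (Fin n → κ) → Matrix ι ι ℂ) :
    gramSum p (fun s : Fin (n + 1) → κ => S₁ (s 0) * f (Fin.tail s) + a • (S₂ (s 0) * f' (Fin.tail s)))
        (fun s => T₁ (s 0) * g (Fin.tail s) + b • (T₂ (s 0) * g' (Fin.tail s))) =
      mixedTransfer S₁ T₁ (gramSum p f g) + star b • mixedTransfer S₁ T₂ (gramSum p f g')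
        + a • mixedTransfer S₂ T₁ (gramSum p f' g)
        + (a * star b) • mixedTransfer S₂ T₂ (gramSum p f' g') := by
  simp only [gramSum]
  rw [sum_fin_succ_fun]
  simp only [Fin.cons_zero, Fin.tail_cons, mixedTransfer_apply, Finset.mul_sum, Finset.sum_mul,
    Finset.smul_sum, ← Finset.sum_add_distrib]
  refine Finset.sum_congr rfl fun x _ => Finset.sum_congr rfl fun s _ => ?_
  simp only [Matrix.conjTranspose_add, Matrix.conjTranspose_smul, Matrix.conjTranspose_mul,
    add_mul, mul_add, Matrix.smul_mul, Matrix.mul_smul, Matrix.mul_assoc, smul_smul,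
    mul_comm a (star b)]
  abel

theorem gramSum_amp {n : ℕ} (C : Tensor κ ι) (p : Matrix ι ι ℂ) :
    gramSum p (amp (fun _ => C) n) (amp (fun _ => C) n) = (mixedTransfer C C ^ n) p := by
  rw [gramSum, sum_amp_mul, seqProd_const (c := mixedTransfer C C) fun _ _ => rfl]

theorem twoWall_eq_zero {κ : Type} {C R L : Tensor κ ι} {ρ w : ℕ → ℂ} {n : ℕ} (h : ∀ t < n, ρ t = 0)
    (s : Fin n → κ) : twoWall C R L ρ w n s = 0 := by
  induction n with
  | zero => rfl
  | succ n ih =>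
    simp [twoWall, ih fun t ht => h t (ht.trans n.lt_succ_self), h n n.lt_succ_self]

namespace IsTwoBlock

variable {C R L : Tensor κ ι} {p q Λ : Matrix ι ι ℂ}

theorem mul_oneWall (h : IsTwoBlock C p q Λ) (hL : ∀ x, q * L x * p = L x) (w : ℕ → ℂ) (n : ℕ)
    (s : Fin n → κ) : q * oneWall C L w n s = oneWall C L w n s := by
  have hqL : ∀ x, q * L x = L x := fun x => by
    rw [← hL x, ← Matrix.mul_assoc, ← Matrix.mul_assoc, h.qq]
  induction n with
  | zero => simp [oneWall]
  | succ n ih =>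
    rw [oneWall, mul_add, ← Matrix.mul_assoc, ← h.comm_q, Matrix.mul_assoc, ih, Matrix.mul_smul,
      ← Matrix.mul_assoc, hqL]

theorem amp_mul_comm (h : IsTwoBlock C p q Λ) (n : ℕ) (s : Fin n → κ) :
    amp (fun _ => C) n s * p = p * amp (fun _ => C) n s := by
  induction n with
  | zero => simp [amp]
  | succ n ih => rw [amp, Matrix.mul_assoc, ih, ← Matrix.mul_assoc, h.comm_p, Matrix.mul_assoc]

theorem oneWall_mul (h : IsTwoBlock C p q Λ) (hL : ∀ x, q * L x * p = L x) (w : ℕ → ℂ) (n : ℕ)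
    (s : Fin n → κ) : oneWall C L w n s * p = oneWall C L w n s := by
  have hLp : ∀ x, L x * p = L x := fun x => by rw [← hL x, Matrix.mul_assoc, h.pp]
  induction n with
  | zero => simp [oneWall]
  | succ n ih =>
    rw [oneWall, add_mul, Matrix.mul_assoc, ih, Matrix.smul_mul, Matrix.mul_assoc, h.amp_mul_comm,
      ← Matrix.mul_assoc, hLp]

theorem twoWall_mul (h : IsTwoBlock C p q Λ) (hL : ∀ x, q * L x * p = L x) (ρ w : ℕ → ℂ) (n : ℕ)
    (s : Fin n → κ) : twoWall C R L ρ w n s * p = twoWall C R L ρ w n s := by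
  induction n with
  | zero => simp [twoWall]
  | succ n ih =>
    rw [twoWall, add_mul, Matrix.mul_assoc, ih, Matrix.smul_mul, Matrix.mul_assoc,
      h.oneWall_mul hL]

/-- The Gram matrix of a superposition of two domain walls is bounded by the product of the total
weights. -/
theorem exists_gramSum_twoWall_le (h : IsTwoBlock C p q Λ) (hR : ∀ x, p * R x * q = R x)
    (hL : ∀ x, q * L x * p = L x) :
    ∃ K : ℝ, 0 < K ∧ ∀ ρ w : ℕ → ℂ, (∀ t, ‖ρ t‖ ≤ 1) → (∀ t, ‖w t‖ ≤ 1) →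
      (∀ t u, u ≤ t → w t ≠ 0 → ρ u = 0) → ∀ (W : ℝ), (∀ n, ∑ t ∈ Finset.range n, ‖w t‖ ≤ W) →
      ∀ n, ‖gramSum p (twoWall C R L ρ w n) (twoWall C R L ρ w n)‖ ≤
        K * W * ∑ t ∈ Finset.range n, ‖ρ t‖ := by
  obtain ⟨K₁, hK₁, hb₁⟩ := h.symm.exists_gram_bound hL
  obtain ⟨K₂, hK₂, hb₂⟩ := h.exists_gram_bound hR
  refine ⟨K₂ * (K₁ * (‖p‖ + 1)), by positivity, fun ρ w hρ hw hsep W hW n => ?_⟩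
  have hγ : ∀ n, gramSum p (amp (fun _ => C) n) (amp (fun _ => C) n) = p := by
    intro n
    rw [gramSum_amp]
    induction n with
    | zero => simp
    | succ n ih => rw [pow_succ', Module.End.mul_apply, ih, h.transfer_p]
  -- Inner layer: `L` is inserted into wall-free amplitudes, whose Gram matrix is constantly `p`.
  -- Since `L` maps block `p` to block `q`, the bound is used with the two blocks exchanged.
  have h1 := hb₁ w (fun n => gramSum p (amp (fun _ => C) n) (amp (fun _ => C) n))
    (fun n => gramSum p (oneWall C L w n) (amp (fun _ => C) n))
    (fun n => gramSum p (oneWall C L w n) (oneWall C L w n)) ‖p‖ hw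
    (by simp [gramSum, oneWall]) (by simp [gramSum, oneWall])
    (fun n => by simp only [hγ, h.pp]) (fun n => by rw [hγ])
    (fun n => by
      have := gramSum_succ p C L C C (w n) 0 (oneWall C L w n) (amp (fun _ => C) n)
        (amp (fun _ => C) n) (amp (fun _ => C) n)
      simp only [zero_smul, add_zero, star_zero, mul_zero] at this
      exact this)
    (fun n => by
      rw [gramSum_conjTranspose h.p_star]
      have := gramSum_succ p C L C L (w n) (w n) (oneWall C L w n) (amp (fun _ => C) n)
        (oneWall C L w n) (amp (fun _ => C) n)
      exact this.trans (by abel))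
  have hvb : ∀ n, ‖gramSum p (oneWall C L w n) (oneWall C L w n)‖ ≤ K₁ * ‖p‖ * W := fun n =>
    (h1 n).trans (by gcongr; exact hW n)
  -- Outer layer: `R` is inserted into the one-wall amplitudes, whose Gram matrices lie in the block
  -- `q` and are bounded by the total weight of `L`.
  have h2 := hb₂ ρ (fun n => gramSum p (oneWall C L w n) (oneWall C L w n))
    (fun n => gramSum p (twoWall C R L ρ w n) (oneWall C L w n))
    (fun n => gramSum p (twoWall C R L ρ w n) (twoWall C R L ρ w n)) (K₁ * ‖p‖ * W) hρ
    (by simp [gramSum, twoWall]) (by simp [gramSum, twoWall])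
    (fun n => by
      simp only [gramSum, Finset.mul_sum, Finset.sum_mul]
      refine Finset.sum_congr rfl fun s _ => ?_
      have e : (oneWall C L w n s).conjTranspose * q = (oneWall C L w n s).conjTranspose := by
        conv_rhs => rw [← h.mul_oneWall hL w n s, Matrix.conjTranspose_mul, h.q_star]
      calc _ = (q * oneWall C L w n s) * p * ((oneWall C L w n s).conjTranspose * q) := by
            simp only [Matrix.mul_assoc]
        _ = _ := by rw [e, h.mul_oneWall hL])
    hvb
    (fun n => by
      have := gramSum_succ p C R C L (ρ n) (w n) (twoWall C R L ρ w n) (oneWall C L w n)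
        (oneWall C L w n) (amp (fun _ => C) n)
      refine this.trans ?_
      -- The recursion also produces terms with `L` inserted at site `n`. Separation of the walls
      -- kills them: if `w n ≠ 0`, no `R` sits at site `n` or to its right.
      by_cases hwn : w n = 0
      · simp [hwn]
      · have hρn : ρ n = 0 := hsep n n le_rfl hwn
        have hz : twoWall C R L ρ w n = fun _ => 0 :=
          funext fun s => twoWall_eq_zero (fun t ht => hsep n t ht.le hwn) s
        simp [hρn, hz, gramSum])
    (fun n => by
      rw [gramSum_conjTranspose h.p_star]
      have := gramSum_succ p C R C R (ρ n) (ρ n) (twoWall C R L ρ w n) (oneWall C L w n)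
        (twoWall C R L ρ w n) (oneWall C L w n)
      exact this.trans (by abel))
  refine (h2 n).trans ?_
  have hW0 : 0 ≤ W := by simpa using hW 0
  have : K₂ * (K₁ * ‖p‖ * W) ≤ K₂ * (K₁ * (‖p‖ + 1)) * W := by
    rw [mul_assoc K₂]
    gcongr
    linarith
  gcongr

end IsTwoBlock

/-- Cauchy–Schwarz on the diagonal, together with the fact that a row's squared norm dominates its
diagonal entry. -/
theorem norm_trace_sq_le {ι : Type} [Fintype ι] (Z : Matrix ι ι ℂ) :
    ‖Z.trace‖ ^ 2 ≤ Fintype.card ι * ∑ α, ‖(Z * Z.conjTranspose) α α‖ := by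
  have h1 : ∀ α, ‖Z α α‖ ^ 2 ≤ ‖(Z * Z.conjTranspose) α α‖ := by
    intro α
    have : (Z * Z.conjTranspose) α α = ((∑ β, ‖Z α β‖ ^ 2 : ℝ) : ℂ) := by
      rw [Matrix.mul_apply]
      push_cast
      refine Finset.sum_congr rfl fun β _ => ?_
      rw [Matrix.conjTranspose_apply, Complex.star_def, Complex.mul_conj, Complex.normSq_eq_norm_sq]
      push_cast; ring
    rw [this, Complex.norm_real, Real.norm_of_nonneg (by positivity)]
    exact Finset.single_le_sum (f := fun β => ‖Z α β‖ ^ 2) (fun _ _ => by positivity)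
      (Finset.mem_univ α)
  calc ‖Z.trace‖ ^ 2 ≤ (∑ α, ‖Z α α‖) ^ 2 := by
        gcongr
        exact norm_sum_le _ _
    _ ≤ Fintype.card ι * ∑ α, ‖Z α α‖ ^ 2 := sq_sum_le_card_mul_sum_sq
    _ ≤ _ := by gcongr with α; exact h1 α

/-- The squared norm of a superposition of domain wall states is bounded by the product of the
total weights. -/
theorem IsTwoBlock.exists_norm_wallState_le {d : ℕ} {C R L : Tensor (Fin d) ι}
    {p q Λ : Matrix ι ι ℂ} (h : IsTwoBlock C p q Λ) (hR : ∀ x, p * R x * q = R x)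
    (hL : ∀ x, q * L x * p = L x) :
    ∃ K : ℝ, 0 < K ∧ ∀ ρ w : ℕ → ℂ, (∀ t, ‖ρ t‖ ≤ 1) → (∀ t, ‖w t‖ ≤ 1) →
      (∀ t u, u ≤ t → w t ≠ 0 → ρ u = 0) → ∀ (W : ℝ), (∀ n, ∑ t ∈ Finset.range n, ‖w t‖ ≤ W) →
      ∀ n, ‖wallState C R L ρ w n‖ ^ 2 ≤ K * W * ∑ t ∈ Finset.range n, ‖ρ t‖ := by
  obtain ⟨K, hK, hb⟩ := h.exists_gramSum_twoWall_le hR hL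
  refine ⟨(Fintype.card ι + 1) * ((Fintype.card ι + 1) * K), by positivity,
    fun ρ w hρ hw hsep W hW n => ?_⟩
  set z := twoWall C R L ρ w n with hz
  set B := K * W * ∑ t ∈ Finset.range n, ‖ρ t‖ with hB
  have hG : ‖gramSum p z z‖ ≤ B := hb ρ w hρ hw hsep W hW n
  have hB0 : 0 ≤ B := (norm_nonneg _).trans hG
  have hgram : gramSum p z z = ∑ s, z s * (z s).conjTranspose := by
    refine Finset.sum_congr rfl fun s _ => ?_
    rw [hz, h.twoWall_mul hL]
  -- Diagonal entries of `z z*` are nonnegative, so no cancellation occurs and the entry of the Gram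
  -- matrix controls the sum of norms.
  have hdiag : ∀ α, ∑ s, ‖(z s * (z s).conjTranspose) α α‖ = ‖gramSum p z z α α‖ := by
    intro α
    have hnn : ∀ s, 0 ≤ (z s * (z s).conjTranspose) α α := fun s =>
      (Matrix.posSemidef_self_mul_conjTranspose (z s)).diag_nonneg
    have e : ∀ c : ℂ, 0 ≤ c → ‖c‖ = c.re := fun c hc => by
      rw [← Complex.re_eq_norm] at hc; exact hc.symm
    rw [hgram, Matrix.sum_apply, e _ (Finset.sum_nonneg fun s _ => hnn s), Complex.re_sum]
    exact Finset.sum_congr rfl fun s _ => e _ (hnn s)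
  rw [EuclideanSpace.norm_sq_eq]
  calc ∑ s, ‖(z s).trace‖ ^ 2
      ≤ ∑ s, Fintype.card ι * ∑ α, ‖(z s * (z s).conjTranspose) α α‖ :=
        Finset.sum_le_sum fun s _ => norm_trace_sq_le (z s)
    _ = Fintype.card ι * ∑ α, ‖gramSum p z z α α‖ := by
        rw [← Finset.mul_sum, Finset.sum_comm]
        simp only [hdiag]
    _ ≤ Fintype.card ι * ∑ _α : ι, B := by
        gcongr with α
        exact (Matrix.norm_entry_le_entrywise_sup_norm _).trans hG
    _ = Fintype.card ι * (Fintype.card ι * B) := by simp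
    _ ≤ (Fintype.card ι + 1) * ((Fintype.card ι + 1) * B) := by
        gcongr <;> linarith
    _ = _ := by rw [hB]; ring

end GramBound

/-! ### Local terms -/

section LocalTerm

variable {d n : ℕ}

/-- The restriction of a chain vector to the sites `a`, `b`, all other sites being frozen in the
configuration `s`. -/
def slice (a b : Fin n) (s : Fin n → Fin d) (ψ : ChainSpace d n) :
    EuclideanSpace ℂ (Fin d × Fin d) :=
  WithLp.toLp 2 fun p => ψ (Function.update (Function.update s a p.1) b p.2)

theorem localTerm_apply (h : EuclideanSpace ℂ (Fin d × Fin d) →L[ℂ] EuclideanSpace ℂ (Fin d × Fin d))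
    (a b : Fin n) (ψ : ChainSpace d n) (s : Fin n → Fin d) :
    localTerm h a b ψ s = h (slice a b s ψ) (s a, s b) := rfl

theorem slice_update (a b : Fin n) (s : Fin n → Fin d) (x y : Fin d) (ψ : ChainSpace d n) :
    slice a b (Function.update (Function.update s a x) b y) ψ = slice a b s ψ := by
  ext p
  simp only [slice]
  refine congrArg ψ.ofLp (funext fun k => ?_)
  by_cases hb : k = b
  · subst hb; simp
  · by_cases ha : k = a
    · subst ha; simp [hb]
    · simp [ha, hb]

theorem slice_localTerm
    (h : EuclideanSpace ℂ (Fin d × Fin d) →L[ℂ] EuclideanSpace ℂ (Fin d × Fin d))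
    {a b : Fin n} (hab : a ≠ b) (s : Fin n → Fin d) (ψ : ChainSpace d n) :
    slice a b s (localTerm h a b ψ) = h (slice a b s ψ) := by
  ext p
  have : slice a b s (localTerm h a b ψ) p =
      localTerm h a b ψ (Function.update (Function.update s a p.1) b p.2) := rfl
  rw [this, localTerm_apply, slice_update]
  simp [hab]

/-- Exchanging the value at `a` with the extra value `x` is an involution, so every configuration is
counted exactly `d` times. -/
theorem sum_update (a : Fin n) (F : (Fin n → Fin d) → ℂ) :
    ∑ s, ∑ x, F (Function.update s a x) = d * ∑ s, F s := by
  let σ : (Fin n → Fin d) × Fin d → (Fin n → Fin d) × Fin d :=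
    fun z => (Function.update z.1 a z.2, z.1 a)
  have hσ : Function.Involutive σ := by
    rintro ⟨s, x⟩
    simp [σ]
  rw [← Fintype.sum_prod_type']
  have h1 := Fintype.sum_equiv hσ.toPerm (fun z => F (Function.update z.1 a z.2))
    (fun z : (Fin n → Fin d) × Fin d => F z.1) fun z => rfl
  rw [h1, Fintype.sum_prod_type]
  simp [Finset.mul_sum]

theorem sum_update_update (a b : Fin n) (F : (Fin n → Fin d) → ℂ) :
    ∑ s, ∑ p : Fin d × Fin d, F (Function.update (Function.update s a p.1) b p.2) =
      (d : ℂ) ^ 2 * ∑ s, F s := by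
  simp only [Fintype.sum_prod_type]
  have := sum_update a fun s => ∑ y, F (Function.update s b y)
  rw [this, sum_update b F]
  ring

/-- Up to the overcounting factor `d ^ 2`, slicing is an isometry into copies of the two-site space.
Symmetry of local terms is thereby read off from the two-site projector. -/
theorem sum_inner_slice (a b : Fin n) (ψ χ : ChainSpace d n) :
    ∑ s, inner ℂ (slice a b s ψ) (slice a b s χ) = (d : ℂ) ^ 2 * inner ℂ ψ χ := by
  simp only [PiLp.inner_apply, slice]
  exact sum_update_update a b fun s => inner ℂ (ψ s) (χ s)

variable (W : Submodule ℂ (EuclideanSpace ℂ (Fin d × Fin d)))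

theorem isSymmetric_localTerm (hd : 0 < d) {a b : Fin n} (hab : a ≠ b) (ψ χ : ChainSpace d n) :
    inner ℂ (localTerm Wᗮ.starProjection a b ψ) χ =
      inner ℂ ψ (localTerm Wᗮ.starProjection a b χ) := by
  have hd' : (d : ℂ) ^ 2 ≠ 0 := by positivity
  apply mul_left_cancel₀ hd'
  rw [← sum_inner_slice a b, ← sum_inner_slice a b]
  refine Finset.sum_congr rfl fun s _ => ?_
  rw [slice_localTerm _ hab, slice_localTerm _ hab]
  exact Submodule.starProjection_isSymmetric Wᗮ _ _

theorem localTerm_localTerm {a b : Fin n} (hab : a ≠ b) (ψ : ChainSpace d n) :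
    localTerm Wᗮ.starProjection a b (localTerm Wᗮ.starProjection a b ψ) =
      localTerm Wᗮ.starProjection a b ψ := by
  ext s
  rw [localTerm_apply, slice_localTerm _ hab, localTerm_apply]
  have : Wᗮ.starProjection (Wᗮ.starProjection (slice a b s ψ)) =
      Wᗮ.starProjection (slice a b s ψ) :=
    DFunLike.congr_fun (Submodule.isIdempotentElem_starProjection Wᗮ) (slice a b s ψ)
  rw [this]

theorem inner_localTerm (hd : 0 < d) {a b : Fin n} (hab : a ≠ b) (ψ : ChainSpace d n) :
    inner ℂ ψ (localTerm Wᗮ.starProjection a b ψ) =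
      ((‖localTerm Wᗮ.starProjection a b ψ‖ ^ 2 : ℝ) : ℂ) := by
  rw [← localTerm_localTerm W hab, ← isSymmetric_localTerm W hd hab, localTerm_localTerm W hab,
    inner_self_eq_norm_sq_to_K]
  push_cast
  rfl

theorem norm_localTerm_le (hd : 0 < d) {a b : Fin n} (hab : a ≠ b) (ψ : ChainSpace d n) :
    ‖localTerm Wᗮ.starProjection a b ψ‖ ≤ ‖ψ‖ := by
  have h1 := inner_localTerm W hd hab ψ
  have h2 := norm_inner_le_norm (𝕜 := ℂ) ψ (localTerm Wᗮ.starProjection a b ψ)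
  rw [h1, Complex.norm_real, Real.norm_of_nonneg (by positivity)] at h2
  by_contra! hlt
  nlinarith [norm_nonneg ψ]

theorem localTerm_eq_zero_iff {a b : Fin n} (hab : a ≠ b) (ψ : ChainSpace d n) :
    localTerm Wᗮ.starProjection a b ψ = 0 ↔ ∀ s, slice a b s ψ ∈ W := by
  have hW : ∀ v, Wᗮ.starProjection v = 0 ↔ v ∈ W := by
    intro v
    have h1 := Submodule.ker_starProjection Wᗮ
    rw [Submodule.orthogonal_orthogonal] at h1
    exact (SetLike.ext_iff.1 h1 v)
  constructor
  · intro h0 s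
    rw [← hW, ← slice_localTerm _ hab, h0]
    ext p
    rfl
  · intro hs
    ext s
    rw [localTerm_apply, (hW _).2 (hs s)]
    rfl

end LocalTerm

/-! ### Frustration free Hamiltonians -/

section Hamiltonian

variable {d : ℕ} (W : Submodule ℂ (EuclideanSpace ℂ (Fin d × Fin d)))

/-- The nearest neighbour Hamiltonian on a periodic chain with local ground space `W`. -/
def ringHamiltonian (n : ℕ) : ChainOperator d n :=
  ∑ i : Fin n, localTerm Wᗮ.starProjection i (finRotate n i)

theorem finRotate_ne {n : ℕ} (hn : 2 ≤ n) (i : Fin n) : i ≠ finRotate n i := by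
  obtain ⟨k, rfl⟩ : ∃ k, n = k + 2 := ⟨n - 2, by omega⟩
  intro h
  rw [finRotate_apply] at h
  have := congrArg Fin.val h
  rw [Fin.val_add_one] at this
  split_ifs at this with hl
  · rw [hl] at this; simp at this
  · omega

theorem ringHamiltonian_isSymmetric (hd : 0 < d) {n : ℕ} (hn : 2 ≤ n) :
    (ringHamiltonian W n : ChainSpace d n →ₗ[ℂ] ChainSpace d n).IsSymmetric := by
  intro ψ χ
  simp only [ringHamiltonian, ContinuousLinearMap.coe_coe, sum_apply,
    sum_inner, inner_sum]
  exact Finset.sum_congr rfl fun i _ => isSymmetric_localTerm W hd (finRotate_ne hn i) ψ χ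

theorem inner_ringHamiltonian (hd : 0 < d) {n : ℕ} (hn : 2 ≤ n) (ψ : ChainSpace d n) :
    inner ℂ ψ (ringHamiltonian W n ψ) =
      ((∑ i, ‖localTerm Wᗮ.starProjection i (finRotate n i) ψ‖ ^ 2 : ℝ) : ℂ) := by
  simp only [ringHamiltonian, sum_apply, inner_sum]
  push_cast
  refine Finset.sum_congr rfl fun i _ => ?_
  rw [inner_localTerm W hd (finRotate_ne hn i)]
  push_cast
  rfl

/-- Frustration freeness: the energy is a sum of squared norms, so it vanishes only if every local
term does. -/
theorem ringHamiltonian_eq_zero_iff (hd : 0 < d) {n : ℕ} (hn : 2 ≤ n) (ψ : ChainSpace d n) :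
    ringHamiltonian W n ψ = 0 ↔ ∀ i s, slice i (finRotate n i) s ψ ∈ W := by
  constructor
  · intro h0 i
    rw [← localTerm_eq_zero_iff W (finRotate_ne hn i)]
    have h1 := inner_ringHamiltonian W hd hn ψ
    rw [h0, inner_zero_right] at h1
    have h2 : (∑ i, ‖localTerm Wᗮ.starProjection i (finRotate n i) ψ‖ ^ 2 : ℝ) = 0 := by
      exact_mod_cast h1.symm
    have h3 := (Finset.sum_eq_zero_iff_of_nonneg fun i _ => by positivity).1 h2 i
      (Finset.mem_univ i)
    simpa using h3
  · intro h
    rw [ringHamiltonian, sum_apply]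
    exact Finset.sum_eq_zero fun i _ => (localTerm_eq_zero_iff W (finRotate_ne hn i) ψ).2 (h i)

/-- The smallest positive eigenvalue of a positive semidefinite operator, with its variational
characterization. -/
theorem exists_first_excited {E : Type*} [NormedAddCommGroup E] [InnerProductSpace ℂ E]
    [FiniteDimensional ℂ E] (T : E →ₗ[ℂ] E) (hT : T.IsSymmetric)
    (hpos : ∀ x, 0 ≤ RCLike.re (inner ℂ x (T x))) (hT0 : T ≠ 0) :
    ∃ t : ℝ, 0 < t ∧ Module.End.HasEigenvalue T (t : ℂ) ∧
      ∀ x : E, t * ‖x - (LinearMap.ker T).starProjection x‖ ^ 2 ≤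
        RCLike.re (inner ℂ x (T x)) := by
  set b := hT.eigenvectorBasis rfl with hb
  set ev := hT.eigenvalues rfl with hev
  have hbT : ∀ i, T (b i) = (ev i : ℂ) • b i := fun i => hT.apply_eigenvectorBasis rfl i
  have hnn : ∀ i, 0 ≤ ev i := by
    intro i
    have := hpos (b i)
    rw [hbT, inner_smul_right, inner_self_eq_norm_sq_to_K, b.orthonormal.1 i] at this
    simpa using this
  set S := Finset.univ.filter fun i => ev i ≠ 0 with hS
  have hSne : S.Nonempty := by
    by_contra hcon
    rw [Finset.not_nonempty_iff_eq_empty] at hcon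
    apply hT0
    refine b.toBasis.ext fun i => ?_
    have hi : ev i = 0 := by
      by_contra hne
      have : i ∈ S := by simp [hS, hne]
      rw [hcon] at this
      simp at this
    simp [hbT, hi]
  obtain ⟨i₀, hi₀, hmin⟩ := S.exists_min_image ev hSne
  have hi₀' : ev i₀ ≠ 0 := by simpa [hS] using hi₀
  have ht : 0 < ev i₀ := lt_of_le_of_ne (hnn i₀) hi₀'.symm
  refine ⟨ev i₀, ht, hT.hasEigenvalue_eigenvalues rfl i₀, fun x => ?_⟩
  have hcoef : ∀ i, inner ℂ (b i) (T x) = (ev i : ℂ) * inner ℂ (b i) x := by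
    intro i
    rw [← hT, hbT, inner_smul_left]
    simp
  have hE : RCLike.re (inner ℂ x (T x)) = ∑ i, ev i * ‖inner ℂ (b i) x‖ ^ 2 := by
    rw [← b.sum_inner_mul_inner x (T x), map_sum]
    refine Finset.sum_congr rfl fun i _ => ?_
    rw [hcoef, ← inner_conj_symm x (b i)]
    have : (starRingEnd ℂ) (inner ℂ (b i) x) * ((ev i : ℂ) * inner ℂ (b i) x) =
        ((ev i * ‖inner ℂ (b i) x‖ ^ 2 : ℝ) : ℂ) := by
      rw [mul_left_comm, mul_comm _ (inner ℂ (b i) x), Complex.mul_conj, Complex.normSq_eq_norm_sq]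
      push_cast; ring
    rw [this]
    exact Complex.ofReal_re _
  -- `y` has no component on eigenvectors of eigenvalue zero and carries the same energy as `x`; all
  -- its other components are weighted by at least `ev i₀`.
  set y := x - (LinearMap.ker T).starProjection x with hy
  have hyT : T y = T x := by
    have : T ((LinearMap.ker T).starProjection x) = 0 :=
      (Submodule.starProjection_apply_mem (LinearMap.ker T) x)
    rw [hy, map_sub, this, sub_zero]
  have hyorth : ∀ z, T z = 0 → inner ℂ z y = 0 := by
    intro z hz
    exact (Submodule.sub_starProjection_mem_orthogonal (K := LinearMap.ker T) x) z hz
  have hEy : RCLike.re (inner ℂ x (T x)) = ∑ i, ev i * ‖inner ℂ (b i) y‖ ^ 2 := by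
    rw [hE]
    refine Finset.sum_congr rfl fun i _ => ?_
    by_cases hi : ev i = 0
    · simp [hi]
    · have h1 : (ev i : ℂ) * inner ℂ (b i) x = (ev i : ℂ) * inner ℂ (b i) y := by
        rw [← hcoef, ← hyT, ← hT, hbT, inner_smul_left]
        simp
      rw [mul_left_cancel₀ (by exact_mod_cast hi) h1]
  rw [hEy, ← b.sum_sq_norm_inner_right y, Finset.mul_sum]
  refine Finset.sum_le_sum fun i _ => ?_
  by_cases hi : ev i = 0
  · have : inner ℂ (b i) y = 0 := hyorth _ (by simp [hbT, hi])
    simp [this]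
  · gcongr
    exact hmin i (by simp [hS, hi])

end Hamiltonian

/-! ### Limits of projectors -/

section Limit

/-- The orthogonal projector onto the range of an injective map depends continuously on the map. -/
theorem tendsto_starProjection_range {E F α : Type*} [NormedAddCommGroup E] [InnerProductSpace ℂ E]
    [FiniteDimensional ℂ E] [NormedAddCommGroup F] [InnerProductSpace ℂ F] [FiniteDimensional ℂ F]
    {l : Filter α} {J : α → E →L[ℂ] F} {J₀ : E →L[ℂ] F} (hJ : Tendsto J l (𝓝 J₀))
    (hinj : Function.Injective J₀) :
    Tendsto (fun ε => (LinearMap.range (J ε).toLinearMap).starProjection) l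
      (𝓝 (LinearMap.range J₀.toLinearMap).starProjection) := by
  have : CompleteSpace E := FiniteDimensional.complete ℂ E
  have : CompleteSpace F := FiniteDimensional.complete ℂ F
  let gram : (E →L[ℂ] F) → (E →L[ℂ] E) := fun J => (ContinuousLinearMap.adjoint J).comp J
  -- The least squares formula `J (J* J)⁻¹ J*`. `Ring.inverse` is `0` off the units, but near the
  -- injective `J₀` the Gram operator is a unit and inversion is continuous.
  let f : (E →L[ℂ] F) → (F →L[ℂ] F) := fun J =>
    (J.comp (Ring.inverse (gram J))).comp (ContinuousLinearMap.adjoint J)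
  have hf : ∀ J : E →L[ℂ] F, IsUnit (gram J) →
      f J = (LinearMap.range J.toLinearMap).starProjection := by
    intro J hu
    ext u
    symm
    refine Submodule.eq_starProjection_of_mem_orthogonal (K := LinearMap.range J.toLinearMap)
      (LinearMap.mem_range_self _ _) ?_
    rintro _ ⟨v, rfl⟩
    have h1 : gram J (Ring.inverse (gram J) (ContinuousLinearMap.adjoint J u)) =
        ContinuousLinearMap.adjoint J u := by
      have := Ring.mul_inverse_cancel _ hu
      exact DFunLike.congr_fun this (ContinuousLinearMap.adjoint J u)
    change inner ℂ (J v) (u - f J u) = 0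
    rw [← ContinuousLinearMap.adjoint_inner_right, map_sub]
    have h2 : ContinuousLinearMap.adjoint J (f J u) = ContinuousLinearMap.adjoint J u := h1
    rw [h2, sub_self, inner_zero_right]
  have hunit : IsUnit (gram J₀) := by
    rw [ContinuousLinearMap.isUnit_iff_bijective]
    have hi : Function.Injective (gram J₀) := by
      rw [injective_iff_map_eq_zero]
      intro v hv
      have h1 : inner ℂ (J₀ v) (J₀ v) = 0 := by
        rw [← ContinuousLinearMap.adjoint_inner_right]
        change inner ℂ v (gram J₀ v) = 0
        rw [hv, inner_zero_right]
      exact (injective_iff_map_eq_zero J₀).1 hinj v (inner_self_eq_zero.1 h1)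
    exact ⟨hi, (LinearMap.injective_iff_surjective (f := (gram J₀).toLinearMap)).1 hi⟩
  have hgram : Continuous gram := by
    have : Continuous fun J : E →L[ℂ] F => ContinuousLinearMap.adjoint J :=
      (ContinuousLinearMap.adjoint (𝕜 := ℂ) (E := E) (F := F)).continuous
    exact this.clm_comp continuous_id
  have hcont : ContinuousAt f J₀ := by
    have h1 : ContinuousAt (fun J => Ring.inverse (gram J)) J₀ := by
      obtain ⟨u, hu⟩ := hunit
      have h2 := NormedRing.inverse_continuousAt u
      rw [hu] at h2
      exact ContinuousAt.comp (f := gram) h2 hgram.continuousAt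
    have h3 : ContinuousAt (fun J : E →L[ℂ] F => ContinuousLinearMap.adjoint J) J₀ :=
      (ContinuousLinearMap.adjoint (𝕜 := ℂ) (E := E) (F := F)).continuous.continuousAt
    exact (continuousAt_id.clm_comp h1).clm_comp h3
  rw [← hf J₀ hunit]
  refine (hcont.tendsto.comp hJ).congr' ?_
  have hopen : ∀ᶠ J in 𝓝 J₀, IsUnit (gram J) :=
    hgram.continuousAt.eventually (Units.isOpen.mem_nhds hunit)
  filter_upwards [hJ.eventually hopen] with ε hε
  exact hf _ hε

theorem continuous_localTerm {d n : ℕ} (a b : Fin n) :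
    Continuous fun h : EuclideanSpace ℂ (Fin d × Fin d) →L[ℂ] EuclideanSpace ℂ (Fin d × Fin d) =>
      localTerm h a b := by
  rw [continuous_clm_apply]
  intro ψ
  refine (PiLp.continuous_toLp 2 _).comp (continuous_pi fun s => ?_)
  change Continuous fun h : EuclideanSpace ℂ (Fin d × Fin d) →L[ℂ]
    EuclideanSpace ℂ (Fin d × Fin d) => h (slice a b s ψ) (s a, s b)
  fun_prop

end Limit

/-! ### The contracted matrix product and the limiting local ground space -/

section Contraction

variable {α β : Type}

/-- The block diagonal part of a matrix. -/
def blockDiag : Matrix (α ⊕ β) (α ⊕ β) ℂ →ₗ[ℂ] Matrix (α ⊕ β) (α ⊕ β) ℂ where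
  toFun X := Matrix.fromBlocks X.toBlocks₁₁ 0 0 X.toBlocks₂₂
  map_add' X Y := by ext (i | i) (j | j) <;> simp [Matrix.toBlocks₁₁, Matrix.toBlocks₂₂]
  map_smul' c X := by ext (i | i) (j | j) <;> simp [Matrix.toBlocks₁₁, Matrix.toBlocks₂₂]

/-- The upper right block of a matrix. -/
def upperRight : Matrix (α ⊕ β) (α ⊕ β) ℂ →ₗ[ℂ] Matrix (α ⊕ β) (α ⊕ β) ℂ where
  toFun X := Matrix.fromBlocks 0 X.toBlocks₁₂ 0 0
  map_add' X Y := by ext (i | i) (j | j) <;> simp [Matrix.toBlocks₁₂]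
  map_smul' c X := by ext (i | i) (j | j) <;> simp [Matrix.toBlocks₁₂]

/-- The lower left block of a matrix. -/
def lowerLeft : Matrix (α ⊕ β) (α ⊕ β) ℂ →ₗ[ℂ] Matrix (α ⊕ β) (α ⊕ β) ℂ where
  toFun X := Matrix.fromBlocks 0 0 X.toBlocks₂₁ 0
  map_add' X Y := by ext (i | i) (j | j) <;> simp [Matrix.toBlocks₂₁]
  map_smul' c X := by ext (i | i) (j | j) <;> simp [Matrix.toBlocks₂₁]

/-- The off-diagonal part of a matrix. -/
def offDiag : Matrix (α ⊕ β) (α ⊕ β) ℂ →ₗ[ℂ] Matrix (α ⊕ β) (α ⊕ β) ℂ := upperRight + lowerLeft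

theorem blockDiag_fromBlocks (a : Matrix α α ℂ) (b : Matrix α β ℂ) (c : Matrix β α ℂ)
    (e : Matrix β β ℂ) :
    blockDiag (Matrix.fromBlocks a b c e) = Matrix.fromBlocks a 0 0 e := by
  simp [blockDiag]

theorem offDiag_fromBlocks (a : Matrix α α ℂ) (b : Matrix α β ℂ) (c : Matrix β α ℂ)
    (e : Matrix β β ℂ) :
    offDiag (Matrix.fromBlocks a b c e) = Matrix.fromBlocks 0 b c 0 := by
  simp [offDiag, upperRight, lowerLeft, Matrix.fromBlocks_add]

/-- Rescaling of the off-diagonal blocks. -/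
def rescale (c : ℂ) : Matrix (α ⊕ β) (α ⊕ β) ℂ →ₗ[ℂ] Matrix (α ⊕ β) (α ⊕ β) ℂ :=
  blockDiag + c • offDiag

theorem rescale_fromBlocks (e : ℂ) (a : Matrix α α ℂ) (b : Matrix α β ℂ) (c : Matrix β α ℂ)
    (f : Matrix β β ℂ) :
    rescale e (Matrix.fromBlocks a b c f) = Matrix.fromBlocks a (e • b) (e • c) f := by
  simp [rescale, blockDiag_fromBlocks, offDiag_fromBlocks, Matrix.fromBlocks_add,
    Matrix.fromBlocks_smul]

theorem rescale_rescale {e : ℂ} (he : e ≠ 0) (X : Matrix (α ⊕ β) (α ⊕ β) ℂ) :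
    rescale e⁻¹ (rescale e X) = X := by
  rw [← Matrix.fromBlocks_toBlocks X, rescale_fromBlocks, rescale_fromBlocks]
  simp [smul_smul, he]

variable [Fintype α] [Fintype β]

/-- The product of block matrices after rescaling the off-diagonal blocks by `e⁻¹`. For `e = 0` the
product of two off-diagonal blocks is contracted to zero. -/
def cmul (e : ℂ) (x y : Matrix (α ⊕ β) (α ⊕ β) ℂ) : Matrix (α ⊕ β) (α ⊕ β) ℂ :=
  blockDiag x * blockDiag y + e ^ 2 • (offDiag x * offDiag y)
    + (blockDiag x * offDiag y + offDiag x * blockDiag y)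

theorem cmul_fromBlocks (e : ℂ) (a a' : Matrix α α ℂ) (b b' : Matrix α β ℂ) (c c' : Matrix β α ℂ)
    (f f' : Matrix β β ℂ) :
    cmul e (Matrix.fromBlocks a b c f) (Matrix.fromBlocks a' b' c' f') =
      Matrix.fromBlocks (a * a' + e ^ 2 • (b * c')) (a * b' + b * f') (c * a' + f * c')
        (f * f' + e ^ 2 • (c * b')) := by
  simp [cmul, blockDiag_fromBlocks, offDiag_fromBlocks, Matrix.fromBlocks_multiply,
    Matrix.fromBlocks_add, Matrix.fromBlocks_smul, add_comm]

/-- The product of two off-diagonal blocks lands on the diagonal, which is not rescaled, while its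
factors have been divided by `e` each; the weight `e ^ 2` compensates. -/
theorem rescale_mul {e : ℂ} (he : e ≠ 0) (x y : Matrix (α ⊕ β) (α ⊕ β) ℂ) :
    rescale e⁻¹ (x * y) = cmul e (rescale e⁻¹ x) (rescale e⁻¹ y) := by
  rw [← Matrix.fromBlocks_toBlocks x, ← Matrix.fromBlocks_toBlocks y, Matrix.fromBlocks_multiply,
    rescale_fromBlocks, rescale_fromBlocks, rescale_fromBlocks, cmul_fromBlocks]
  have h : e ^ 2 * (e⁻¹ * e⁻¹) = 1 := by field_simp
  simp only [Matrix.smul_mul, Matrix.mul_smul, smul_smul, h, one_smul, smul_add]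
  congr 1
  exact add_comm _ _

/-- Rescaling is self-adjoint for the trace pairing, so it can be moved from the tensor to the test
matrix. -/
theorem trace_rescale_mul (e : ℂ) (x X : Matrix (α ⊕ β) (α ⊕ β) ℂ) :
    (rescale e x * X).trace = (x * rescale e X).trace := by
  rw [← Matrix.fromBlocks_toBlocks x, ← Matrix.fromBlocks_toBlocks X,
    rescale_fromBlocks, rescale_fromBlocks, Matrix.fromBlocks_multiply, Matrix.fromBlocks_multiply]
  simp [Matrix.trace]

theorem cmul_add_left (e : ℂ) (x x' y : Matrix (α ⊕ β) (α ⊕ β) ℂ) :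
    cmul e (x + x') y = cmul e x y + cmul e x' y := by
  simp only [cmul, map_add, add_mul, smul_add]; abel

theorem cmul_add_right (e : ℂ) (x y y' : Matrix (α ⊕ β) (α ⊕ β) ℂ) :
    cmul e x (y + y') = cmul e x y + cmul e x y' := by
  simp only [cmul, map_add, mul_add, smul_add]; abel

theorem cmul_smul_left (e c : ℂ) (x y : Matrix (α ⊕ β) (α ⊕ β) ℂ) :
    cmul e (c • x) y = c • cmul e x y := by
  simp only [cmul, map_smul, Matrix.smul_mul, smul_add, smul_comm c (e ^ 2)]

theorem cmul_smul_right (e c : ℂ) (x y : Matrix (α ⊕ β) (α ⊕ β) ℂ) :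
    cmul e x (c • y) = c • cmul e x y := by
  simp only [cmul, map_smul, Matrix.mul_smul, smul_add, smul_comm c (e ^ 2)]

/-- The contracted product as a bilinear map. -/
def cmulLin : Matrix (α ⊕ β) (α ⊕ β) ℂ →ₗ[ℂ] Matrix (α ⊕ β) (α ⊕ β) ℂ →ₗ[ℂ]
    Matrix (α ⊕ β) (α ⊕ β) ℂ :=
  LinearMap.mk₂ ℂ (cmul 0) (cmul_add_left 0) (fun c x y => cmul_smul_left 0 c x y)
    (cmul_add_right 0) (fun c x y => cmul_smul_right 0 c x y)

theorem cmulLin_apply (x y : Matrix (α ⊕ β) (α ⊕ β) ℂ) : cmulLin x y = cmul 0 x y := rfl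

variable [DecidableEq α] [DecidableEq β]

theorem one_cmul (e : ℂ) (x : Matrix (α ⊕ β) (α ⊕ β) ℂ) : cmul e 1 x = x := by
  rw [← Matrix.fromBlocks_one, ← Matrix.fromBlocks_toBlocks x, cmul_fromBlocks]
  simp

theorem cmul_one (e : ℂ) (x : Matrix (α ⊕ β) (α ⊕ β) ℂ) : cmul e x 1 = x := by
  rw [← Matrix.fromBlocks_one, ← Matrix.fromBlocks_toBlocks x, cmul_fromBlocks]
  simp

end Contraction

/-! ### The two-site span at `ε → 0` and the existence of the uncle Hamiltonian -/

section LimitSpan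

/-- The map `X ↦ ∑_i tr[M_i X] |i⟩`. -/
def traceMap {κ n : Type} [Fintype κ] [Fintype n] (M : Tensor κ n) :
    Matrix n n ℂ →ₗ[ℂ] EuclideanSpace ℂ κ where
  toFun X := WithLp.toLp 2 fun i => (M i * X).trace
  map_add' X Y := by ext i; simp [mul_add]
  map_smul' c X := by ext i; simp

theorem tensorSpan_eq_range {κ n : Type} [Fintype κ] [Fintype n] (M : Tensor κ n) :
    tensorSpan M = LinearMap.range (traceMap M) := by
  rw [tensorSpan]
  exact Submodule.span_eq_of_le _ (by rintro _ ⟨X, rfl⟩; exact ⟨X, rfl⟩)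
    (by rintro _ ⟨X, rfl⟩; exact Submodule.subset_span ⟨X, rfl⟩)

variable {d l m : ℕ}

/-- The two-site tensor of contracted products. -/
def cmulSites (e : ℂ) (T : Tensor (Fin d) (Fin l ⊕ Fin m)) :
    Tensor (Fin d × Fin d) (Fin l ⊕ Fin m) :=
  fun p => cmul e (T p.1) (T p.2)

/-- For `e ≠ 0` rescaling permutes the test matrices, so the span is unchanged. For `T = C + eP`
this parametrization, unlike the original one, stays nondegenerate as `e → 0`. -/
theorem tensorSpan_twoSite {e : ℂ} (he : e ≠ 0) (T : Tensor (Fin d) (Fin l ⊕ Fin m)) :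
    tensorSpan (twoSite T) =
      LinearMap.range (traceMap (cmulSites e fun i => rescale e⁻¹ (T i))) := by
  rw [tensorSpan_eq_range]
  have h : ∀ X, traceMap (cmulSites e fun i => rescale e⁻¹ (T i)) X =
      traceMap (twoSite T) (rescale e⁻¹ X) := by
    intro X
    ext p
    simp only [traceMap, cmulSites, LinearMap.coe_mk, AddHom.coe_mk, twoSite]
    rw [← rescale_mul he, trace_rescale_mul]
  apply le_antisymm
  · rintro _ ⟨X, rfl⟩
    exact ⟨rescale e X, by rw [h, rescale_rescale he]⟩
  · rintro _ ⟨X, rfl⟩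
    exact ⟨rescale e⁻¹ X, by rw [h]⟩

theorem rescale_directSum_add {e : ℂ} (he : e ≠ 0) (A : Tensor (Fin d) (Fin l))
    (B : Tensor (Fin d) (Fin m)) (P : Tensor (Fin d) (Fin l ⊕ Fin m)) (i : Fin d) :
    rescale e⁻¹ ((directSum A B + e • P) i) = wallTensor A B P i + e • blockDiag (P i) := by
  simp only [Pi.add_apply, Pi.smul_apply, directSum, wallTensor]
  conv_lhs => rw [← Matrix.fromBlocks_toBlocks (P i)]
  conv_rhs => rw [← Matrix.fromBlocks_toBlocks (P i)]
  rw [Matrix.fromBlocks_smul, Matrix.fromBlocks_add, rescale_fromBlocks, blockDiag_fromBlocks,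
    Matrix.fromBlocks_smul, Matrix.fromBlocks_add]
  simp [smul_smul, he]

/-- The limit of the two-site spans of `A ⊕ B + ε P`. -/
def limitSpan (T : Tensor (Fin d) (Fin l ⊕ Fin m)) :
    Submodule ℂ (EuclideanSpace ℂ (Fin d × Fin d)) :=
  LinearMap.range (traceMap (cmulSites 0 T))

theorem exists_trace_eq {n : Type} [Fintype n] [DecidableEq n] (g : Matrix n n ℂ →ₗ[ℂ] ℂ) :
    ∃ X : Matrix n n ℂ, ∀ Z, g Z = (Z * X).trace := by
  refine ⟨Matrix.of fun b a => g (Matrix.single a b 1), fun Z => ?_⟩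
  conv_lhs => rw [Matrix.matrix_eq_sum_single Z]
  simp only [map_sum, Matrix.trace, Matrix.diag, Matrix.mul_apply, Matrix.of_apply]
  refine Finset.sum_congr rfl fun a _ => Finset.sum_congr rfl fun b _ => ?_
  rw [← mul_one (Z a b), ← smul_eq_mul, ← Matrix.smul_single, map_smul]
  simp

/-- Every linear functional on matrices is a trace pairing. In this form, local zero energy says
that the dependence on two neighbours factors linearly through their contracted product. -/
theorem mem_limitSpan_iff (T : Tensor (Fin d) (Fin l ⊕ Fin m))
    (v : EuclideanSpace ℂ (Fin d × Fin d)) :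
    v ∈ limitSpan T ↔ ∃ g : Matrix (Fin l ⊕ Fin m) (Fin l ⊕ Fin m) ℂ →ₗ[ℂ] ℂ,
      ∀ x y, v (x, y) = g (cmul 0 (T x) (T y)) := by
  constructor
  · rintro ⟨X, rfl⟩
    exact ⟨(Matrix.traceLinearMap _ ℂ ℂ) ∘ₗ LinearMap.mulRight ℂ X, fun x y => rfl⟩
  · rintro ⟨g, hg⟩
    obtain ⟨X, hX⟩ := exists_trace_eq g
    refine ⟨X, ?_⟩
    ext ⟨x, y⟩
    rw [hg, hX]
    rfl

/-- A linear section of the spanning tensor `T`. -/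
theorem exists_section {κ n : Type} [Fintype κ] [Fintype n] {T : Tensor κ n}
    (hT : Submodule.span ℂ (Set.range T) = ⊤) :
    ∃ c : Matrix n n ℂ →ₗ[ℂ] (κ → ℂ), ∀ X, ∑ x, c X x • T x = X := by
  have hs : LinearMap.range (Fintype.linearCombination ℂ T) = ⊤ := by
    rw [Fintype.range_linearCombination, hT]
  obtain ⟨c, hc⟩ := LinearMap.exists_rightInverse_of_surjective _ hs
  exact ⟨c, fun X => by simpa [Fintype.linearCombination_apply] using LinearMap.congr_fun hc X⟩

/-- The contracted product has the unit `1` and `T` spans, so the products of pairs span all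
matrices. This prevents a drop of dimension in the limit. -/
theorem traceMap_injective {T : Tensor (Fin d) (Fin l ⊕ Fin m)}
    (hT : Submodule.span ℂ (Set.range T) = ⊤) :
    Function.Injective (traceMap (cmulSites 0 T)) := by
  rw [injective_iff_map_eq_zero]
  intro X hX
  obtain ⟨c, hc⟩ := exists_section hT
  have h1 : ∀ x y, (cmul 0 (T x) (T y) * X).trace = 0 := fun x y =>
    congrFun (congrArg WithLp.ofLp hX) (x, y)
  have h2 : ∀ Z, (Z * X).trace = 0 := by
    intro Z
    rw [← one_cmul 0 Z, ← hc 1, ← hc Z, ← cmulLin_apply]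
    simp [LinearMap.sum_apply, Finset.sum_mul, Matrix.trace_sum, cmulLin_apply, h1]
  ext a b
  have := h2 (Matrix.single b a 1)
  simpa [Matrix.trace_single_mul] using this

/-- Existence of the uncle Hamiltonian. -/
theorem isUncleHamiltonian_ringHamiltonian (A : Tensor (Fin d) (Fin l)) (B : Tensor (Fin d) (Fin m))
    {P : Tensor (Fin d) (Fin l ⊕ Fin m)} (hP : IsInjectivePerturbation A B P) (n : ℕ) :
    IsUncleHamiltonian (directSum A B) P n (ringHamiltonian (limitSpan (wallTensor A B P)) n) := by
  let ι := Fin l ⊕ Fin m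
  let vec : EuclideanSpace ℂ (ι × ι) →ₗ[ℂ] Matrix ι ι ℂ :=
    { toFun := fun v => Matrix.of fun a b => v (a, b)
      map_add' := fun v w => by ext; simp
      map_smul' := fun c v => by ext; simp }
  have hvec : Function.Surjective vec := fun X =>
    ⟨WithLp.toLp 2 fun ab => X ab.1 ab.2, by ext; rfl⟩
  have hvec' : Function.Injective vec := by
    intro v w hvw
    ext ⟨a, b⟩
    exact congrFun (congrFun hvw a) b
  let S : ℂ → Tensor (Fin d) ι := fun e i => wallTensor A B P i + e • blockDiag (P i)
  let J : ℂ → EuclideanSpace ℂ (ι × ι) →L[ℂ] EuclideanSpace ℂ (Fin d × Fin d) := fun e =>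
    LinearMap.toContinuousLinearMap (traceMap (cmulSites e (S e)) ∘ₗ vec)
  have hS0 : S 0 = wallTensor A B P := by funext i; simp [S]
  have hrange : ∀ e, LinearMap.range (J e).toLinearMap =
      LinearMap.range (traceMap (cmulSites e (S e))) := by
    intro e
    simp only [J, LinearMap.coe_toContinuousLinearMap]
    rw [LinearMap.range_comp, LinearMap.range_eq_top.2 hvec, Submodule.map_top]
  have hcont : Continuous J := by
    rw [continuous_clm_apply]
    intro v
    refine (PiLp.continuous_toLp 2 _).comp (continuous_pi fun p => ?_)
    change Continuous fun e => (cmul e (S e p.1) (S e p.2) * vec v).trace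
    simp only [cmul, S, map_add, map_smul]
    fun_prop
  have hinj : Function.Injective (J 0) := by
    have : Function.Injective (traceMap (cmulSites 0 (S 0))) := by
      rw [hS0]; exact traceMap_injective hP
    exact this.comp hvec'
  have hproj : Tendsto (fun e : ℂ => tensorProjector (twoSite (directSum A B + e • P))) (𝓝[≠] 0)
      (𝓝 (limitSpan (wallTensor A B P))ᗮ.starProjection) := by
    have h1 := tendsto_starProjection_range (hcont.tendsto 0 |>.mono_left nhdsWithin_le_nhds) hinj
      (l := 𝓝[≠] 0)
    have h2 := h1.const_sub 1
    have hcongr : ∀ U V : Submodule ℂ (EuclideanSpace ℂ (Fin d × Fin d)), U = V →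
        1 - U.starProjection = Vᗮ.starProjection := by
      rintro U _ rfl
      rw [Submodule.starProjection_orthogonal']
    rw [hcongr _ (limitSpan (wallTensor A B P)) (by rw [hrange 0, hS0]; rfl)] at h2
    refine h2.congr' ?_
    filter_upwards [self_mem_nhdsWithin] with e he
    refine hcongr _ _ ?_
    rw [hrange, tensorSpan_twoSite he]
    simp only [rescale_directSum_add he]
    rfl
  rw [IsUncleHamiltonian, ringHamiltonian]
  unfold parentHamiltonian
  exact tendsto_finsetSum _ fun i _ => ((continuous_localTerm i (finRotate n i)).tendsto _).comp hproj

end LimitSpan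

/-! ### The ground space of the uncle Hamiltonian -/

section GroundSpace

variable {d l m : ℕ}

/-- The iterated contracted product `X • T_{s_0} • ⋯ • T_{s_{n-1}}`, bracketed to the left. -/
def cfold (T : Tensor (Fin d) (Fin l ⊕ Fin m)) :
    (n : ℕ) → (Fin n → Fin d) →
      Matrix (Fin l ⊕ Fin m) (Fin l ⊕ Fin m) ℂ →ₗ[ℂ] Matrix (Fin l ⊕ Fin m) (Fin l ⊕ Fin m) ℂ
  | 0, _ => LinearMap.id
  | n + 1, s => cfold T n (Fin.tail s) ∘ₗ cmulLin.flip (T (s 0))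

theorem cfold_cons (T : Tensor (Fin d) (Fin l ⊕ Fin m)) {n : ℕ} (x : Fin d) (s : Fin n → Fin d)
    (X : Matrix (Fin l ⊕ Fin m) (Fin l ⊕ Fin m) ℂ) :
    cfold T (n + 1) (Fin.cons x s : Fin (n + 1) → Fin d) X = cfold T n s (cmul 0 X (T x)) := rfl

theorem cfold_snoc (T : Tensor (Fin d) (Fin l ⊕ Fin m)) {n : ℕ} (s : Fin n → Fin d) (x : Fin d)
    (X : Matrix (Fin l ⊕ Fin m) (Fin l ⊕ Fin m) ℂ) :
    cfold T (n + 1) (Fin.snoc s x : Fin (n + 1) → Fin d) X = cmul 0 (cfold T n s X) (T x) := by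
  induction n generalizing X with
  | zero => rfl
  | succ n ih =>
    rw [← Fin.cons_self_tail s, ← Fin.cons_snoc_eq_snoc_cons, cfold_cons, ih, cfold_cons]

variable {T : Tensor (Fin d) (Fin l ⊕ Fin m)}

/-- A functional that depends only on the contracted products of neighbours depends only on the
total contracted product. -/
theorem exists_functional_cfold
    {c : Matrix (Fin l ⊕ Fin m) (Fin l ⊕ Fin m) ℂ →ₗ[ℂ] (Fin d → ℂ)}
    (hc : ∀ X, ∑ x, c X x • T x = X) (n : ℕ)
    (Ψ : Matrix (Fin l ⊕ Fin m) (Fin l ⊕ Fin m) ℂ →ₗ[ℂ] ((Fin n → Fin d) → ℂ))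
    (h₁ : ∀ i : Fin n, (i : ℕ) = 0 → ∀ s, ∃ g : Matrix (Fin l ⊕ Fin m) (Fin l ⊕ Fin m) ℂ →ₗ[ℂ] ℂ,
      ∀ X y, Ψ X (Function.update s i y) = g (cmul 0 X (T y)))
    (h₂ : ∀ i j : Fin n, (i : ℕ) + 1 = j → ∀ X s,
      ∃ g : Matrix (Fin l ⊕ Fin m) (Fin l ⊕ Fin m) ℂ →ₗ[ℂ] ℂ,
      ∀ x y, Ψ X (Function.update (Function.update s i x) j y) = g (cmul 0 (T x) (T y))) :
    ∃ f : Matrix (Fin l ⊕ Fin m) (Fin l ⊕ Fin m) ℂ →ₗ[ℂ] ℂ, ∀ X s, Ψ X s = f (cfold T n s X) := by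
  induction n with
  | zero =>
    refine ⟨LinearMap.proj (fun i => i.elim0) ∘ₗ Ψ, fun X s => ?_⟩
    rw [Subsingleton.elim s fun i => i.elim0]
    rfl
  | succ n ih =>
    -- The first site is absorbed into the matrix argument: `c` expands `Z` in the matrices `T z`.
    -- The bond between the first two sites then becomes the boundary condition `h₁` for `Ψ'`.
    let Ψ' : Matrix (Fin l ⊕ Fin m) (Fin l ⊕ Fin m) ℂ →ₗ[ℂ] ((Fin n → Fin d) → ℂ) :=
      { toFun := fun Z s => ∑ z, c Z z * Ψ 1 (Fin.cons z s : Fin (n + 1) → Fin d)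
        map_add' := fun Z Z' => by
          ext s; simp [add_mul, Finset.sum_add_distrib]
        map_smul' := fun a Z => by
          ext s; simp [Finset.mul_sum, mul_assoc] }
    have hΨ'_apply : ∀ Z s, Ψ' Z s = ∑ z, c Z z * Ψ 1 (Fin.cons z s : Fin (n + 1) → Fin d) :=
      fun _ _ => rfl
    have hΨ : ∀ X y s, Ψ X (Fin.cons y s : Fin (n + 1) → Fin d) = Ψ' (cmul 0 X (T y)) s := by
      intro X y s
      obtain ⟨g, hg⟩ := h₁ 0 rfl (Fin.cons y s)
      simp only [Fin.update_cons_zero] at hg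
      rw [hΨ'_apply, hg]
      simp only [hg, one_cmul]
      conv_lhs => rw [← hc (cmul 0 X (T y))]
      simp
    obtain ⟨f, hf⟩ := ih Ψ' (fun i hi s => by
      obtain ⟨g, hg⟩ := h₂ 0 i.succ (by simp [hi]) 1 (Fin.cons (s i) s)
      simp only [Fin.update_cons_zero, ← Fin.cons_update] at hg
      refine ⟨g, fun Z y => ?_⟩
      rw [hΨ'_apply]
      simp only [hg]
      conv_rhs => rw [← hc Z, ← cmulLin_apply]
      simp [LinearMap.sum_apply, cmulLin_apply])
      (fun i j hij Z s => by
        choose g hg using fun z => h₂ i.succ j.succ (by simp [← hij]) 1 (Fin.cons z s)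
        simp only [← Fin.cons_update] at hg
        refine ⟨∑ z, c Z z • g z, fun x y => ?_⟩
        rw [hΨ'_apply]
        simp only [hg]
        simp [LinearMap.sum_apply])
    refine ⟨f, fun X s => ?_⟩
    rw [← Fin.cons_self_tail s, hΨ, hf, cfold_cons]

/-- Weighted sums of contracted products over all configurations can produce the identity map. -/
theorem sum_prod_smul_cfold {u : Fin d → ℂ} (hu : ∑ x, u x • T x = 1) (n : ℕ)
    (X : Matrix (Fin l ⊕ Fin m) (Fin l ⊕ Fin m) ℂ) :
    ∑ s : Fin n → Fin d, (∏ k, u (s k)) • cfold T n s X = X := by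
  induction n generalizing X with
  | zero => simp [cfold]
  | succ n ih =>
    rw [sum_fin_succ_fun]
    simp only [Fin.prod_univ_succ, Fin.cons_zero, Fin.cons_succ, cfold_cons, mul_smul]
    calc ∑ x, ∑ s : Fin n → Fin d, u x • (∏ k, u (s k)) • cfold T n s (cmul 0 X (T x))
        = ∑ x, u x • cmul 0 X (T x) :=
          Finset.sum_congr rfl fun x _ => by rw [← Finset.smul_sum, ih]
      _ = cmulLin X (∑ x, u x • T x) := by simp [cmulLin_apply]
      _ = X := by rw [hu, cmulLin_apply, cmul_one]

/-- A tracial functional on a matrix algebra is a multiple of the trace. -/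
theorem exists_eq_smul_trace {n : Type} [Fintype n] [DecidableEq n] (g : Matrix n n ℂ →ₗ[ℂ] ℂ)
    (hg : ∀ X Y, g (X * Y) = g (Y * X)) : ∃ a : ℂ, ∀ X, g X = a * X.trace := by
  have h1 : ∀ i j, i ≠ j → g (Matrix.single i j 1) = 0 := by
    intro i j hij
    have := hg (Matrix.single i i 1) (Matrix.single i j 1)
    rwa [Matrix.single_mul_single_same, Matrix.single_mul_single_of_ne _ _ _ _ hij.symm, map_zero,
      mul_one] at this
  have h2 : ∀ i j, g (Matrix.single i i 1) = g (Matrix.single j j 1) := by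
    intro i j
    have := hg (Matrix.single i j 1) (Matrix.single j i 1)
    rwa [Matrix.single_mul_single_same, Matrix.single_mul_single_same, mul_one] at this
  rcases isEmpty_or_nonempty n with hn | ⟨⟨i₀⟩⟩
  · refine ⟨0, fun X => ?_⟩
    rw [Subsingleton.elim X 0]
    simp
  · refine ⟨g (Matrix.single i₀ i₀ 1), fun X => ?_⟩
    conv_lhs => rw [Matrix.matrix_eq_sum_single X]
    simp only [map_sum, Matrix.trace, Matrix.diag, Finset.mul_sum]
    refine Finset.sum_congr rfl fun i _ => ?_
    have h3 : ∀ j, g (Matrix.single i j (X i j)) = X i j * g (Matrix.single i j 1) := by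
      intro j
      rw [← smul_eq_mul, ← map_smul, Matrix.smul_single, smul_eq_mul, mul_one]
    rw [Finset.sum_eq_single i]
    · rw [h3, h2 i i₀, mul_comm]
    · intro j _ hji
      rw [h3, h1 i j hji.symm, mul_zero]
    · simp

/-- A functional that is tracial for the contracted product is a combination of block traces. -/
theorem exists_eq_blockTraces (f : Matrix (Fin l ⊕ Fin m) (Fin l ⊕ Fin m) ℂ →ₗ[ℂ] ℂ)
    (hf : ∀ X Y, f (cmul 0 X Y) = f (cmul 0 Y X)) :
    ∃ a b : ℂ, ∀ X, f X = a * X.toBlocks₁₁.trace + b * X.toBlocks₂₂.trace := by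
  let i₁ : Matrix (Fin l) (Fin l) ℂ →ₗ[ℂ] Matrix (Fin l ⊕ Fin m) (Fin l ⊕ Fin m) ℂ :=
    { toFun := fun a => Matrix.fromBlocks a 0 0 0
      map_add' := fun a b => by simp [Matrix.fromBlocks_add]
      map_smul' := fun c a => by simp [Matrix.fromBlocks_smul] }
  let i₂ : Matrix (Fin m) (Fin m) ℂ →ₗ[ℂ] Matrix (Fin l ⊕ Fin m) (Fin l ⊕ Fin m) ℂ :=
    { toFun := fun a => Matrix.fromBlocks 0 0 0 a
      map_add' := fun a b => by simp [Matrix.fromBlocks_add]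
      map_smul' := fun c a => by simp [Matrix.fromBlocks_smul] }
  obtain ⟨a, ha⟩ := exists_eq_smul_trace (f ∘ₗ i₁) fun X Y => by
    have := hf (Matrix.fromBlocks X 0 0 0) (Matrix.fromBlocks Y 0 0 0)
    simpa [cmul_fromBlocks, i₁] using this
  obtain ⟨b, hb⟩ := exists_eq_smul_trace (f ∘ₗ i₂) fun X Y => by
    have := hf (Matrix.fromBlocks 0 0 0 X) (Matrix.fromBlocks 0 0 0 Y)
    simpa [cmul_fromBlocks, i₂] using this
  refine ⟨a, b, fun X => ?_⟩
  -- Multiplying an off-diagonal block by a block identity reproduces it on one side and gives zero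
  -- on the other.
  have h12 : f (Matrix.fromBlocks 0 X.toBlocks₁₂ 0 0) = 0 := by
    have := hf (Matrix.fromBlocks 1 0 0 0) (Matrix.fromBlocks 0 X.toBlocks₁₂ 0 0)
    simpa [cmul_fromBlocks] using this
  have h21 : f (Matrix.fromBlocks 0 0 X.toBlocks₂₁ 0) = 0 := by
    have := hf (Matrix.fromBlocks 0 0 0 1) (Matrix.fromBlocks 0 0 X.toBlocks₂₁ 0)
    simpa [cmul_fromBlocks] using this
  have hX : X = i₁ X.toBlocks₁₁ + i₂ X.toBlocks₂₂ + (Matrix.fromBlocks 0 X.toBlocks₁₂ 0 0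
      + Matrix.fromBlocks 0 0 X.toBlocks₂₁ 0) := by
    conv_lhs => rw [← Matrix.fromBlocks_toBlocks X]
    simp [i₁, i₂, Matrix.fromBlocks_add]
  conv_lhs => rw [hX]
  rw [map_add, map_add, map_add, h12, h21]
  have e1 := ha X.toBlocks₁₁
  have e2 := hb X.toBlocks₂₂
  simp only [LinearMap.comp_apply] at e1 e2
  rw [e1, e2]
  ring

/-- Off-diagonal blocks never feed back into the diagonal of a contracted product, so the diagonal
blocks multiply independently. -/
theorem toBlocks_cfold_wallTensor (A : Tensor (Fin d) (Fin l)) (B : Tensor (Fin d) (Fin m))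
    (P : Tensor (Fin d) (Fin l ⊕ Fin m)) (n : ℕ) (s : Fin n → Fin d)
    (X : Matrix (Fin l ⊕ Fin m) (Fin l ⊕ Fin m) ℂ) :
    (cfold (wallTensor A B P) n s X).toBlocks₁₁ = X.toBlocks₁₁ * amp (fun _ => A) n s ∧
    (cfold (wallTensor A B P) n s X).toBlocks₂₂ = X.toBlocks₂₂ * amp (fun _ => B) n s := by
  induction n generalizing X with
  | zero => simp [cfold, amp]
  | succ n ih =>
    rw [← Fin.cons_self_tail s, cfold_cons, amp_cons, amp_cons, (ih _ _).1, (ih _ _).2, wallTensor]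
    conv_lhs => rw [← Matrix.fromBlocks_toBlocks X, cmul_fromBlocks]
    conv_rhs => rw [← Matrix.fromBlocks_toBlocks X, cmul_fromBlocks]
    simp [Matrix.mul_assoc]

theorem mpsState_apply {ι : Type} [Fintype ι] [DecidableEq ι] (A : Tensor (Fin d) ι) (n : ℕ)
    (s : Fin n → Fin d) : mpsState A n s = (amp (fun _ => A) n s).trace := by
  rw [← amp_eq_prod]
  rfl

/-- Every ground state of the uncle Hamiltonian is a combination of the two matrix product
states. -/
theorem exists_eq_mpsState_of_slices (A : Tensor (Fin d) (Fin l)) (B : Tensor (Fin d) (Fin m))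
    {P : Tensor (Fin d) (Fin l ⊕ Fin m)} (hP : IsInjectivePerturbation A B P) {n : ℕ} (hn : 3 ≤ n)
    {ψ : ChainSpace d n}
    (hψ : ∀ i s, slice i (finRotate n i) s ψ ∈ limitSpan (wallTensor A B P)) :
    ∃ a b : ℂ, ψ = a • mpsState A n + b • mpsState B n := by
  obtain ⟨k, rfl⟩ : ∃ k, n = k + 3 := ⟨n - 3, by omega⟩
  set T := wallTensor A B P with hTdef
  obtain ⟨c, hc⟩ := exists_section (T := T) hP
  have hψ' : ∀ (i j : Fin (k + 3)), finRotate _ i = j → ∀ s,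
      ∃ g : Matrix (Fin l ⊕ Fin m) (Fin l ⊕ Fin m) ℂ →ₗ[ℂ] ℂ, ∀ x y,
        ψ (Function.update (Function.update s i x) j y) = g (cmul 0 (T x) (T y)) := by
    rintro i _ rfl s
    exact (mem_limitSpan_iff T _).1 (hψ i s)
  have hrot : ∀ i j : Fin (k + 3), (i : ℕ) + 1 = j → finRotate _ i = j := by
    intro i j hij
    ext
    have hi : (i : ℕ) < k + 2 := by omega
    rw [coe_finRotate_of_ne_last (by intro h; rw [h] at hi; simp at hi)]
    exact hij
  have hrot' : finRotate (k + 3) (Fin.last (k + 2)) = 0 := finRotate_last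
  let Ψ : Matrix (Fin l ⊕ Fin m) (Fin l ⊕ Fin m) ℂ →ₗ[ℂ] ((Fin (k + 2) → Fin d) → ℂ) :=
    { toFun := fun X s => ∑ x, c X x * ψ (Fin.cons x s : Fin (k + 3) → Fin d)
      map_add' := fun X Y => by ext s; simp [add_mul, Finset.sum_add_distrib]
      map_smul' := fun a X => by ext s; simp [Finset.mul_sum, mul_assoc] }
  have hΨ : ∀ X s, Ψ X s = ∑ x, c X x * ψ (Fin.cons x s : Fin (k + 3) → Fin d) := fun _ _ => rfl
  obtain ⟨f, hf⟩ := exists_functional_cfold hc (k + 2) Ψ (fun i hi s => by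
      obtain ⟨g, hg⟩ := hψ' 0 i.succ (hrot _ _ (by simp [hi])) (Fin.cons (s i) s)
      simp only [Fin.update_cons_zero, ← Fin.cons_update] at hg
      refine ⟨g, fun Z y => ?_⟩
      rw [hΨ]
      simp only [hg]
      conv_rhs => rw [← hc Z, ← cmulLin_apply]
      simp [LinearMap.sum_apply, cmulLin_apply])
    (fun i j hij Z s => by
      choose g hg using fun z => hψ' i.succ j.succ (hrot _ _ (by simp [← hij])) (Fin.cons z s)
      simp only [← Fin.cons_update] at hg
      refine ⟨∑ z, c Z z • g z, fun x y => ?_⟩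
      rw [hΨ]
      simp only [hg]
      simp [LinearMap.sum_apply])
  -- The bond between the first two sites shows that `ψ` depends on the first letter only through `T
  -- x`, so expanding `T x` by the section `c` gives back `ψ`.
  have hψf : ∀ x s, ψ (Fin.cons x s : Fin (k + 3) → Fin d) = f (cfold T (k + 2) s (T x)) := by
    intro x s
    rw [← hf, hΨ]
    obtain ⟨g, hg⟩ := hψ' 0 1 (hrot 0 1 (by simp)) (Fin.cons x s)
    have e : ∀ z, (Fin.cons z s : Fin (k + 3) → Fin d) =
        Function.update (Function.update (Fin.cons x s : Fin (k + 3) → Fin d) 0 z) 1 (s 0) := by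
      intro z
      rw [Fin.update_cons_zero]
      symm
      rw [Function.update_eq_self_iff]
      rfl
    have e' : ∀ z, ψ (Fin.cons z s : Fin (k + 3) → Fin d) = g (cmul 0 (T z) (T (s 0))) :=
      fun z => by rw [e z, hg]
    simp only [e']
    conv_lhs => rw [← hc (T x), ← cmulLin_apply]
    simp [LinearMap.sum_apply, cmulLin_apply]
  have hcyc : ∀ s : Fin (k + 1) → Fin d,
      ∃ g : Matrix (Fin l ⊕ Fin m) (Fin l ⊕ Fin m) ℂ →ₗ[ℂ] ℂ, ∀ X Y,
        f (cmul 0 (cfold T (k + 1) s Y) X) = g (cmul 0 X Y) := by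
    intro s
    -- The two letters `s 0` are placeholders, overwritten at both ends of the closing bond; three
    -- sites guarantee that `s` is nonempty.
    obtain ⟨g, hg⟩ := hψ' (Fin.last _) 0 hrot' (Fin.cons (s 0) (Fin.snoc s (s 0)))
    have h1 : ∀ x y, f (cmul 0 (cfold T (k + 1) s (T y)) (T x)) = g (cmul 0 (T x) (T y)) := by
      intro x y
      rw [← hg, ← cfold_snoc, ← hψf]
      refine congrArg ψ.ofLp ?_
      rw [← Fin.succ_last, ← Fin.cons_update, Fin.update_cons_zero, Fin.update_snoc_last]
    refine ⟨g, fun X Y => ?_⟩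
    rw [← hc X, ← hc Y, ← cmulLin_apply, ← cmulLin_apply]
    simp only [map_sum, map_smul, LinearMap.sum_apply, LinearMap.smul_apply, cmulLin_apply, h1,
      Finset.smul_sum]
    rw [Finset.sum_comm]
    exact Finset.sum_congr rfl fun x _ => Finset.sum_congr rfl fun y _ => smul_comm _ _ _
  choose g hg using hcyc
  -- Averaging the middle sites with the coefficients of the identity removes them, so the closing
  -- bond compares `Y X` with `X Y` directly. Setting `Y = 1` identifies the averaged functional
  -- with `f`, which is therefore tracial.
  have htr : ∀ X Y, f (cmul 0 Y X) = (∑ s, (∏ j, c 1 (s j)) • g s) (cmul 0 X Y) := by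
    intro X Y
    conv_lhs => rw [← sum_prod_smul_cfold (hc 1) (k + 1) Y, ← cmulLin_apply]
    simp [LinearMap.sum_apply, cmulLin_apply, hg]
  have hfg : ∀ X, f X = (∑ s, (∏ j, c 1 (s j)) • g s) X := by
    intro X
    simpa [one_cmul, cmul_one] using htr X 1
  obtain ⟨a, b, hab⟩ := exists_eq_blockTraces f fun X Y => by rw [htr Y X, ← hfg]
  refine ⟨a, b, ?_⟩
  ext s
  rw [← Fin.cons_self_tail s, hψf, hab]
  simp only [PiLp.add_apply, PiLp.smul_apply, smul_eq_mul, mpsState_apply, amp_cons]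
  rw [(toBlocks_cfold_wallTensor A B P _ _ _).1, (toBlocks_cfold_wallTensor A B P _ _ _).2]
  simp [hTdef, wallTensor]

end GroundSpace

/-! ### Local terms acting on matrix product vectors -/

section Bonds

theorem exists_amp_update_succ {κ R : Type} [Monoid R] (S : ℕ → κ → R) (n : ℕ) (i j : Fin n)
    (hij : (i : ℕ) + 1 = j) (s : Fin n → κ) :
    ∃ a b : R, ∀ x y, amp S n (Function.update (Function.update s i x) j y) =
      a * (S (n - 1 - i) x * S (n - 1 - j) y) * b := by
  induction n with
  | zero => exact i.elim0
  | succ n ih =>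
    obtain ⟨z, s, rfl⟩ : ∃ z s', s = (Fin.cons z s' : Fin (n + 1) → κ) :=
      ⟨s 0, Fin.tail s, (Fin.cons_self_tail s).symm⟩
    obtain ⟨j, rfl⟩ : ∃ j', j = Fin.succ j' :=
      Fin.exists_succ_eq.2 (by intro h; simp [h] at hij) |>.imp fun _ h => h.symm
    rcases Fin.eq_zero_or_eq_succ i with rfl | ⟨i, rfl⟩
    · obtain ⟨k, rfl⟩ : ∃ k, n = k + 1 := ⟨n - 1, by have := j.2; omega⟩
      have hj : j = 0 := by ext; simpa using hij.symm
      subst hj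
      refine ⟨1, amp S k (Fin.tail s), fun x y => ?_⟩
      rw [Fin.update_cons_zero, ← Fin.cons_update, amp_cons, amp]
      simp [mul_assoc]
    · obtain ⟨a, b, hab⟩ := ih i j (by simpa using hij) s
      refine ⟨S n z * a, b, fun x y => ?_⟩
      have e1 : n + 1 - 1 - (i.succ : ℕ) = n - 1 - i := by rw [Fin.val_succ]; omega
      have e2 : n + 1 - 1 - (j.succ : ℕ) = n - 1 - j := by rw [Fin.val_succ]; omega
      rw [← Fin.cons_update, ← Fin.cons_update, amp_cons, hab, e1, e2]
      simp only [mul_assoc]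

theorem amp_snoc {κ R : Type} [Monoid R] (S : ℕ → κ → R) (n : ℕ) (s : Fin n → κ) (x : κ) :
    amp S (n + 1) (Fin.snoc s x : Fin (n + 1) → κ) = amp (fun t => S (t + 1)) n s * S 0 x := by
  induction n with
  | zero => simp [amp, Fin.snoc]
  | succ n ih =>
    rw [← Fin.cons_self_tail s, ← Fin.cons_snoc_eq_snoc_cons, amp_cons, ih, amp_cons, mul_assoc]

/-- On the closing bond the two letters are the outermost factors of the product and in reversed
order; cyclicity of the trace later brings them together. -/
theorem exists_amp_update_last {κ R : Type} [Monoid R] (S : ℕ → κ → R) (n : ℕ)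
    (s : Fin (n + 2) → κ) :
    ∃ b : R, ∀ x y, amp S (n + 2) (Function.update (Function.update s (Fin.last (n + 1)) x) 0 y) =
      S (n + 1) y * b * S 0 x := by
  obtain ⟨z, s, rfl⟩ : ∃ z s', s = (Fin.cons z s' : Fin (n + 2) → κ) :=
    ⟨s 0, Fin.tail s, (Fin.cons_self_tail s).symm⟩
  obtain ⟨s, w, rfl⟩ : ∃ s' w, s = (Fin.snoc s' w : Fin (n + 1) → κ) :=
    ⟨Fin.init s, s (Fin.last n), (Fin.snoc_init_self s).symm⟩
  refine ⟨amp (fun t => S (t + 1)) n s, fun x y => ?_⟩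
  rw [← Fin.succ_last, ← Fin.cons_update, Fin.update_cons_zero, Fin.update_snoc_last, amp_cons,
    amp_snoc, mul_assoc]

variable {d l m : ℕ} {T : Tensor (Fin d) (Fin l ⊕ Fin m)} {R : Type} [Ring R] [Algebra ℂ R]

theorem finRotate_eq_or {n : ℕ} (i : Fin (n + 2)) :
    (i = Fin.last (n + 1) ∧ finRotate (n + 2) i = 0) ∨ (i : ℕ) + 1 = finRotate (n + 2) i := by
  by_cases h : i = Fin.last (n + 1)
  · left
    exact ⟨h, by rw [h, finRotate_last]⟩
  · right
    rw [coe_finRotate_of_ne_last h]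

/-- Neighbouring site tensors whose product is a linear function of the contracted product lie in
the limiting local ground space. -/
theorem slice_mem_limitSpan_of_succ {n : ℕ} (S : ℕ → Fin d → R) (F : R →ₗ[ℂ] ℂ)
    {ψ : ChainSpace d n} (hψ : ∀ s, ψ s = F (amp S n s)) {i j : Fin n} (hij : (i : ℕ) + 1 = j)
    (Θ : Matrix (Fin l ⊕ Fin m) (Fin l ⊕ Fin m) ℂ →ₗ[ℂ] R)
    (hΘ : ∀ x y, S (n - 1 - i) x * S (n - 1 - j) y = Θ (cmul 0 (T x) (T y)))
    (s : Fin n → Fin d) : slice i j s ψ ∈ limitSpan T := by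
  obtain ⟨a, b, hab⟩ := exists_amp_update_succ S n i j hij s
  rw [mem_limitSpan_iff]
  refine ⟨F ∘ₗ LinearMap.mulRight ℂ b ∘ₗ LinearMap.mulLeft ℂ a ∘ₗ Θ, fun x y => ?_⟩
  change ψ (Function.update (Function.update s i x) j y) = _
  rw [hψ, hab, hΘ]
  rfl

theorem slice_mem_limitSpan_of_last {n : ℕ} (S : ℕ → Fin d → R) (F : R →ₗ[ℂ] ℂ)
    {ψ : ChainSpace d (n + 2)} (hψ : ∀ s, ψ s = F (amp S (n + 2) s))
    (hF : ∀ b, ∃ Θ : Matrix (Fin l ⊕ Fin m) (Fin l ⊕ Fin m) ℂ →ₗ[ℂ] ℂ,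
      ∀ x y, F (S (n + 1) y * b * S 0 x) = Θ (cmul 0 (T x) (T y)))
    (s : Fin (n + 2) → Fin d) : slice (Fin.last (n + 1)) 0 s ψ ∈ limitSpan T := by
  obtain ⟨b, hb⟩ := exists_amp_update_last S n s
  obtain ⟨Θ, hΘ⟩ := hF b
  rw [mem_limitSpan_iff]
  refine ⟨Θ, fun x y => ?_⟩
  change ψ (Function.update (Function.update s (Fin.last (n + 1)) x) 0 y) = _
  rw [hψ, hb, hΘ]

variable (A : Tensor (Fin d) (Fin l)) (B : Tensor (Fin d) (Fin m))
  (P : Tensor (Fin d) (Fin l ⊕ Fin m))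

theorem cmul_wallTensor (x y : Fin d) :
    cmul 0 (wallTensor A B P x) (wallTensor A B P y) =
      Matrix.fromBlocks (A x * A y)
        (A x * (P y).toBlocks₁₂ + (P x).toBlocks₁₂ * B y)
        ((P x).toBlocks₂₁ * A y + B x * (P y).toBlocks₂₁) (B x * B y) := by
  rw [wallTensor, wallTensor, cmul_fromBlocks]
  simp

/-- A matrix product state built from a tensor whose two-site products are linear functions of the
contracted products is a ground state. -/
theorem slice_mpsState_mem {ι : Type} [Fintype ι] [DecidableEq ι] (D : Tensor (Fin d) ι)
    (Θ : Matrix (Fin l ⊕ Fin m) (Fin l ⊕ Fin m) ℂ →ₗ[ℂ] Matrix ι ι ℂ)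
    (hΘ : ∀ x y, D x * D y = Θ (cmul 0 (T x) (T y))) {n : ℕ} (hn : 2 ≤ n) (i : Fin n)
    (s : Fin n → Fin d) : slice i (finRotate n i) s (mpsState D n) ∈ limitSpan T := by
  obtain ⟨k, rfl⟩ : ∃ k, n = k + 2 := ⟨n - 2, by omega⟩
  rcases finRotate_eq_or i with ⟨h1, h2⟩ | h
  · rw [h2, h1]
    refine slice_mem_limitSpan_of_last (fun _ => D) (Matrix.traceLinearMap ι ℂ ℂ)
      (fun s => mpsState_apply D _ s) (fun b => ?_) s
    refine ⟨Matrix.traceLinearMap ι ℂ ℂ ∘ₗ LinearMap.mulRight ℂ b ∘ₗ Θ, fun x y => ?_⟩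
    simp only [LinearMap.comp_apply, ← hΘ, LinearMap.mulRight_apply, Matrix.traceLinearMap_apply]
    rw [Matrix.trace_mul_comm, Matrix.mul_assoc]
  · exact slice_mem_limitSpan_of_succ (fun _ => D) (Matrix.traceLinearMap ι ℂ ℂ)
      (fun s => mpsState_apply D _ s) h Θ hΘ s

theorem slice_mpsState_left_mem {n : ℕ} (hn : 2 ≤ n) (i : Fin n) (s : Fin n → Fin d) :
    slice i (finRotate n i) s (mpsState A n) ∈ limitSpan (wallTensor A B P) :=
  slice_mpsState_mem A
    { toFun := Matrix.toBlocks₁₁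
      map_add' := fun _ _ => rfl
      map_smul' := fun _ _ => rfl }
    (fun x y => by rw [cmul_wallTensor]; rfl) hn i s

/-- The upper right wall of a perturbation. -/
def wallR : Tensor (Fin d) (Fin l ⊕ Fin m) := fun x => upperRight (P x)

/-- The lower left wall of a perturbation. -/
def wallL : Tensor (Fin d) (Fin l ⊕ Fin m) := fun x => lowerLeft (P x)

theorem wallState_apply_eq {n : ℕ} (ρ w : ℕ → ℂ) (s : Fin n → Fin d) :
    wallState (directSum A B) (wallR P) (wallL P) ρ w n s =
      (Matrix.traceLinearMap _ ℂ ℂ ∘ₗ Matrix.entryLinearMap ℂ _ (0 : Fin 3) (2 : Fin 3))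
        (amp (triSites (directSum A B) (wallR P) (wallL P) ρ w) n s) := by
  rw [LinearMap.comp_apply, Matrix.entryLinearMap_apply, (amp_triSites ρ w n s).2.2.2.2]
  rfl

theorem directSum_mul (x y : Fin d) : directSum A B x * directSum A B y =
    blockDiag (cmul 0 (wallTensor A B P x) (wallTensor A B P y)) := by
  rw [cmul_wallTensor, blockDiag_fromBlocks, directSum, directSum, Matrix.fromBlocks_multiply]
  simp

theorem directSum_mul_wallR (x y : Fin d) :
    directSum A B x * wallR P y + wallR P x * directSum A B y =
      upperRight (cmul 0 (wallTensor A B P x) (wallTensor A B P y)) := by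
  rw [cmul_wallTensor]
  simp [upperRight, directSum, wallR, Matrix.fromBlocks_multiply, Matrix.fromBlocks_add]

theorem directSum_mul_wallL (x y : Fin d) :
    directSum A B x * wallL P y + wallL P x * directSum A B y =
      lowerLeft (cmul 0 (wallTensor A B P x) (wallTensor A B P y)) := by
  rw [cmul_wallTensor]
  simp [lowerLeft, directSum, wallL, Matrix.fromBlocks_multiply, Matrix.fromBlocks_add, add_comm]

/-- Equal weights give `C R` and `R C` the same coefficient, as in the off-diagonal block of the
contracted product. The condition `ρ b * w b = 0` removes the term `R L`, which the contracted
product lacks. -/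
theorem triSites_mul {ι : Type} [Fintype ι] [DecidableEq ι] {C R L : Tensor (Fin d) ι}
    {ρ w : ℕ → ℂ} {a b : ℕ}
    (hρ : ρ a = ρ b) (hw : w a = w b) (hρw : ρ b * w b = 0) (x y : Fin d) :
    triSites C R L ρ w a x * triSites C R L ρ w b y =
      !![C x * C y, ρ b • (C x * R y + R x * C y), 0;
        0, C x * C y, w b • (C x * L y + L x * C y); 0, 0, C x * C y] := by
  have h02 : (ρ b • R x) * (w b • L y) = 0 := by
    rw [Matrix.smul_mul, Matrix.mul_smul, smul_smul, hρw, zero_smul]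
  ext i j : 2
  fin_cases i <;> fin_cases j <;>
    simp only [triSites, Matrix.mul_apply, Fin.sum_univ_three, hρ, hw, Matrix.of_apply,
      Matrix.cons_val', Matrix.cons_val_zero, Matrix.cons_val_one, Matrix.cons_val,
      Matrix.cons_val_fin_one, Fin.zero_eta, Fin.mk_one, Fin.reduceFinMk, zero_mul, mul_zero,
      add_zero, zero_add, h02] <;>
    simp only [smul_add, Matrix.mul_smul, Matrix.smul_mul]

/-- A matrix of linear maps as a matrix valued linear map. -/
def matrixOfMaps {V W : Type} [AddCommMonoid V] [Module ℂ V] [AddCommMonoid W] [Module ℂ W]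
    {k : ℕ} (M : Fin k → Fin k → V →ₗ[ℂ] W) : V →ₗ[ℂ] Matrix (Fin k) (Fin k) W where
  toFun Z := Matrix.of fun i j => M i j Z
  map_add' Z Z' := by ext i j : 2; exact map_add (M i j) _ _
  map_smul' c Z := by ext i j : 2; exact map_smul (M i j) _ _

/-- A superposition of walls costs no energy at a bond across which neither weight jumps. -/
theorem slice_wallState_succ_mem {n : ℕ} {ρ w : ℕ → ℂ} {i j : Fin n} (hij : (i : ℕ) + 1 = j)
    (hρ : ρ (n - 1 - i) = ρ (n - 1 - j)) (hw : w (n - 1 - i) = w (n - 1 - j))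
    (hρw : ρ (n - 1 - j) * w (n - 1 - j) = 0) (s : Fin n → Fin d) :
    slice i j s (wallState (directSum A B) (wallR P) (wallL P) ρ w n) ∈
      limitSpan (wallTensor A B P) := by
  refine slice_mem_limitSpan_of_succ _ _ (wallState_apply_eq A B P ρ w) hij
    (matrixOfMaps ![![blockDiag, ρ (n - 1 - j) • upperRight, 0],
      ![0, blockDiag, w (n - 1 - j) • lowerLeft], ![0, 0, blockDiag]]) (fun x y => ?_) s
  rw [triSites_mul hρ hw hρw, directSum_mul A B P, directSum_mul_wallR, directSum_mul_wallL]
  ext i j : 2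
  fin_cases i <;> fin_cases j <;> rfl

/-- With no `L` at the rightmost site and no `R` at the leftmost one, only `C` occurs at the two
ends in the entry `(0, 2)`, and the trace can be rotated. -/
theorem slice_wallState_last_mem {n : ℕ} {ρ w : ℕ → ℂ} (hw0 : w 0 = 0)
    (hρn : ρ (n + 1) = 0) (s : Fin (n + 2) → Fin d) :
    slice (Fin.last (n + 1)) 0 s (wallState (directSum A B) (wallR P) (wallL P) ρ w (n + 2)) ∈
      limitSpan (wallTensor A B P) := by
  refine slice_mem_limitSpan_of_last _ _ (wallState_apply_eq A B P ρ w) (fun b => ?_) s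
  refine ⟨Matrix.traceLinearMap _ ℂ ℂ ∘ₗ LinearMap.mulRight ℂ (b 0 2) ∘ₗ blockDiag,
    fun x y => ?_⟩
  have h2 : (triSites (directSum A B) (wallR P) (wallL P) ρ w (n + 1) y * b *
      triSites (directSum A B) (wallR P) (wallL P) ρ w 0 x) 0 2 =
      directSum A B y * b 0 2 * directSum A B x := by
    have e : ∀ c D : Matrix (Fin 3) (Fin 3) (Matrix (Fin l ⊕ Fin m) (Fin l ⊕ Fin m) ℂ),
        c 0 1 = 0 → c 0 2 = 0 → D 0 2 = 0 → D 1 2 = 0 →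
        (c * b * D) 0 2 = c 0 0 * b 0 2 * D 2 2 := by
      intro c D h1 h2 h3 h4
      simp only [Matrix.mul_apply, Fin.sum_univ_three, h1, h2, h3, h4, zero_mul, mul_zero,
        add_zero, zero_add]
    refine e _ _ ?_ ?_ ?_ ?_
    · exact (congrArg (· • wallR P y) hρn).trans (zero_smul _ _)
    · rfl
    · rfl
    · exact (congrArg (· • wallL P x) hw0).trans (zero_smul _ _)
  simp only [LinearMap.comp_apply, ← directSum_mul, LinearMap.mulRight_apply,
    Matrix.traceLinearMap_apply, Matrix.entryLinearMap_apply, h2]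
  rw [Matrix.trace_mul_comm, Matrix.mul_assoc]

end Bonds

/-! ### The direct sum of two normal blocks -/

section DirectSum

variable {d l m : ℕ}

/-- The projection onto the first block. -/
def projLeft (l m : ℕ) : Matrix (Fin l ⊕ Fin m) (Fin l ⊕ Fin m) ℂ := Matrix.fromBlocks 1 0 0 0

/-- The projection onto the second block. -/
def projRight (l m : ℕ) : Matrix (Fin l ⊕ Fin m) (Fin l ⊕ Fin m) ℂ := Matrix.fromBlocks 0 0 0 1

variable {A : Tensor (Fin d) (Fin l)} {B : Tensor (Fin d) (Fin m)}

theorem posDef_fromBlocks {ΛA : Matrix (Fin l) (Fin l) ℂ} {ΛB : Matrix (Fin m) (Fin m) ℂ}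
    (hA : ΛA.PosDef) (hB : ΛB.PosDef) : (Matrix.fromBlocks ΛA 0 0 ΛB).PosDef := by
  refine Matrix.PosDef.of_dotProduct_mulVec_pos
    (Matrix.IsHermitian.fromBlocks hA.1 (by simp) hB.1) fun x hx => ?_
  rw [← Sum.elim_comp_inl_inr x, Matrix.fromBlocks_mulVec]
  simp only [Matrix.zero_mulVec, add_zero, zero_add, Sum.elim_comp_inl_inr]
  have e : star x ⬝ᵥ Sum.elim (ΛA.mulVec (x ∘ Sum.inl)) (ΛB.mulVec (x ∘ Sum.inr)) =
      star (x ∘ Sum.inl) ⬝ᵥ ΛA.mulVec (x ∘ Sum.inl) +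
        star (x ∘ Sum.inr) ⬝ᵥ ΛB.mulVec (x ∘ Sum.inr) := by
    simp [dotProduct, Fintype.sum_sum_type]
  rw [e]
  by_cases hl : x ∘ Sum.inl = 0
  · have hr : x ∘ Sum.inr ≠ 0 := by
      intro hr
      apply hx
      funext i
      rcases i with i | i
      · exact congrFun hl i
      · exact congrFun hr i
    exact add_pos_of_nonneg_of_pos (hA.posSemidef.dotProduct_mulVec_nonneg _)
      (hB.dotProduct_mulVec_pos hr)
  · exact add_pos_of_pos_of_nonneg (hA.dotProduct_mulVec_pos hl)
      (hB.posSemidef.dotProduct_mulVec_nonneg _)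

theorem trace_fromBlocks (a : Matrix (Fin l) (Fin l) ℂ) (b : Matrix (Fin l) (Fin m) ℂ)
    (c : Matrix (Fin m) (Fin l) ℂ) (e : Matrix (Fin m) (Fin m) ℂ) :
    (Matrix.fromBlocks a b c e).trace = a.trace + e.trace := by
  simp [Matrix.trace, Fintype.sum_sum_type]

/-- A matrix commuting with every matrix is a scalar. -/
theorem exists_eq_smul_one_of_comm {n : ℕ} {X : Matrix (Fin n) (Fin n) ℂ}
    (hX : ∀ Y, Y * X = X * Y) : ∃ a : ℂ, X = a • 1 := by
  have h := Matrix.mem_range_scalar_of_commute_single (M := X)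
    fun i j _ => (hX (Matrix.single i j 1))
  obtain ⟨a, ha⟩ := h
  exact ⟨a, by rw [← ha, Matrix.scalar_apply, Matrix.smul_one_eq_diagonal]⟩

/-- Block-injectivity allows to replace the matrices of the tensor by arbitrary pairs. -/
theorem linearMap_eq_of_blockInjective {V : Type*} [AddCommGroup V] [Module ℂ V]
    (hAB : Submodule.span ℂ (Set.range fun i => (A i, B i)) = ⊤)
    {f g : (Matrix (Fin l) (Fin l) ℂ × Matrix (Fin m) (Fin m) ℂ) →ₗ[ℂ] V}
    (h : ∀ i, f (A i, B i) = g (A i, B i)) (x : Matrix (Fin l) (Fin l) ℂ)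
    (y : Matrix (Fin m) (Fin m) ℂ) : f (x, y) = g (x, y) := by
  have : f = g := LinearMap.ext_on_range hAB h
  rw [this]

/-- The embedding of pairs of matrices as block diagonal matrices. -/
def fromDiagBlocks (l m : ℕ) : (Matrix (Fin l) (Fin l) ℂ × Matrix (Fin m) (Fin m) ℂ) →ₗ[ℂ]
    Matrix (Fin l ⊕ Fin m) (Fin l ⊕ Fin m) ℂ where
  toFun x := Matrix.fromBlocks x.1 0 0 x.2
  map_add' x y := by simp [Matrix.fromBlocks_add]
  map_smul' c x := by simp [Matrix.fromBlocks_smul]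

/-- By linearity `X` commutes with all block diagonal matrices: its diagonal blocks are central, and
the block identities force the off-diagonal blocks to vanish. -/
theorem directSum_commutant (hAB : Submodule.span ℂ (Set.range fun i => (A i, B i)) = ⊤)
    (X : Matrix (Fin l ⊕ Fin m) (Fin l ⊕ Fin m) ℂ)
    (hX : ∀ i, directSum A B i * X = X * directSum A B i) :
    ∃ a b : ℂ, X = a • projLeft l m + b • projRight l m := by
  have key : ∀ x y, Matrix.fromBlocks x 0 0 y * X = X * Matrix.fromBlocks x 0 0 y :=
    linearMap_eq_of_blockInjective (A := A) (B := B)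
      (f := LinearMap.mulRight ℂ X ∘ₗ fromDiagBlocks l m)
      (g := LinearMap.mulLeft ℂ X ∘ₗ fromDiagBlocks l m) hAB hX
  rw [← Matrix.fromBlocks_toBlocks X] at key ⊢
  simp only [Matrix.fromBlocks_multiply, Matrix.fromBlocks_inj, Matrix.zero_mul, Matrix.mul_zero,
    add_zero, zero_add] at key
  obtain ⟨a, ha⟩ := exists_eq_smul_one_of_comm fun Y => (key Y 0).1
  obtain ⟨b, hb⟩ := exists_eq_smul_one_of_comm fun Y => (key 0 Y).2.2.2
  have h12 := (key 1 0).2.1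
  have h21 := (key 0 1).2.2.1
  simp only [Matrix.one_mul, Matrix.mul_zero] at h12 h21
  refine ⟨a, b, ?_⟩
  rw [ha, hb, h12, h21]
  simp [projLeft, projRight, Matrix.fromBlocks_smul, Matrix.fromBlocks_add]

/-- A tensor in standard form is a two-block tensor. -/
theorem IsStandardForm.exists_isTwoBlock (hAB : IsStandardForm A B) :
    ∃ Λ, IsTwoBlock (directSum A B) (projLeft l m) (projRight l m) Λ := by
  obtain ⟨ΛA, hA, hAt, hAf⟩ := hAB.left.exists_fixed
  obtain ⟨ΛB, hB, hBt, hBf⟩ := hAB.right.exists_fixed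
  have hAu : ∑ x, A x * (A x).conjTranspose = 1 := by
    have := hAB.left.unital
    simpa [transfer] using this
  have hBu : ∑ x, B x * (B x).conjTranspose = 1 := by
    have := hAB.right.unital
    simpa [transfer] using this
  have hsum : ∀ (f : Fin d → Matrix (Fin l) (Fin l) ℂ) (g : Fin d → Matrix (Fin m) (Fin m) ℂ),
      ∑ x, Matrix.fromBlocks (f x) 0 0 (g x) = Matrix.fromBlocks (∑ x, f x) 0 0 (∑ x, g x) := by
    intro f g
    have h1 := map_sum (fromDiagBlocks l m) (fun x => (f x, g x)) Finset.univ
    have h2 : ∑ x, (f x, g x) = (∑ x, f x, ∑ x, g x) := by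
      ext1 <;> simp [Prod.fst_sum, Prod.snd_sum]
    rw [h2] at h1
    exact h1.symm
  refine ⟨Matrix.fromBlocks ΛA 0 0 ΛB, ?_⟩
  constructor
  · simp [projLeft, projRight, Matrix.fromBlocks_add]
  · simp [projLeft, Matrix.fromBlocks_multiply]
  · simp [projRight, Matrix.fromBlocks_multiply]
  · simp [projLeft, projRight, Matrix.fromBlocks_multiply]
  · simp [projLeft, projRight, Matrix.fromBlocks_multiply]
  · simp [projLeft, Matrix.fromBlocks_conjTranspose]
  · simp [projRight, Matrix.fromBlocks_conjTranspose]
  · simp [projLeft, directSum, Matrix.fromBlocks_multiply]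
  · simp [projRight, directSum, Matrix.fromBlocks_multiply]
  · simp only [mixedTransfer_apply, directSum, Matrix.fromBlocks_conjTranspose,
      Matrix.fromBlocks_multiply, Matrix.mul_one]
    simp [hsum, hAu, hBu]
  · exact posDef_fromBlocks hA hB
  · simp only [directSum, Matrix.fromBlocks_conjTranspose, Matrix.fromBlocks_multiply]
    simp [hsum, hAf, hBf]
  · simp [projLeft, Matrix.fromBlocks_multiply, trace_fromBlocks, hAt]
  · simp [projRight, Matrix.fromBlocks_multiply, trace_fromBlocks, hBt]
  · intro X
    rw [← Matrix.fromBlocks_toBlocks X]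
    simp [projLeft, projRight, Matrix.fromBlocks_multiply, trace_fromBlocks]
  · intro X
    rw [← Matrix.fromBlocks_toBlocks X]
    simp [projLeft, projRight, Matrix.fromBlocks_multiply, trace_fromBlocks]
  · have h1 : ((1, 1) : Matrix (Fin l) (Fin l) ℂ × Matrix (Fin m) (Fin m) ℂ) ∈
        Submodule.span ℂ (Set.range fun i => (A i, B i)) := by
      rw [hAB.blockInjective]; trivial
    have h2 := Submodule.mem_map_of_mem (f := fromDiagBlocks l m) h1
    rw [Submodule.map_span, ← Set.range_comp] at h2
    have h3 : fromDiagBlocks l m (1, 1) = 1 := Matrix.fromBlocks_one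
    rw [h3] at h2
    exact h2
  · exact directSum_commutant hAB.blockInjective

theorem projLeft_mul_wallR (P : Tensor (Fin d) (Fin l ⊕ Fin m)) (x : Fin d) :
    projLeft l m * wallR P x * projRight l m = wallR P x := by
  simp [projLeft, projRight, wallR, upperRight, Matrix.fromBlocks_multiply]

theorem projRight_mul_wallL (P : Tensor (Fin d) (Fin l ⊕ Fin m)) (x : Fin d) :
    projRight l m * wallL P x * projLeft l m = wallL P x := by
  simp [projLeft, projRight, wallL, lowerLeft, Matrix.fromBlocks_multiply]

theorem amp_directSum (n : ℕ) (s : Fin n → Fin d) :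
    amp (fun _ => directSum A B) n s =
      Matrix.fromBlocks (amp (fun _ => A) n s) 0 0 (amp (fun _ => B) n s) := by
  induction n with
  | zero => simp [amp]
  | succ n ih => simp [amp, ih, directSum, Matrix.fromBlocks_multiply]

theorem mpsState_left_apply (A : Tensor (Fin d) (Fin l)) (B : Tensor (Fin d) (Fin m)) (n : ℕ)
    (s : Fin n → Fin d) :
    mpsState A n s = (amp (fun _ => directSum A B) n s * projLeft l m).trace := by
  rw [mpsState_apply, amp_directSum]
  simp [projLeft, Matrix.fromBlocks_multiply, trace_fromBlocks]

theorem mpsState_right_apply (A : Tensor (Fin d) (Fin l)) (B : Tensor (Fin d) (Fin m)) (n : ℕ)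
    (s : Fin n → Fin d) :
    mpsState B n s = (amp (fun _ => directSum A B) n s * projRight l m).trace := by
  rw [mpsState_apply, amp_directSum]
  simp [projRight, Matrix.fromBlocks_multiply, trace_fromBlocks]

end DirectSum

/-! ### The trial state as a superposition of domain walls -/

section TrialState

/-- Block projections between the walls may be inserted or dropped. -/
theorem IsTwoBlock.amp_wallSites {κ ι : Type} [Fintype κ] [Fintype ι] [DecidableEq ι]
    {C R L : Tensor κ ι} {p q Λ : Matrix ι ι ℂ} (h : IsTwoBlock C p q Λ)
    (hR : ∀ x, p * R x * q = R x) (hL : ∀ x, q * L x * p = L x) {a b : ℕ} (hba : b < a)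
    {T : ℕ → Tensor κ ι} (hTa : T a = R) (hTb : T b = L)
    (hin : ∀ t x, b < t → t < a → T t x = q * C x)
    (hout : ∀ t x, t < b ∨ a < t → T t x = p * C x) {n : ℕ} (hn : a < n) (s : Fin n → κ) :
    amp T n s = amp (wallSites C R L a b) n s := by
  have hpR : ∀ x, p * R x = R x := fun x => by
    rw [← hR x, ← Matrix.mul_assoc, ← Matrix.mul_assoc, h.pp]
  have hqL : ∀ x, q * L x = L x := fun x => by
    rw [← hL x, ← Matrix.mul_assoc, ← Matrix.mul_assoc, h.qq]
  have hLp : ∀ x, L x * p = L x := fun x => by rw [← hL x, Matrix.mul_assoc, h.pp]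
  have hRq : ∀ x, R x * q = R x := fun x => by rw [← hR x, Matrix.mul_assoc, h.qq]
  have hC : ∀ t, t ≠ a → t ≠ b → wallSites C R L a b t = C := fun t h1 h2 => by
    rw [wallSites, if_neg h1, if_neg h2]
  -- To the right of `L` the two amplitudes agree only after multiplication by `p`; the wall itself
  -- supplies this factor, as `L = L p`.
  have h1 : ∀ n ≤ b, ∀ s : Fin n → κ, p * amp T n s = p * amp (wallSites C R L a b) n s := by
    intro n hn
    induction n with
    | zero => intro s; rfl
    | succ n ih =>
      intro s
      rw [amp, amp, hC n (by omega) (by omega), hout n _ (by omega), ← Matrix.mul_assoc,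
        ← Matrix.mul_assoc, h.pp, ← h.comm_p, Matrix.mul_assoc, ih (by omega), ← Matrix.mul_assoc,
        ← Matrix.mul_assoc, h.comm_p]
  have h2 : ∀ n, b < n → n ≤ a → ∀ s : Fin n → κ, amp T n s = amp (wallSites C R L a b) n s ∧
      q * amp (wallSites C R L a b) n s = amp (wallSites C R L a b) n s := by
    intro n hbn hna
    induction n with
    | zero => omega
    | succ n ih =>
      intro s
      rcases Nat.lt_succ_iff_lt_or_eq.1 hbn with hlt | rfl
      · obtain ⟨e1, e2⟩ := ih hlt (by omega) (Fin.tail s)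
        rw [amp, amp, hC n (by omega) (by omega), hin n _ hlt (by omega), e1, ← h.comm_q,
          Matrix.mul_assoc, e2, ← Matrix.mul_assoc, ← h.comm_q, Matrix.mul_assoc, e2]
        exact ⟨rfl, rfl⟩
      · have hw : wallSites C R L a b b = L := by
          rw [wallSites, if_neg (by omega), if_pos rfl]
        rw [amp, amp, hw, hTb, ← hLp, Matrix.mul_assoc, Matrix.mul_assoc, h1 b le_rfl]
        refine ⟨rfl, ?_⟩
        rw [← Matrix.mul_assoc, hqL]
  have h3 : ∀ n, a < n → ∀ s : Fin n → κ, amp T n s = amp (wallSites C R L a b) n s ∧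
      p * amp (wallSites C R L a b) n s = amp (wallSites C R L a b) n s := by
    intro n hn
    induction n with
    | zero => omega
    | succ n ih =>
      intro s
      rcases Nat.lt_succ_iff_lt_or_eq.1 hn with hlt | rfl
      · obtain ⟨e1, e2⟩ := ih hlt (Fin.tail s)
        rw [amp, amp, hC n (by omega) (by omega), hout n _ (by omega), e1, ← h.comm_p,
          Matrix.mul_assoc, e2, ← Matrix.mul_assoc, ← h.comm_p, Matrix.mul_assoc, e2]
        exact ⟨rfl, rfl⟩
      · have hw : wallSites C R L a b a = R := by rw [wallSites, if_pos rfl]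
        rw [amp, amp, hw, hTa, (h2 a hba le_rfl _).1]
        refine ⟨rfl, ?_⟩
        rw [← Matrix.mul_assoc, hpR]
  exact (h3 n hn s).1

variable {d l m : ℕ} {A : Tensor (Fin d) (Fin l)} {B : Tensor (Fin d) (Fin m)}

theorem domainWall_eq_chainState (hAB : IsStandardForm A B) (P : Tensor (Fin d) (Fin l ⊕ Fin m))
    {N a b : ℕ} {i j : ℤ} (hi : i = 3 * N - a) (hj : j = 3 * N - b) (hba : b < a)
    (ha : a < 6 * N + 1) :
    domainWall A B P N i j =
      chainState (wallSites (directSum A B) (wallR P) (wallL P) a b) (6 * N + 1) := by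
  obtain ⟨Λ, h⟩ := hAB.exists_isTwoBlock
  let T : ℕ → Tensor (Fin d) (Fin l ⊕ Fin m) := fun t x =>
    if t = a then wallR P x else if t = b then wallL P x
    else if b < t ∧ t < a then Matrix.fromBlocks 0 0 0 (B x) else Matrix.fromBlocks (A x) 0 0 0
  have h1 : domainWall A B P N i j = chainState T (6 * N + 1) := by
    refine siteState_eq_chainState _ _ fun k => ?_
    funext x
    have hk := k.2
    -- The site at position `pos` has label `3N - pos`, since labels count from the right end `3N`.
    have e1 : ((k : ℤ) - 3 * N = i) ↔ 6 * N + 1 - 1 - (k : ℕ) = a := by omega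
    have e2 : ((k : ℤ) - 3 * N = j) ↔ 6 * N + 1 - 1 - (k : ℕ) = b := by omega
    have e3 : (i < (k : ℤ) - 3 * N ∧ (k : ℤ) - 3 * N < j) ↔
        b < 6 * N + 1 - 1 - (k : ℕ) ∧ 6 * N + 1 - 1 - (k : ℕ) < a := by omega
    simp only [T, e1, e2, e3]
    rfl
  rw [h1]
  ext s
  simp only [chainState]
  rw [h.amp_wallSites (projLeft_mul_wallR P) (projRight_mul_wallL P) hba
    (T := T) (by funext x; simp [T]) (by funext x; simp [T, hba.ne])
    (fun t x h1 h2 => ?_) (fun t x h1 => ?_) ha]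
  · simp only [T]
    rw [if_neg h2.ne, if_neg h1.ne', if_pos ⟨h1, h2⟩]
    simp [projRight, directSum, Matrix.fromBlocks_multiply]
  · simp only [T]
    rw [if_neg (by omega), if_neg (by omega), if_neg (by omega)]
    simp [projLeft, directSum, Matrix.fromBlocks_multiply]

/-- Under `pos ↦ 3N - pos` the range `[-2N, -N]` of `R` becomes `[4N, 5N]`, and the range `[N, 2N]`
of `L` is mapped to itself. -/
theorem trialState_eq_sum (hAB : IsStandardForm A B) (P : Tensor (Fin d) (Fin l ⊕ Fin m))
    {N : ℕ} (hN : 1 ≤ N) :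
    trialState A B P N = ∑ a ∈ Finset.Icc (4 * N) (5 * N), ∑ b ∈ Finset.Icc N (2 * N),
      chainState (wallSites (directSum A B) (wallR P) (wallL P) a b) (6 * N + 1) := by
  have reindex : ∀ (x y : ℕ) (u v : ℤ) (f : ℕ → ChainSpace d (6 * N + 1))
      (g : ℤ → ChainSpace d (6 * N + 1)), u = 3 * N - y → v = 3 * N - x →
      (∀ t ∈ Finset.Icc x y, g (3 * N - t) = f t) →
      ∑ i ∈ Finset.Icc u v, g i = ∑ t ∈ Finset.Icc x y, f t := by
    intro x y u v f g hu hv hfg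
    symm
    refine Finset.sum_bij (fun t _ => (3 * N - t : ℤ)) ?_ ?_ ?_ ?_
    · intro t ht; rw [Finset.mem_Icc] at ht ⊢; omega
    · intro t _ t' _ he; simpa using he
    · intro i hi
      rw [Finset.mem_Icc] at hi
      exact ⟨(3 * N - i).toNat, by rw [Finset.mem_Icc]; omega, by omega⟩
    · intro t ht; exact (hfg t ht).symm
  rw [trialState]
  refine reindex _ _ _ _ _ _ (by push_cast; ring) (by push_cast; ring) fun a ha => ?_
  refine reindex _ _ _ _ _ _ (by push_cast; ring) (by ring) fun b hb => ?_
  rw [Finset.mem_Icc] at ha hb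
  exact domainWall_eq_chainState hAB P rfl rfl (by omega) (by omega)

theorem trialState_eq_wallState (hAB : IsStandardForm A B) (P : Tensor (Fin d) (Fin l ⊕ Fin m))
    {N : ℕ} (hN : 1 ≤ N) :
    trialState A B P N = wallState (directSum A B) (wallR P) (wallL P)
      (fun t => if t ∈ Finset.Icc (4 * N) (5 * N) then 1 else 0)
      (fun t => if t ∈ Finset.Icc N (2 * N) then 1 else 0) (6 * N + 1) := by
  rw [trialState_eq_sum hAB P hN, wallState_indicator]
  · intro i hi j hj; rw [Finset.mem_Icc] at hi hj; omega
  · intro i hi; rw [Finset.mem_Icc] at hi; omega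

end TrialState

/-! ### Norm and energy of the trial state: upper bounds -/

section Energy

theorem wallState_eq_add_left {d : ℕ} {ι : Type} [Fintype ι] [DecidableEq ι]
    (C R L : Tensor (Fin d) ι) (ρ ρ' w : ℕ → ℂ) (n : ℕ) :
    wallState C R L ρ w n = wallState C R L (ρ - ρ') w n + wallState C R L ρ' w n := by
  ext s
  simp [wallState, twoWall_sub_left]

theorem wallState_eq_add_right {d : ℕ} {ι : Type} [Fintype ι] [DecidableEq ι]
    (C R L : Tensor (Fin d) ι) (ρ w w' : ℕ → ℂ) (n : ℕ) :
    wallState C R L ρ w n = wallState C R L ρ (w - w') n + wallState C R L ρ w' n := by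
  ext s
  simp [wallState, twoWall_sub_right]

/-- The weight function of a set of wall positions. -/
def weight (I : Finset ℕ) (t : ℕ) : ℂ := if t ∈ I then 1 else 0

theorem weight_of_notMem {I : Finset ℕ} {t : ℕ} (h : t ∉ I) : weight I t = 0 := if_neg h

theorem norm_weight_le (I : Finset ℕ) (t : ℕ) : ‖weight I t‖ ≤ 1 := by
  rw [weight]; split_ifs <;> simp

theorem sum_norm_weight_le (I : Finset ℕ) (n : ℕ) :
    ∑ t ∈ Finset.range n, ‖weight I t‖ ≤ I.card := by
  have h : ∀ t, ‖weight I t‖ = if t ∈ I then 1 else 0 := by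
    intro t; rw [weight]; split_ifs <;> simp
  simp only [h, Finset.sum_ite_mem, Finset.sum_const, nsmul_eq_mul, mul_one]
  exact_mod_cast Finset.card_le_card Finset.inter_subset_right

theorem weight_sdiff_singleton {I : Finset ℕ} {a : ℕ} (ha : a ∈ I) :
    weight I - weight {a} = weight (I \ {a}) := by
  funext t
  by_cases hta : t = a
  · subst hta; simp [weight, ha]
  · by_cases ht : t ∈ I <;> simp [weight, hta, ht]

variable {d l m : ℕ} {A : Tensor (Fin d) (Fin l)} {B : Tensor (Fin d) (Fin m)}

/-- The superposition of domain walls with positions in `I` and `J`. -/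
def wallSum (A : Tensor (Fin d) (Fin l)) (B : Tensor (Fin d) (Fin m))
    (P : Tensor (Fin d) (Fin l ⊕ Fin m)) (I J : Finset ℕ) (n : ℕ) : ChainSpace d n :=
  wallState (directSum A B) (wallR P) (wallL P) (weight I) (weight J) n

theorem trialState_eq_wallSum (hAB : IsStandardForm A B) (P : Tensor (Fin d) (Fin l ⊕ Fin m))
    {N : ℕ} (hN : 1 ≤ N) :
    trialState A B P N =
      wallSum A B P (Finset.Icc (4 * N) (5 * N)) (Finset.Icc N (2 * N)) (6 * N + 1) :=
  trialState_eq_wallState hAB P hN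

theorem exists_norm_wallSum_le (hAB : IsStandardForm A B) (P : Tensor (Fin d) (Fin l ⊕ Fin m)) :
    ∃ K : ℝ, 0 < K ∧ ∀ (I J : Finset ℕ), (∀ i ∈ I, ∀ j ∈ J, j < i) → ∀ n,
      ‖wallSum A B P I J n‖ ^ 2 ≤ K * (J.card * I.card) := by
  obtain ⟨Λ, h⟩ := hAB.exists_isTwoBlock
  obtain ⟨K, hK, hb⟩ := h.exists_norm_wallState_le (projLeft_mul_wallR P) (projRight_mul_wallL P)
  refine ⟨K, hK, fun I J hIJ n => ?_⟩
  refine (hb (weight I) (weight J) (norm_weight_le I) (norm_weight_le J) ?_ J.card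
    (sum_norm_weight_le J) n).trans ?_
  · intro t u hut ht
    refine weight_of_notMem fun hu => ?_
    by_cases htJ : t ∈ J
    · exact absurd (hIJ u hu t htJ) (by omega)
    · exact ht (weight_of_notMem htJ)
  · rw [mul_assoc]
    gcongr
    exact sum_norm_weight_le I n

theorem localTerm_wallSum_eq_zero (A : Tensor (Fin d) (Fin l)) (B : Tensor (Fin d) (Fin m))
    (P : Tensor (Fin d) (Fin l ⊕ Fin m)) {I J : Finset ℕ}
    {n : ℕ} {i j : Fin n} (hij : (i : ℕ) + 1 = j)
    (hI : n - 1 - i ∈ I ↔ n - 1 - j ∈ I) (hJ : n - 1 - i ∈ J ↔ n - 1 - j ∈ J)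
    (hIJ : n - 1 - j ∈ I → n - 1 - j ∈ J → False) :
    localTerm (limitSpan (wallTensor A B P))ᗮ.starProjection i j (wallSum A B P I J n) = 0 := by
  rw [localTerm_eq_zero_iff _ (by intro h; rw [h] at hij; omega)]
  refine slice_wallState_succ_mem A B P hij ?_ ?_ ?_
  · simp only [weight, hI]
  · simp only [weight, hJ]
  · by_cases h1 : n - 1 - (j : ℕ) ∈ I
    · rw [weight_of_notMem fun h2 => hIJ h1 h2, mul_zero]
    · rw [weight_of_notMem h1, zero_mul]

theorem localTerm_wallSum_last_eq_zero (A : Tensor (Fin d) (Fin l)) (B : Tensor (Fin d) (Fin m))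
    (P : Tensor (Fin d) (Fin l ⊕ Fin m)) {I J : Finset ℕ} {n : ℕ} (hn : 2 ≤ n) {i j : Fin n}
    (hi : (i : ℕ) = n - 1) (hj : (j : ℕ) = 0) (hJ : 0 ∉ J) (hI : n - 1 ∉ I) :
    localTerm (limitSpan (wallTensor A B P))ᗮ.starProjection i j (wallSum A B P I J n) = 0 := by
  obtain ⟨k, rfl⟩ : ∃ k, n = k + 2 := ⟨n - 2, by omega⟩
  obtain rfl : i = Fin.last (k + 1) := Fin.ext hi
  obtain rfl : j = 0 := Fin.ext hj
  rw [localTerm_eq_zero_iff _ (Fin.last_pos).ne']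
  exact slice_wallState_last_mem A B P (weight_of_notMem hJ) (weight_of_notMem hI)

theorem exists_energy_trialState_le (hAB : IsStandardForm A B) (hd : 0 < d)
    (P : Tensor (Fin d) (Fin l ⊕ Fin m)) :
    ∃ K : ℝ, 0 < K ∧ ∀ N : ℕ, 1 ≤ N →
      ∑ i, ‖localTerm (limitSpan (wallTensor A B P))ᗮ.starProjection i (finRotate (6 * N + 1) i)
        (trialState A B P N)‖ ^ 2 ≤ K * (N + 1) := by
  obtain ⟨K, hK, hb⟩ := exists_norm_wallSum_le hAB P
  refine ⟨4 * K, by positivity, fun N hN => ?_⟩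
  set I := Finset.Icc (4 * N) (5 * N) with hI
  set J := Finset.Icc N (2 * N) with hJ
  set W := limitSpan (wallTensor A B P) with hW
  have hIc : (I.card : ℝ) = N + 1 := by
    rw [hI, Nat.card_Icc, show 5 * N + 1 - 4 * N = N + 1 by omega]; push_cast; rfl
  have hJc : (J.card : ℝ) = N + 1 := by
    rw [hJ, Nat.card_Icc, show 2 * N + 1 - N = N + 1 by omega]; push_cast; rfl
  have hsep : ∀ i ∈ I, ∀ j ∈ J, j < i := by
    intro i hi j hj; rw [hI, Finset.mem_Icc] at hi; rw [hJ, Finset.mem_Icc] at hj; omega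
  -- If removing one position `a` makes the local term vanish, only configurations with `R` at `a`
  -- contribute. There are `N + 1` of them, which bounds their squared norm by `K * (N + 1)`, and
  -- local terms are contractions.
  have left : ∀ a ∈ I, ∀ i j : Fin (6 * N + 1), i ≠ j →
      localTerm Wᗮ.starProjection i j (wallSum A B P (I \ {a}) J (6 * N + 1)) = 0 →
      ‖localTerm Wᗮ.starProjection i j (wallSum A B P I J (6 * N + 1))‖ ^ 2 ≤ K * (N + 1) := by
    intro a ha i j hij h0
    have e : wallSum A B P I J (6 * N + 1) = wallSum A B P (I \ {a}) J (6 * N + 1) +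
        wallSum A B P {a} J (6 * N + 1) := by
      rw [wallSum, wallState_eq_add_left _ _ _ _ (weight {a}), weight_sdiff_singleton ha]; rfl
    rw [e, map_add, h0, zero_add]
    have h1 := hb {a} J (fun i hi j hj => hsep i (by rw [Finset.mem_singleton.1 hi]; exact ha) j hj)
      (6 * N + 1)
    rw [Finset.card_singleton, hJc, Nat.cast_one, mul_one] at h1
    refine le_trans ?_ h1
    gcongr
    exact norm_localTerm_le W hd hij _
  have right : ∀ a ∈ J, ∀ i j : Fin (6 * N + 1), i ≠ j →
      localTerm Wᗮ.starProjection i j (wallSum A B P I (J \ {a}) (6 * N + 1)) = 0 →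
      ‖localTerm Wᗮ.starProjection i j (wallSum A B P I J (6 * N + 1))‖ ^ 2 ≤ K * (N + 1) := by
    intro a ha i j hij h0
    have e : wallSum A B P I J (6 * N + 1) = wallSum A B P I (J \ {a}) (6 * N + 1) +
        wallSum A B P I {a} (6 * N + 1) := by
      rw [wallSum, wallState_eq_add_right _ _ _ _ _ (weight {a}), weight_sdiff_singleton ha]; rfl
    rw [e, map_add, h0, zero_add]
    have h1 := hb I {a} (fun i hi j hj => hsep i hi j (by rw [Finset.mem_singleton.1 hj]; exact ha))
      (6 * N + 1)
    rw [Finset.card_singleton, hIc, Nat.cast_one, one_mul] at h1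
    refine le_trans ?_ h1
    gcongr
    exact norm_localTerm_le W hd hij _
  -- The bonds where a weight jumps. Bond `i` joins labels `6N - i` and `6N - i - 1`, so these are
  -- the bonds at the ends `4N`, `5N` of `I` and `N`, `2N` of `J`, in this order.
  set F : Finset ℕ := {2 * N, N - 1, 5 * N, 4 * N - 1} with hF
  have bond : ∀ i : Fin (6 * N + 1),
      ‖localTerm Wᗮ.starProjection i (finRotate (6 * N + 1) i) (trialState A B P N)‖ ^ 2 ≤
        if (i : ℕ) ∈ F then K * (N + 1) else 0 := by
    intro i
    rw [trialState_eq_wallSum hAB P hN]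
    obtain ⟨k, hk⟩ : ∃ k, 6 * N + 1 = k + 2 := ⟨6 * N - 1, by omega⟩
    have hne := finRotate_ne (n := 6 * N + 1) (by omega) i
    have hcase : ((i : ℕ) = 6 * N ∧ (finRotate (6 * N + 1) i : ℕ) = 0) ∨
        (i : ℕ) + 1 = finRotate (6 * N + 1) i := by
      clear_value I J F
      revert i
      rw [hk]
      intro i _
      rcases finRotate_eq_or i with ⟨h1, h2⟩ | h
      · left
        rw [h2, h1]
        exact ⟨by rw [Fin.val_last]; omega, rfl⟩
      · exact Or.inr h
    rcases hcase with ⟨h1, h2⟩ | h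
    · have h0 := localTerm_wallSum_last_eq_zero A B P (I := I) (J := J) (i := i)
        (by omega) (by omega) h2 (by simp [hJ]; omega) (by simp [hI]; omega)
      rw [h0, norm_zero, zero_pow two_ne_zero]
      split_ifs <;> positivity
    · have hi := i.2
      have hj := (finRotate (6 * N + 1) i).2
      split_ifs with hiF
      · simp only [hF, Finset.mem_insert, Finset.mem_singleton] at hiF
        rcases hiF with e | e | e | e
        · refine left (4 * N) (by simp [hI]; omega) _ _ hne
            (localTerm_wallSum_eq_zero A B P h ?_ ?_ ?_) <;>
            simp only [hI, hJ, Finset.mem_sdiff, Finset.mem_Icc, Finset.mem_singleton] <;> omega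
        · refine left (5 * N) (by simp [hI]; omega) _ _ hne
            (localTerm_wallSum_eq_zero A B P h ?_ ?_ ?_) <;>
            simp only [hI, hJ, Finset.mem_sdiff, Finset.mem_Icc, Finset.mem_singleton] <;> omega
        · refine right N (by simp [hJ]; omega) _ _ hne
            (localTerm_wallSum_eq_zero A B P h ?_ ?_ ?_) <;>
            simp only [hI, hJ, Finset.mem_sdiff, Finset.mem_Icc, Finset.mem_singleton] <;> omega
        · refine right (2 * N) (by simp [hJ]; omega) _ _ hne
            (localTerm_wallSum_eq_zero A B P h ?_ ?_ ?_) <;>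
            simp only [hI, hJ, Finset.mem_sdiff, Finset.mem_Icc, Finset.mem_singleton] <;> omega
      · simp only [hF, Finset.mem_insert, Finset.mem_singleton, not_or] at hiF
        rw [localTerm_wallSum_eq_zero A B P h]
        · simp
        all_goals
          simp only [Finset.mem_Icc]
          omega
  calc _ ≤ ∑ i : Fin (6 * N + 1), (if (i : ℕ) ∈ F then K * ((N : ℝ) + 1) else 0) :=
        Finset.sum_le_sum fun i _ => bond i
    _ = ∑ k ∈ Finset.range (6 * N + 1), (if k ∈ F then K * ((N : ℝ) + 1) else 0) :=
        (Finset.sum_range (fun k => if k ∈ F then K * ((N : ℝ) + 1) else 0)).symm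
    _ ≤ 4 * K * (N + 1) := by
        rw [Finset.sum_ite_mem, Finset.sum_const, nsmul_eq_mul, mul_assoc]
        gcongr
        have : (Finset.range (6 * N + 1) ∩ F).card ≤ 4 :=
          (Finset.card_le_card Finset.inter_subset_right).trans Finset.card_le_four
        exact_mod_cast this

end Energy

/-! ### Overlaps of domain wall states -/

section Overlap

attribute [local instance] Matrix.normedAddCommGroup Matrix.normedSpace

/-- Inner products of matrix product states with boundary matrices. -/
theorem inner_of_apply_eq_trace {d : ℕ} {ι : Type} [Fintype ι] [DecidableEq ι]
    {S T : ℕ → Tensor (Fin d) ι} {n : ℕ} {χ ψ : ChainSpace d n} {F G : Matrix ι ι ℂ}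
    (hχ : ∀ s, χ s = (amp S n s * G).trace) (hψ : ∀ s, ψ s = (amp T n s * F).trace) :
    inner ℂ χ ψ = ∑ α, ∑ β, seqProd (fun t => mixedTransfer (T t) (S t)) n
      (F * Matrix.single α β 1 * G.conjTranspose) α β := by
  simp only [← sum_amp_mul, Matrix.sum_apply]
  rw [PiLp.inner_apply]
  simp only [RCLike.inner_apply, hχ, hψ]
  refine (Finset.sum_congr rfl fun s _ =>
    trace_mul_star_trace (amp T n s * F) (amp S n s * G)).trans ?_
  rw [Finset.sum_comm]
  refine Finset.sum_congr rfl fun α _ => Finset.sum_comm.trans ?_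
  simp only [Matrix.conjTranspose_mul, Matrix.mul_assoc]

variable {κ ι : Type} [Fintype κ] [Fintype ι] [DecidableEq ι]

theorem linearMap_eq_sum (f : Matrix ι ι ℂ →ₗ[ℂ] ℂ) (X : Matrix ι ι ℂ) :
    f X = ∑ α, ∑ β, X α β * f (Matrix.single α β 1) := by
  conv_lhs => rw [Matrix.matrix_eq_sum_single X]
  simp only [map_sum]
  refine Finset.sum_congr rfl fun a _ => Finset.sum_congr rfl fun b _ => ?_
  rw [← smul_eq_mul, ← map_smul, Matrix.smul_single, smul_eq_mul, mul_one]

theorem tendsto_entry {α : Type*} {ι : Type} [Fintype ι] {f : Filter α} {u : α → Matrix ι ι ℂ} {u₀ : Matrix ι ι ℂ}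
    (hu : Tendsto (fun x => ‖u x - u₀‖) f (𝓝 0)) (i j : ι) :
    Tendsto (fun x => u x i j) f (𝓝 (u₀ i j)) := by
  rw [tendsto_iff_norm_sub_tendsto_zero]
  exact squeeze_zero (fun _ => norm_nonneg _)
    (fun x => Matrix.norm_entry_le_entrywise_sup_norm (u x - u₀)) hu

theorem tendsto_norm_map_sub {α : Type*} {ι : Type} [Fintype ι] {f : Filter α} {u : α → Matrix ι ι ℂ}
    {u₀ : Matrix ι ι ℂ} (g : Module.End ℂ (Matrix ι ι ℂ))
    (hu : Tendsto (fun x => ‖u x - u₀‖) f (𝓝 0)) :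
    Tendsto (fun x => ‖g (u x) - g u₀‖) f (𝓝 0) := by
  obtain ⟨M, _, hM⟩ := exists_linearMap_bound g
  refine squeeze_zero (fun _ => norm_nonneg _) (fun x => ?_) (by simpa using hu.const_mul M)
  rw [← map_sub]
  exact hM _

theorem fixedProj_comm (p q Λ : Matrix ι ι ℂ) : fixedProj p q Λ = fixedProj q p Λ := by
  ext1 X
  rw [fixedProj_apply, fixedProj_apply, add_comm]

namespace IsTwoBlock

variable {C R L : Tensor κ ι} {p q Λ : Matrix ι ι ℂ}

theorem tendsto_pow_transfer (h : IsTwoBlock C p q Λ) {α : Type*} {f : Filter α}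
    {u : α → Matrix ι ι ℂ} {u₀ : Matrix ι ι ℂ} {a : α → ℕ}
    (hu : Tendsto (fun x => ‖u x - u₀‖) f (𝓝 0)) (ha : Tendsto a f atTop) :
    Tendsto (fun x => ‖(mixedTransfer C C ^ a x) (u x) - fixedProj p q Λ u₀‖) f (𝓝 0) := by
  obtain ⟨K, r, hK, hr0, hr1, hb⟩ := h.exists_pow_transfer_le
  obtain ⟨M, hM0, hM⟩ := h.exists_pow_transfer_bounded
  have h1 : Tendsto (fun x => K * r ^ a x * ‖u₀‖ + M * ‖u x - u₀‖) f (𝓝 0) := by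
    have h2 := ((tendsto_pow_atTop_nhds_zero_of_lt_one hr0.le hr1).comp ha).const_mul K
    simpa using (h2.mul_const ‖u₀‖).add (hu.const_mul M)
  refine squeeze_zero (fun _ => norm_nonneg _) (fun x => ?_) h1
  have e : (mixedTransfer C C ^ a x) (u x) - fixedProj p q Λ u₀ =
      ((mixedTransfer C C ^ a x) u₀ - fixedProj p q Λ u₀) +
        (mixedTransfer C C ^ a x) (u x - u₀) := by
    rw [map_sub]; abel
  rw [e]
  exact (norm_add_le _ _).trans (add_le_add (hb _ _) (hM _ _))

theorem fixedProj_diag (h : IsTwoBlock C p q Λ) (X : Matrix ι ι ℂ) :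
    fixedProj p q Λ (p * X * p) = (Λ * (p * X * p)).trace • p := by
  have e1 : p * (p * X * p) * p = p * X * p := by
    rw [← Matrix.mul_assoc, ← Matrix.mul_assoc, h.pp, Matrix.mul_assoc, h.pp]
  have e2 : q * (p * X * p) * q = 0 := by
    rw [← Matrix.mul_assoc, ← Matrix.mul_assoc, h.qp]; simp
  rw [fixedProj_apply, e1, e2]; simp

theorem sum_fixedProj (h : IsTwoBlock C p q Λ) :
    ∑ α, ∑ β, (fixedProj p q Λ (p * Matrix.single α β 1 * p)) α β = 1 := by
  let f : Matrix ι ι ℂ →ₗ[ℂ] ℂ := Matrix.traceLinearMap ι ℂ ℂ ∘ₗ LinearMap.mulLeft ℂ Λ ∘ₗ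
    LinearMap.mulRight ℂ p ∘ₗ LinearMap.mulLeft ℂ p
  have h1 : f p = 1 := by
    change (Λ * (p * p * p)).trace = 1
    rw [h.pp, h.pp, h.trace_p]
  refine Eq.trans (Finset.sum_congr rfl fun α _ => Finset.sum_congr rfl fun β _ => ?_)
    ((linearMap_eq_sum f p).symm.trans h1)
  rw [h.fixedProj_diag, Matrix.smul_apply, smul_eq_mul, mul_comm]
  rfl

/-- The squared norm of the matrix product state of a block converges to one. -/
theorem tendsto_sum_pow_transfer (h : IsTwoBlock C p q Λ) :
    Tendsto (fun n => ∑ α, ∑ β, ((mixedTransfer C C ^ n) (p * Matrix.single α β 1 * p)) α β) atTop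
      (𝓝 1) := by
  have h0 : Tendsto (fun n => ∑ α, ∑ β,
      ((mixedTransfer C C ^ n) (p * Matrix.single α β 1 * p)) α β) atTop
      (𝓝 (∑ α, ∑ β, (fixedProj p q Λ (p * Matrix.single α β 1 * p)) α β)) :=
    tendsto_finsetSum _ fun α _ => tendsto_finsetSum _ fun β _ =>
      tendsto_entry (h.tendsto_pow_transfer (by simp) tendsto_id) α β
  rwa [h.sum_fixedProj] at h0

/-- The overlap of the matrix product states of different blocks converges to zero. -/
theorem tendsto_sum_pow_transfer_offDiag (h : IsTwoBlock C p q Λ) :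
    Tendsto (fun n => ∑ α, ∑ β, ((mixedTransfer C C ^ n) (p * Matrix.single α β 1 * q)) α β) atTop
      (𝓝 0) := by
  have h0 : ∑ α, ∑ β, (fixedProj p q Λ (p * Matrix.single α β 1 * q)) α β = 0 := by
    simp [h.fixedProj_offDiag]
  refine h0 ▸ tendsto_finsetSum _ fun α _ => tendsto_finsetSum _ fun β _ => ?_
  exact tendsto_entry (h.tendsto_pow_transfer (by simp) tendsto_id) α β

theorem mixedTransfer_mul_left (hLp : ∀ x, L x * p = L x) (X : Matrix ι ι ℂ) :
    mixedTransfer L C X = mixedTransfer L C (p * X) := by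
  rw [mixedTransfer_apply, mixedTransfer_apply]
  refine Finset.sum_congr rfl fun x _ => ?_
  rw [← Matrix.mul_assoc (L x) p X, hLp]

/-- Between the walls the ket is in block `q` while the bra stays in block `p`, so the overlap
decays with the distance `b` between them. -/
theorem exists_overlap_left_le (h : IsTwoBlock C p q Λ) (hL : ∀ x, q * L x * p = L x) :
    ∃ K r : ℝ, 0 < K ∧ 0 < r ∧ r < 1 ∧ ∀ a b c : ℕ,
      ‖∑ α, ∑ β, ((mixedTransfer C C ^ a * mixedTransfer R C * mixedTransfer C C ^ b *
        mixedTransfer L C * mixedTransfer C C ^ c) (1 * Matrix.single α β 1 * p)) α β‖ ≤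
          K * r ^ b := by
  have hLp : ∀ x, L x * p = L x := fun x => by rw [← hL x, Matrix.mul_assoc, h.pp]
  obtain ⟨M, hM0, hM⟩ := h.exists_pow_transfer_bounded
  obtain ⟨K, r, hK, hr0, hr1, hb⟩ := h.symm.exists_pow_transfer_offDiag_le
  obtain ⟨M₁, hM₁0, hM₁⟩ := exists_linearMap_bound (mixedTransfer R C)
  obtain ⟨M₂, hM₂0, hM₂⟩ := exists_linearMap_bound (mixedTransfer L C)
  refine ⟨(∑ α, ∑ β, M * (M₁ * (K * (M₂ * (M * ‖p * Matrix.single α β 1 * p‖))))) + 1, r,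
    by positivity, hr0, hr1, fun a b c => ?_⟩
  rw [add_mul, Finset.sum_mul]
  refine le_add_of_le_of_nonneg ((norm_sum_le _ _).trans (Finset.sum_le_sum fun α _ => ?_))
    (by positivity)
  rw [Finset.sum_mul]
  refine (norm_sum_le _ _).trans (Finset.sum_le_sum fun β _ => ?_)
  refine (Matrix.norm_entry_le_entrywise_sup_norm _).trans ?_
  simp only [Module.End.mul_apply]
  rw [mixedTransfer_mul_left hLp, one_mul, show Matrix.single α β (1 : ℂ) * p =
    1 * Matrix.single α β 1 * p by rw [one_mul], h.pow_transfer_mul_mul c _ (by simp) (by simp),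
    one_mul, ← Matrix.mul_assoc, ← h.pow_transfer_mul_mul c _ (by simp) (by simp)]
  set X := (mixedTransfer C C ^ c) (p * Matrix.single α β 1 * p) with hX
  have hXp : p * X * p = X := by
    rw [hX, ← h.pow_transfer_mul_mul c _ (by simp) (by simp)]
    congr 1
    rw [← Matrix.mul_assoc, ← Matrix.mul_assoc, h.pp, Matrix.mul_assoc, h.pp]
  have hY := h.symm.mixedTransfer_offDiag hL hXp
  calc _ ≤ M * (M₁ * (K * r ^ b * (M₂ * (M * ‖p * Matrix.single α β (1 : ℂ) * p‖)))) := by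
        refine (hM _ _).trans ?_
        gcongr
        refine (hM₁ _).trans ?_
        gcongr
        refine (hb _ _ hY).trans ?_
        gcongr
        refine (hM₂ _).trans ?_
        gcongr
        exact hM _ _
    _ = _ := by ring

/-- Here the bra is in block `q` and the mismatch occurs outside the walls; the stretch of length
`c` to the right of `L` already gives the decay. -/
theorem exists_overlap_right_le (h : IsTwoBlock C p q Λ) (hL : ∀ x, q * L x * p = L x) :
    ∃ K r : ℝ, 0 < K ∧ 0 < r ∧ r < 1 ∧ ∀ a b c : ℕ,
      ‖∑ α, ∑ β, ((mixedTransfer C C ^ a * mixedTransfer R C * mixedTransfer C C ^ b *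
        mixedTransfer L C * mixedTransfer C C ^ c) (1 * Matrix.single α β 1 * q)) α β‖ ≤
          K * r ^ c := by
  have hLp : ∀ x, L x * p = L x := fun x => by rw [← hL x, Matrix.mul_assoc, h.pp]
  obtain ⟨M, hM0, hM⟩ := h.exists_pow_transfer_bounded
  obtain ⟨K, r, hK, hr0, hr1, hb⟩ := h.exists_pow_transfer_offDiag_le
  obtain ⟨M₁, hM₁0, hM₁⟩ := exists_linearMap_bound (mixedTransfer R C)
  obtain ⟨M₂, hM₂0, hM₂⟩ := exists_linearMap_bound (mixedTransfer L C)
  refine ⟨(∑ α, ∑ β, M * (M₁ * (M * (M₂ * (K * ‖p * Matrix.single α β 1 * q‖))))) + 1, r,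
    by positivity, hr0, hr1, fun a b c => ?_⟩
  rw [add_mul, Finset.sum_mul]
  refine le_add_of_le_of_nonneg ((norm_sum_le _ _).trans (Finset.sum_le_sum fun α _ => ?_))
    (by positivity)
  rw [Finset.sum_mul]
  refine (norm_sum_le _ _).trans (Finset.sum_le_sum fun β _ => ?_)
  refine (Matrix.norm_entry_le_entrywise_sup_norm _).trans ?_
  simp only [Module.End.mul_apply]
  rw [mixedTransfer_mul_left hLp, h.pow_transfer_mul_mul c _ (by simp) (by simp),
    one_mul, ← Matrix.mul_assoc, ← h.pow_transfer_mul_mul c _ (by simp) (by simp)]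
  have hX : p * (p * Matrix.single α β 1 * q) * q = p * Matrix.single α β 1 * q := by
    rw [← Matrix.mul_assoc, ← Matrix.mul_assoc, h.pp, Matrix.mul_assoc, h.qq]
  calc _ ≤ M * (M₁ * (M * (M₂ * (K * r ^ c * ‖p * Matrix.single α β (1 : ℂ) * q‖)))) := by
        refine (hM _ _).trans ?_
        gcongr
        refine (hM₁ _).trans ?_
        gcongr
        refine (hM _ _).trans ?_
        gcongr
        refine (hM₂ _).trans ?_
        gcongr
        exact hb _ _ hX
    _ = _ := by ring

/-- Conjugation `X ↦ F X F^*`. -/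
def conj (F : Matrix ι ι ℂ) : Module.End ℂ (Matrix ι ι ℂ) :=
  LinearMap.mulRight ℂ F.conjTranspose ∘ₗ LinearMap.mulLeft ℂ F

theorem conj_apply (F X : Matrix ι ι ℂ) : conj F X = F * X * F.conjTranspose := rfl

/-- Conjugation by `F` carries the fixed point `q` to `F F*`, which relaxes to a multiple of `p`.
Each dual wall thus costs only the factor `tr[Λ F F*]`. -/
theorem fixedProj_conj (h : IsTwoBlock C p q Λ) {F : Matrix ι ι ℂ} (hF : p * F * q = F)
    (X : Matrix ι ι ℂ) :
    fixedProj p q Λ (conj F (fixedProj p q Λ X)) =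
      ((Λ * (q * X * q)).trace * (Λ * (F * F.conjTranspose)).trace) • p := by
  have hpF : p * F = F := by rw [← hF, ← Matrix.mul_assoc, ← Matrix.mul_assoc, h.pp]
  have hFq : F * q = F := by rw [← hF, Matrix.mul_assoc, h.qq]
  have hFp : F * p = 0 := by rw [← hFq, Matrix.mul_assoc, h.qp, Matrix.mul_zero]
  have hqF : q * F = 0 := by rw [← hpF, ← Matrix.mul_assoc, h.qp, Matrix.zero_mul]
  have hFs : F.conjTranspose * p = F.conjTranspose := by
    have := congrArg Matrix.conjTranspose hpF
    simpa [h.p_star] using this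
  have e : conj F (fixedProj p q Λ X) = (Λ * (q * X * q)).trace • (F * F.conjTranspose) := by
    rw [conj_apply, fixedProj_apply, mul_add, Matrix.mul_smul, Matrix.mul_smul, hFp, hFq, smul_zero,
      zero_add, Matrix.smul_mul]
  have e1 : p * (F * F.conjTranspose) * p = F * F.conjTranspose := by
    rw [← Matrix.mul_assoc, hpF, Matrix.mul_assoc, hFs]
  have e2 : q * (F * F.conjTranspose) * q = 0 := by
    rw [← Matrix.mul_assoc, hqF]; simp
  rw [e, map_smul, fixedProj_apply, e1, e2]
  simp [smul_smul]

/-- The overlap of a domain wall state with its dual state has a nonzero limit. -/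
theorem tendsto_sum_conj (h : IsTwoBlock C p q Λ) {F G : Matrix ι ι ℂ} (hF : p * F * q = F)
    (hG : q * G * p = G) :
    Tendsto (fun t : ℕ × ℕ × ℕ => ∑ α, ∑ β, ((mixedTransfer C C ^ t.1 * conj F *
        mixedTransfer C C ^ t.2.1 * conj G * mixedTransfer C C ^ t.2.2)
          (Matrix.single α β 1)) α β) atTop
      (𝓝 ((Λ * (F * F.conjTranspose)).trace * (Λ * (G * G.conjTranspose)).trace)) := by
  have hlim : ∑ α, ∑ β, (fixedProj p q Λ (conj F (fixedProj p q Λ (conj G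
      (fixedProj p q Λ (Matrix.single α β 1)))))) α β =
      (Λ * (F * F.conjTranspose)).trace * (Λ * (G * G.conjTranspose)).trace := by
    have e : ∀ X, fixedProj p q Λ (conj F (fixedProj p q Λ (conj G (fixedProj p q Λ X)))) =
        ((Λ * (F * F.conjTranspose)).trace * (Λ * (G * G.conjTranspose)).trace) •
          fixedProj p q Λ (p * X * p) := by
      intro X
      have e1 := h.symm.fixedProj_conj hG X
      have e2 := h.fixedProj_conj hF q
      rw [← fixedProj_comm] at e1
      rw [h.fixedProj_q, h.qq, h.qq, h.trace_q, one_mul] at e2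
      rw [e1, map_smul, map_smul, e2, h.fixedProj_diag, smul_smul, smul_smul]
      congr 1
      ring
    simp only [e, Matrix.smul_apply, smul_eq_mul]
    simp only [← Finset.mul_sum]
    rw [h.sum_fixedProj, mul_one]
  refine hlim ▸ tendsto_finsetSum _ fun α _ => tendsto_finsetSum _ fun β _ => ?_
  refine tendsto_entry ?_ α β
  simp only [Module.End.mul_apply]
  rw [← prod_atTop_atTop_eq, ← prod_atTop_atTop_eq]
  refine h.tendsto_pow_transfer (tendsto_norm_map_sub _ ?_) tendsto_fst
  refine h.tendsto_pow_transfer (tendsto_norm_map_sub _ ?_) (tendsto_fst.comp tendsto_snd)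
  exact h.tendsto_pow_transfer (by simp) (tendsto_snd.comp tendsto_snd)

end IsTwoBlock

end Overlap

/-! ### Norm and overlaps of the trial state -/

section TrialBounds

theorem IsNormalBlock.card_pos {d l : ℕ} {A : Tensor (Fin d) (Fin l)} (hA : IsNormalBlock A) :
    0 < l := by
  obtain ⟨Λ, -, h, -⟩ := hA.exists_fixed
  rcases Nat.eq_zero_or_pos l with rfl | hl
  · simp [Matrix.trace] at h
  · exact hl

variable {d l m : ℕ} {A : Tensor (Fin d) (Fin l)} {B : Tensor (Fin d) (Fin m)}

theorem card_Icc_left (N : ℕ) : (Finset.Icc (4 * N) (5 * N)).card = N + 1 := by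
  rw [Nat.card_Icc]; omega

theorem card_Icc_right (N : ℕ) : (Finset.Icc N (2 * N)).card = N + 1 := by
  rw [Nat.card_Icc]; omega

theorem exists_norm_trialState_le (hAB : IsStandardForm A B)
    (P : Tensor (Fin d) (Fin l ⊕ Fin m)) :
    ∃ K : ℝ, 0 < K ∧ ∀ N : ℕ, 1 ≤ N → ‖trialState A B P N‖ ^ 2 ≤ K * (N + 1) ^ 2 := by
  obtain ⟨K, hK, hb⟩ := exists_norm_wallSum_le hAB P
  refine ⟨K, hK, fun N hN => ?_⟩
  rw [trialState_eq_wallSum hAB P hN]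
  refine (hb _ _ ?_ _).trans (le_of_eq ?_)
  · intro i hi j hj; rw [Finset.mem_Icc] at hi hj; omega
  · rw [card_Icc_left, card_Icc_right]; push_cast; ring

theorem seqProd_wallSites {ι : Type} [Fintype ι] [DecidableEq ι] {C R L C' R' L' : Tensor (Fin d) ι}
    {a b n : ℕ} (hba : b < a) (han : a < n) :
    seqProd (fun t => mixedTransfer (wallSites C R L a b t) (wallSites C' R' L' a b t)) n =
      mixedTransfer C C' ^ (n - 1 - a) * mixedTransfer R R' * mixedTransfer C C' ^ (a - 1 - b) *
        mixedTransfer L L' * mixedTransfer C C' ^ b := by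
  rw [seqProd_two_defects (c := mixedTransfer C C') hba han]
  · simp [wallSites, hba.ne]
  · intro t h1 h2
    simp [wallSites, h1, h2]

theorem norm_inner_trialState_le (hAB : IsStandardForm A B) (P : Tensor (Fin d) (Fin l ⊕ Fin m))
    {N : ℕ} (hN : 1 ≤ N) (χ : ChainSpace d (6 * N + 1)) {ε : ℝ}
    (h : ∀ a ∈ Finset.Icc (4 * N) (5 * N), ∀ b ∈ Finset.Icc N (2 * N),
      ‖(inner ℂ χ (chainState (wallSites (directSum A B) (wallR P) (wallL P) a b)
        (6 * N + 1)) : ℂ)‖ ≤ ε) :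
    ‖(inner ℂ χ (trialState A B P N) : ℂ)‖ ≤ (N + 1) ^ 2 * ε := by
  rw [trialState_eq_sum hAB P hN, inner_sum]
  refine (norm_sum_le_of_le _ (f := fun a => inner ℂ χ _) (n := fun _ => (N + 1) * ε)
    fun a ha => ?_).trans (le_of_eq ?_)
  · rw [inner_sum]
    refine (norm_sum_le_of_le _ (n := fun _ => ε) fun b hb => h a ha b hb).trans (le_of_eq ?_)
    rw [Finset.sum_const, card_Icc_right, nsmul_eq_mul]; push_cast; ring
  · rw [Finset.sum_const, card_Icc_left, nsmul_eq_mul]; push_cast; ring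

theorem inner_wallSites_eq {ι : Type} [Fintype ι] [DecidableEq ι] {C R L : Tensor (Fin d) ι}
    {a b n : ℕ} (hba : b < a) (han : a < n) {χ : ChainSpace d n} {G : Matrix ι ι ℂ}
    (hχ : ∀ s, χ s = (amp (fun _ => C) n s * G).trace) (hG : G.conjTranspose = G) :
    inner ℂ χ (chainState (wallSites C R L a b) n) =
      ∑ α, ∑ β, ((mixedTransfer C C ^ (n - 1 - a) * mixedTransfer R C *
        mixedTransfer C C ^ (a - 1 - b) * mixedTransfer L C * mixedTransfer C C ^ b)
          (1 * Matrix.single α β 1 * G)) α β := by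
  rw [inner_of_apply_eq_trace (F := 1) hχ (fun s => by rw [mul_one]; rfl), hG]
  have e :=
    seqProd_wallSites (C := C) (R := R) (L := L) (C' := C) (R' := C) (L' := C) hba han
  have hC : ∀ t, wallSites C C C a b t = C := fun t => by simp [wallSites]
  simp only [hC] at e
  rw [e]

theorem exists_overlap_le (hAB : IsStandardForm A B) (P : Tensor (Fin d) (Fin l ⊕ Fin m)) :
    ∃ K r : ℝ, 0 < K ∧ 0 < r ∧ r < 1 ∧ ∀ N : ℕ, 1 ≤ N →
      ‖(inner ℂ (mpsState A (6 * N + 1)) (trialState A B P N) : ℂ)‖ ≤ (N + 1) ^ 2 * (K * r ^ N) ∧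
      ‖(inner ℂ (mpsState B (6 * N + 1)) (trialState A B P N) : ℂ)‖ ≤
        (N + 1) ^ 2 * (K * r ^ N) := by
  obtain ⟨Λ, h⟩ := hAB.exists_isTwoBlock
  obtain ⟨K₁, r₁, hK₁, hr₁, hr₁', hb₁⟩ :=
    h.exists_overlap_left_le (R := wallR P) (projRight_mul_wallL P)
  obtain ⟨K₂, r₂, hK₂, hr₂, hr₂', hb₂⟩ :=
    h.exists_overlap_right_le (R := wallR P) (projRight_mul_wallL P)
  refine ⟨max K₁ K₂, max r₁ r₂, by positivity, by positivity, max_lt hr₁' hr₂', fun N hN =>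
    ⟨norm_inner_trialState_le hAB P hN _ fun a ha b hb => ?_,
      norm_inner_trialState_le hAB P hN _ fun a ha b hb => ?_⟩⟩
  · rw [Finset.mem_Icc] at ha hb
    rw [inner_wallSites_eq (by omega) (by omega) (mpsState_left_apply A B _) h.p_star]
    refine (hb₁ _ _ _).trans ?_
    have : r₁ ^ (a - 1 - b) ≤ (max r₁ r₂) ^ N :=
      (pow_le_pow_of_le_one hr₁.le hr₁'.le (by omega)).trans
        (pow_le_pow_left₀ hr₁.le (le_max_left _ _) _)
    gcongr
    exact le_max_left _ _
  · rw [Finset.mem_Icc] at ha hb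
    rw [inner_wallSites_eq (by omega) (by omega) (mpsState_right_apply A B _) h.q_star]
    refine (hb₂ _ _ _).trans ?_
    have : r₂ ^ b ≤ (max r₁ r₂) ^ N :=
      (pow_le_pow_of_le_one hr₂.le hr₂'.le (by omega)).trans
        (pow_le_pow_left₀ hr₂.le (le_max_right _ _) _)
    gcongr
    exact le_max_right _ _

theorem mixedTransfer_dual {ι : Type} [Fintype ι] (Y : Tensor (Fin d) ι) (c : Fin d → ℂ)
    (F X : Matrix ι ι ℂ) :
    ∑ x, Y x * X * (star (c x) • F).conjTranspose =
      (∑ x, c x • Y x) * X * F.conjTranspose := by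
  rw [Finset.sum_mul, Finset.sum_mul]
  refine Finset.sum_congr rfl fun x _ => ?_
  rw [Matrix.conjTranspose_smul, star_star, Matrix.mul_smul, Matrix.smul_mul, Matrix.smul_mul]

/-- Dual walls: tensors detecting the walls `R` and `L` of an injective perturbation. -/
theorem exists_dual_perturbation (hAB : IsStandardForm A B) {P : Tensor (Fin d) (Fin l ⊕ Fin m)}
    (hP : IsInjectivePerturbation A B P) :
    ∃ (P' : Tensor (Fin d) (Fin l ⊕ Fin m)) (F G : Matrix (Fin l ⊕ Fin m) (Fin l ⊕ Fin m) ℂ),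
      F ≠ 0 ∧ G ≠ 0 ∧ projLeft l m * F * projRight l m = F ∧
      projRight l m * G * projLeft l m = G ∧
      mixedTransfer (wallR P) (wallR P') = IsTwoBlock.conj F ∧
      mixedTransfer (wallL P) (wallR P') = 0 ∧
      mixedTransfer (directSum A B) (wallR P') = 0 ∧
      mixedTransfer (wallL P) (wallL P') = IsTwoBlock.conj G ∧
      mixedTransfer (directSum A B) (wallL P') = 0 := by
  obtain ⟨c, hc⟩ := exists_section hP
  have hl := hAB.left.card_pos
  have hm := hAB.right.card_pos
  let i₀ : Fin l := ⟨0, hl⟩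
  let j₀ : Fin m := ⟨0, hm⟩
  let f : Matrix (Fin l) (Fin m) ℂ := Matrix.single i₀ j₀ 1
  let g : Matrix (Fin m) (Fin l) ℂ := Matrix.single j₀ i₀ 1
  let F : Matrix (Fin l ⊕ Fin m) (Fin l ⊕ Fin m) ℂ := Matrix.fromBlocks 0 f 0 0
  let G : Matrix (Fin l ⊕ Fin m) (Fin l ⊕ Fin m) ℂ := Matrix.fromBlocks 0 0 g 0
  -- The coefficients expand `F` and `G` in the wall tensor. They are conjugated because the bra is,
  -- so that summing over the physical index against `P` reproduces the corresponding block of `F`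
  -- or `G`.
  let P' : Tensor (Fin d) (Fin l ⊕ Fin m) := fun x =>
    Matrix.fromBlocks 0 (star (c F x) • f) (star (c G x) • g) 0
  have hR' : ∀ x, wallR P' x = star (c F x) • F := fun x => by
    simp [wallR, P', upperRight, F, Matrix.fromBlocks_smul]
  have hL' : ∀ x, wallL P' x = star (c G x) • G := fun x => by
    simp [wallL, P', lowerLeft, G, Matrix.fromBlocks_smul]
  have hD : ∀ X, ∑ x, c X x • directSum A B x = blockDiag X := fun X => by
    conv_rhs => rw [← hc X, map_sum]
    simp only [map_smul, blockDiag_fromBlocks]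
    rfl
  have hR : ∀ X, ∑ x, c X x • wallR P x = upperRight X := fun X => by
    conv_rhs => rw [← hc X, map_sum]
    simp only [map_smul]
    rfl
  have hL : ∀ X, ∑ x, c X x • wallL P x = lowerLeft X := fun X => by
    conv_rhs => rw [← hc X, map_sum]
    simp only [map_smul]
    rfl
  refine ⟨P', F, G, ?_, ?_, ?_, ?_, ?_, ?_, ?_, ?_, ?_⟩
  · intro h0
    have := congrFun (congrFun h0 (Sum.inl i₀)) (Sum.inr j₀)
    simp [F, f] at this
  · intro h0
    have := congrFun (congrFun h0 (Sum.inr j₀)) (Sum.inl i₀)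
    simp [G, g] at this
  · simp [projLeft, projRight, F, Matrix.fromBlocks_multiply]
  · simp [projLeft, projRight, G, Matrix.fromBlocks_multiply]
  · ext1 X
    rw [mixedTransfer_apply, IsTwoBlock.conj_apply]
    simp only [hR', mixedTransfer_dual, hR]
    simp [upperRight, F]
  · ext1 X
    rw [mixedTransfer_apply]
    simp only [hR', mixedTransfer_dual, hL]
    simp [lowerLeft, F]
  · ext1 X
    rw [mixedTransfer_apply]
    simp only [hR', mixedTransfer_dual, hD]
    simp [blockDiag, F]
  · ext1 X
    rw [mixedTransfer_apply, IsTwoBlock.conj_apply]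
    simp only [hL', mixedTransfer_dual, hL]
    simp [lowerLeft, G]
  · ext1 X
    rw [mixedTransfer_apply]
    simp only [hL', mixedTransfer_dual, hD]
    simp [blockDiag, G]

/-- If the `R` positions differ, the dual `R'` at `a` meets `L` or `C`; if they agree, the dual `L'`
at `b` meets `C`. Either way one transfer operator in the product is zero. -/
theorem inner_wallSites_eq_zero {ι : Type} [Fintype ι] [DecidableEq ι]
    {C R L R' L' : Tensor (Fin d) ι} (hLR : mixedTransfer L R' = 0) (hCR : mixedTransfer C R' = 0)
    (hCL : mixedTransfer C L' = 0) {a b a' b' n : ℕ} (hba : b < a) (han : a < n)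
    (hne : a' ≠ a ∨ b' ≠ b) :
    inner ℂ (chainState (wallSites C R' L' a b) n) (chainState (wallSites C R L a' b') n) =
      (0 : ℂ) := by
  have h0 : seqProd (fun t => mixedTransfer (wallSites C R L a' b' t) (wallSites C R' L' a b t)) n
      = 0 := by
    by_cases ha : a' = a
    · subst ha
      have hb : b' ≠ b := by simpa using hne
      refine seqProd_eq_zero (t := b) (by omega) ?_
      simp [wallSites, hba.ne, hb.symm, hCL]
    · refine seqProd_eq_zero (t := a) han ?_
      by_cases hb : a = b'
      · simp [wallSites, Ne.symm ha, ← hb, hLR]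
      · simp [wallSites, Ne.symm ha, hb, hCR]
  rw [inner_chainState, h0]
  simp

/-- Duality: in the pairing with the trial state of the dual walls only equal positions survive,
each contributing at least half of a positive limit. Cauchy–Schwarz with the upper norm bound for
the dual state then bounds `φ_N` from below. -/
theorem exists_le_norm_trialState (hAB : IsStandardForm A B)
    {P : Tensor (Fin d) (Fin l ⊕ Fin m)} (hP : IsInjectivePerturbation A B P) :
    ∃ (c : ℝ) (N₀ : ℕ), 0 < c ∧ ∀ N : ℕ, N₀ ≤ N →
      c * (N + 1) ^ 2 ≤ ‖trialState A B P N‖ ^ 2 := by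
  obtain ⟨Λ, h⟩ := hAB.exists_isTwoBlock
  obtain ⟨P', F, G, hF0, hG0, hF, hG, hRR, hLR, hCR, hLL, hCL⟩ := exists_dual_perturbation hAB hP
  obtain ⟨K, hK, hb⟩ := exists_norm_trialState_le hAB P'
  set g : ℂ := (Λ * (F * F.conjTranspose)).trace * (Λ * (G * G.conjTranspose)).trace with hg
  have hpos : ∀ Y : Matrix (Fin l ⊕ Fin m) (Fin l ⊕ Fin m) ℂ, Y ≠ 0 →
      0 < (Λ * (Y * Y.conjTranspose)).trace := fun Y hY =>
    lt_of_le_of_ne (trace_posDef_mul_nonneg h.posDef Y)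
      fun h0 => hY (trace_posDef_mul_eq_zero h.posDef h0.symm)
  have hg0 : 0 < g := mul_pos (hpos F hF0) (hpos G hG0)
  have hgre : 0 < g.re := (Complex.pos_iff.1 hg0).1
  have hev := (Metric.tendsto_nhds.1 (h.tendsto_sum_conj hF hG)) (g.re / 2) (by positivity)
  obtain ⟨⟨n₁, n₂, n₃⟩, hn⟩ := eventually_atTop.1 hev
  -- For such `N` the three wall-free stretches are at least as long as the convergence of the
  -- overlap requires.
  refine ⟨(g.re / 2) ^ 2 / K, n₁ + n₂ + n₃ + 1, by positivity, fun N hN => ?_⟩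
  have hN1 : 1 ≤ N := by omega
  have hre : ∀ a ∈ Finset.Icc (4 * N) (5 * N), ∀ b ∈ Finset.Icc N (2 * N), g.re / 2 ≤
      (inner ℂ (chainState (wallSites (directSum A B) (wallR P') (wallL P') a b) (6 * N + 1))
        (chainState (wallSites (directSum A B) (wallR P) (wallL P) a b) (6 * N + 1))).re := by
    intro a ha b hb
    rw [Finset.mem_Icc] at ha hb
    rw [inner_chainState, seqProd_wallSites (by omega) (by omega), hRR, hLL]
    have h1 := hn (6 * N + 1 - 1 - a, a - 1 - b, b)
      ⟨show n₁ ≤ 6 * N + 1 - 1 - a by omega, show n₂ ≤ a - 1 - b by omega, show n₃ ≤ b by omega⟩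
    rw [dist_eq_norm] at h1
    have h2 := (Complex.abs_re_le_norm _).trans_lt h1
    rw [Complex.sub_re, abs_lt] at h2
    linarith [h2.1]
  have hsum : inner ℂ (trialState A B P' N) (trialState A B P N) =
      ∑ a ∈ Finset.Icc (4 * N) (5 * N), ∑ b ∈ Finset.Icc N (2 * N),
        (inner ℂ (chainState (wallSites (directSum A B) (wallR P') (wallL P') a b) (6 * N + 1))
        (chainState (wallSites (directSum A B) (wallR P) (wallL P) a b) (6 * N + 1)) : ℂ) := by
    rw [trialState_eq_sum hAB P' hN1, trialState_eq_sum hAB P hN1, sum_inner]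
    refine Finset.sum_congr rfl fun a ha => ?_
    rw [sum_inner]
    refine Finset.sum_congr rfl fun b hb => ?_
    have hab : b < a ∧ a < 6 * N + 1 := by rw [Finset.mem_Icc] at ha hb; omega
    rw [inner_sum, Finset.sum_eq_single_of_mem a ha, inner_sum, Finset.sum_eq_single_of_mem b hb]
    · intro b' _ hb'
      exact inner_wallSites_eq_zero hLR hCR hCL hab.1 hab.2 (Or.inr hb')
    · intro a' _ ha'
      rw [inner_sum]
      exact Finset.sum_eq_zero fun b' _ =>
        inner_wallSites_eq_zero hLR hCR hCL hab.1 hab.2 (Or.inl ha')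
  have hlow : ((N : ℝ) + 1) ^ 2 * (g.re / 2) ≤
      ‖(inner ℂ (trialState A B P' N) (trialState A B P N) : ℂ)‖ := by
    refine le_trans ?_ (Complex.re_le_norm _)
    rw [hsum, Complex.re_sum]
    calc ((N : ℝ) + 1) ^ 2 * (g.re / 2)
        = ∑ a ∈ Finset.Icc (4 * N) (5 * N), ∑ b ∈ Finset.Icc N (2 * N), g.re / 2 := by
          simp only [Finset.sum_const, card_Icc_left, card_Icc_right, nsmul_eq_mul]
          push_cast
          ring
      _ ≤ _ := Finset.sum_le_sum fun a ha => by
          rw [Complex.re_sum]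
          exact Finset.sum_le_sum fun b hb => hre a ha b hb
  have hcs := hlow.trans (norm_inner_le_norm (𝕜 := ℂ) (trialState A B P' N) (trialState A B P N))
  have hsq : (((N : ℝ) + 1) ^ 2 * (g.re / 2)) ^ 2 ≤
      K * ((N : ℝ) + 1) ^ 2 * ‖trialState A B P N‖ ^ 2 := by
    calc _ ≤ (‖trialState A B P' N‖ * ‖trialState A B P N‖) ^ 2 := by gcongr
      _ = ‖trialState A B P' N‖ ^ 2 * ‖trialState A B P N‖ ^ 2 := by ring
      _ ≤ _ := by gcongr; exact hb N hN1
  have hNp : (0 : ℝ) < ((N : ℝ) + 1) ^ 2 := by positivity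
  rw [div_mul_eq_mul_div, div_le_iff₀ hK]
  refine le_of_mul_le_mul_left (a := ((N : ℝ) + 1) ^ 2) ?_ hNp
  calc _ = (((N : ℝ) + 1) ^ 2 * (g.re / 2)) ^ 2 := by ring
    _ ≤ _ := hsq
    _ = _ := by ring

/-- Norms and overlap of the two ground states. -/
theorem tendsto_inner_mpsState (hAB : IsStandardForm A B) :
    Tendsto (fun n => inner ℂ (mpsState A n) (mpsState A n) : ℕ → ℂ) atTop (𝓝 1) ∧
    Tendsto (fun n => inner ℂ (mpsState B n) (mpsState B n) : ℕ → ℂ) atTop (𝓝 1) ∧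
    Tendsto (fun n => inner ℂ (mpsState B n) (mpsState A n) : ℕ → ℂ) atTop (𝓝 0) := by
  obtain ⟨Λ, h⟩ := hAB.exists_isTwoBlock
  have e : ∀ n, seqProd (fun _ => mixedTransfer (directSum A B) (directSum A B)) n =
      mixedTransfer (directSum A B) (directSum A B) ^ n := fun n => seqProd_const fun _ _ => rfl
  refine ⟨h.tendsto_sum_pow_transfer.congr fun n => ?_,
    h.symm.tendsto_sum_pow_transfer.congr fun n => ?_,
    h.tendsto_sum_pow_transfer_offDiag.congr fun n => ?_⟩
  · rw [inner_of_apply_eq_trace (mpsState_left_apply A B n) (mpsState_left_apply A B n), e,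
      h.p_star]
  · rw [inner_of_apply_eq_trace (mpsState_right_apply A B n) (mpsState_right_apply A B n), e,
      h.q_star]
  · rw [inner_of_apply_eq_trace (mpsState_right_apply A B n) (mpsState_left_apply A B n), e,
      h.q_star]

end TrialBounds

/-! ### Ground states, gaplessness and the asymptotics of the trial state -/

section Gapless

/-- A vector in the span of two almost orthonormal vectors is controlled by its overlaps. -/
theorem norm_le_of_almost_orthonormal {E : Type*} [NormedAddCommGroup E] [InnerProductSpace ℂ E]
    {u v x y : E} {a b : ℂ} {ε : ℝ} (hu : 3 / 4 ≤ ‖u‖ ^ 2) (hv : 3 / 4 ≤ ‖v‖ ^ 2)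
    (huv : ‖(inner ℂ v u : ℂ)‖ ≤ 1 / 4) (hx : x = a • u + b • v)
    (hxy : inner ℂ x x = (inner ℂ x y : ℂ)) (huy : ‖(inner ℂ u y : ℂ)‖ ≤ ε)
    (hvy : ‖(inner ℂ v y : ℂ)‖ ≤ ε) : ‖x‖ ≤ 2 * ε := by
  have h1 : ‖x‖ ^ 2 = ‖a‖ ^ 2 * ‖u‖ ^ 2 + 2 * RCLike.re (inner ℂ (a • u) (b • v)) +
      ‖b‖ ^ 2 * ‖v‖ ^ 2 := by
    rw [hx, norm_add_sq (𝕜 := ℂ), norm_smul, norm_smul]; ring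
  have h2 : -(‖a‖ * ‖b‖ * (1 / 4)) ≤ RCLike.re (inner ℂ (a • u) (b • v)) := by
    have h3 : ‖(inner ℂ (a • u) (b • v) : ℂ)‖ ≤ ‖a‖ * ‖b‖ * (1 / 4) := by
      rw [inner_smul_left, inner_smul_right, norm_mul, norm_mul, RCLike.norm_conj,
        norm_inner_symm, mul_assoc]
      gcongr
    have h4 := (RCLike.abs_re_le_norm (inner ℂ (a • u) (b • v) : ℂ)).trans h3
    exact (abs_le.1 h4).1
  -- With norms squared at least `3/4` and overlap at most `1/4`, `4‖x‖²` is at least `3(‖a‖² +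
  -- ‖b‖²) - 2‖a‖‖b‖`, which exceeds the left side by `2(‖a‖ - ‖b‖)²`.
  have h5 : (‖a‖ + ‖b‖) ^ 2 ≤ (2 * ‖x‖) ^ 2 := by
    nlinarith [sq_nonneg (‖a‖ - ‖b‖), sq_nonneg ‖a‖, sq_nonneg ‖b‖,
      mul_le_mul_of_nonneg_left hu (sq_nonneg ‖a‖), mul_le_mul_of_nonneg_left hv (sq_nonneg ‖b‖)]
  have h6 : ‖a‖ + ‖b‖ ≤ 2 * ‖x‖ := le_of_sq_le_sq h5 (by positivity)
  have hε : 0 ≤ ε := (norm_nonneg _).trans huy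
  have h7 : ‖x‖ ^ 2 ≤ (‖a‖ + ‖b‖) * ε := by
    have h8 : ‖x‖ ^ 2 = ‖(inner ℂ x y : ℂ)‖ := by
      rw [← hxy, inner_self_eq_norm_sq_to_K, norm_pow, RCLike.norm_ofReal, abs_norm]
    rw [h8, hx, inner_add_left, inner_smul_left, inner_smul_left, add_mul]
    refine (norm_add_le _ _).trans ?_
    rw [norm_mul, norm_mul, RCLike.norm_conj, RCLike.norm_conj]
    gcongr
  by_contra! hlt
  have hx0 : 0 < ‖x‖ := lt_of_le_of_lt (by positivity) hlt
  nlinarith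

variable {d l m : ℕ} {A : Tensor (Fin d) (Fin l)} {B : Tensor (Fin d) (Fin m)}

theorem sum_prod_smul_amp {ι : Type} [Fintype ι] [DecidableEq ι] {T : Tensor (Fin d) ι}
    {u : Fin d → ℂ} (hu : ∑ x, u x • T x = 1) (n : ℕ) :
    ∑ s : Fin n → Fin d, (∏ k, u (s k)) • amp (fun _ => T) n s = 1 := by
  induction n with
  | zero => simp [amp]
  | succ n ih =>
    rw [sum_fin_succ_fun]
    simp only [Fin.prod_univ_succ, Fin.cons_zero, Fin.cons_succ, amp_cons]
    calc ∑ x, ∑ s : Fin n → Fin d, (u x * ∏ k, u (s k)) • (T x * amp (fun _ => T) n s)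
        = (∑ x, u x • T x) * ∑ s : Fin n → Fin d, (∏ k, u (s k)) • amp (fun _ => T) n s := by
          rw [Finset.sum_mul_sum]
          refine Finset.sum_congr rfl fun x _ => Finset.sum_congr rfl fun s _ => ?_
          rw [smul_mul_smul_comm]
      _ = 1 := by rw [hu, ih, one_mul]

/-- A suitable linear combination of the amplitudes is the identity matrix, whose trace `l` is not
zero. -/
theorem mpsState_ne_zero (hAB : IsStandardForm A B) (n : ℕ) : mpsState A n ≠ 0 := by
  have h1 : ((1, 1) : Matrix (Fin l) (Fin l) ℂ × Matrix (Fin m) (Fin m) ℂ) ∈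
      Submodule.span ℂ (Set.range fun i => (A i, B i)) := by
    rw [hAB.blockInjective]; trivial
  obtain ⟨u, hu⟩ := (Submodule.mem_span_range_iff_exists_fun ℂ).1 h1
  have hu' : ∑ x, u x • A x = 1 := by
    have := congrArg Prod.fst hu
    simpa [Prod.fst_sum] using this
  intro h0
  have h2 := congrArg Matrix.trace (sum_prod_smul_amp hu' n)
  have h3 : ∀ s, (amp (fun _ => A) n s).trace = 0 := fun s => by
    rw [← mpsState_apply, h0]; rfl
  simp only [Matrix.trace_sum, Matrix.trace_smul, h3, smul_zero, Finset.sum_const_zero,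
    Matrix.trace_one, Fintype.card_fin] at h2
  exact hAB.left.card_pos.ne' (by exact_mod_cast h2.symm)

variable {P : Tensor (Fin d) (Fin l ⊕ Fin m)}

/-- The uncle Hamiltonian. -/
def uncle (A : Tensor (Fin d) (Fin l)) (B : Tensor (Fin d) (Fin m))
    (P : Tensor (Fin d) (Fin l ⊕ Fin m)) (n : ℕ) : ChainOperator d n :=
  ringHamiltonian (limitSpan (wallTensor A B P)) n

theorem re_inner_uncle_nonneg (hd : 0 < d) {n : ℕ} (hn : 2 ≤ n) (ψ : ChainSpace d n) :
    0 ≤ RCLike.re (inner ℂ ψ (uncle A B P n ψ)) := by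
  rw [uncle, inner_ringHamiltonian _ hd hn]
  have h : (0 : ℝ) ≤ ∑ i, ‖localTerm (limitSpan (wallTensor A B P))ᗮ.starProjection i
      (finRotate n i) ψ‖ ^ 2 := by positivity
  exact h

theorem uncle_mpsState (hd : 0 < d) {n : ℕ} (hn : 2 ≤ n) : uncle A B P n (mpsState A n) = 0 :=
  (ringHamiltonian_eq_zero_iff _ hd hn _).2 fun i s => slice_mpsState_left_mem A B P hn i s

theorem exists_eq_of_uncle_eq_zero (hd : 0 < d) (hP : IsInjectivePerturbation A B P) {n : ℕ}
    (hn : 3 ≤ n) {ψ : ChainSpace d n} (hψ : uncle A B P n ψ = 0) :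
    ∃ a b : ℂ, ψ = a • mpsState A n + b • mpsState B n :=
  exists_eq_mpsState_of_slices A B hP hn
    ((ringHamiltonian_eq_zero_iff _ hd (by omega) _).1 hψ)

/-- The kernel is spanned by two vectors, while the chain has dimension `d ^ n > 2`. This is what
guarantees a positive eigenvalue. -/
theorem uncle_ne_zero (hd : 2 < d) (hP : IsInjectivePerturbation A B P) {n : ℕ} (hn : 3 ≤ n) :
    uncle A B P n ≠ 0 := by
  intro h0
  have htop : (⊤ : Submodule ℂ (ChainSpace d n)) ≤
      Submodule.span ℂ (({mpsState A n, mpsState B n} : Finset (ChainSpace d n)) :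
        Set (ChainSpace d n)) := by
    intro ψ _
    obtain ⟨a, b, rfl⟩ := exists_eq_of_uncle_eq_zero (ψ := ψ) (by omega) hP hn (by rw [h0]; rfl)
    rw [Finset.coe_pair]
    exact Submodule.mem_span_pair.2 ⟨a, b, rfl⟩
  have h1 := (Submodule.finrank_mono htop).trans (finrank_span_finset_le_card _)
  rw [finrank_top, finrank_euclideanSpace, Fintype.card_fun, Fintype.card_fin, Fintype.card_fin]
    at h1
  have h2 := h1.trans Finset.card_le_two
  have h3 : d ^ 1 ≤ d ^ n := Nat.pow_le_pow_right (by omega) (by omega)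
  rw [pow_one] at h3
  omega

theorem isLeast_realEigenvalues (hAB : IsStandardForm A B) (hd : 0 < d) {n : ℕ} (hn : 2 ≤ n) :
    IsLeast (realEigenvalues (uncle A B P n)) 0 := by
  constructor
  · refine Module.End.hasEigenvalue_of_hasEigenvector (x := mpsState A n) ⟨?_, mpsState_ne_zero hAB n⟩
    rw [Module.End.mem_eigenspace_iff]
    simpa using uncle_mpsState hd hn
  · intro t ht
    obtain ⟨ψ, hψ⟩ := Module.End.HasEigenvalue.exists_hasEigenvector ht
    have h1 : uncle A B P n ψ = (t : ℂ) • ψ := hψ.apply_eq_smul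
    have h2 := re_inner_uncle_nonneg (A := A) (B := B) (P := P) hd hn ψ
    rw [h1, inner_smul_right, inner_self_eq_norm_sq_to_K] at h2
    have e : (t : ℂ) * (RCLike.ofReal ‖ψ‖ : ℂ) ^ 2 = ((t * ‖ψ‖ ^ 2 : ℝ) : ℂ) := by
      push_cast; rfl
    rw [e] at h2
    have h3 : 0 ≤ t * ‖ψ‖ ^ 2 := h2
    have h4 : 0 < ‖ψ‖ := norm_pos_iff.2 hψ.2
    exact nonneg_of_mul_nonneg_left h3 (by positivity)

theorem exists_energy_le (hAB : IsStandardForm A B) (hd : 0 < d)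
    (P : Tensor (Fin d) (Fin l ⊕ Fin m)) :
    ∃ K : ℝ, 0 < K ∧ ∀ N : ℕ, 1 ≤ N →
      ‖(inner ℂ (trialState A B P N) (uncle A B P (6 * N + 1) (trialState A B P N)) : ℂ)‖ ≤
        K * (N + 1) := by
  obtain ⟨K, hK, hb⟩ := exists_energy_trialState_le hAB hd P
  refine ⟨K, hK, fun N hN => ?_⟩
  rw [uncle, inner_ringHamiltonian _ hd (by omega), Complex.norm_real,
    Real.norm_of_nonneg (by positivity)]
  exact hb N hN

/-- The trial state is asymptotically orthogonal to the ground states. -/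
theorem eventually_le_norm_sub_starProjection (hAB : IsStandardForm A B) (hd : 0 < d)
    (hP : IsInjectivePerturbation A B P) :
    ∃ c : ℝ, 0 < c ∧ ∀ᶠ N : ℕ in atTop, c * ((N : ℝ) + 1) ^ 2 ≤
      ‖trialState A B P N - (LinearMap.ker (uncle A B P (6 * N + 1) :
        ChainSpace d (6 * N + 1) →ₗ[ℂ] ChainSpace d (6 * N + 1))).starProjection
          (trialState A B P N)‖ ^ 2 := by
  obtain ⟨c, N₀, hc, hlow⟩ := exists_le_norm_trialState hAB hP
  obtain ⟨K, r, hK, hr0, hr1, hov⟩ := exists_overlap_le hAB P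
  obtain ⟨hA, hB, hBA⟩ := tendsto_inner_mpsState hAB
  have hn : Tendsto (fun N : ℕ => 6 * N + 1) atTop atTop :=
    tendsto_atTop_mono (fun N => by simp only [id]; omega) tendsto_id
  have nrm : ∀ (f : ∀ n, ChainSpace d n),
      Tendsto (fun n => inner ℂ (f n) (f n) : ℕ → ℂ) atTop (𝓝 1) →
      ∀ᶠ N : ℕ in atTop, 3 / 4 ≤ ‖f (6 * N + 1)‖ ^ 2 := by
    intro f hf
    have h1 := ((Complex.continuous_re.tendsto _).comp hf).comp hn
    filter_upwards [h1.eventually (lt_mem_nhds (show (3 / 4 : ℝ) < (1 : ℂ).re by norm_num))]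
      with N hN
    simp only [Function.comp_apply] at hN
    rw [inner_self_eq_norm_sq_to_K] at hN
    exact_mod_cast hN.le
  have hcross : ∀ᶠ N : ℕ in atTop,
      ‖(inner ℂ (mpsState B (6 * N + 1)) (mpsState A (6 * N + 1)) : ℂ)‖ ≤ 1 / 4 := by
    have h1 := (hBA.norm).comp hn
    rw [norm_zero] at h1
    filter_upwards [h1.eventually (gt_mem_nhds (show (0 : ℝ) < 1 / 4 by norm_num))] with N hN
    exact hN.le
  have hε : ∀ᶠ N : ℕ in atTop, ((N : ℝ) + 1) ^ 2 * (K * r ^ N) ≤ 1 := by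
    have h1 : Tendsto (fun N : ℕ => 4 * K * ((N : ℝ) ^ 2 * r ^ N)) atTop (𝓝 0) := by
      simpa using (tendsto_pow_const_mul_const_pow_of_lt_one 2 hr0.le hr1).const_mul (4 * K)
    filter_upwards [h1.eventually (gt_mem_nhds zero_lt_one), eventually_ge_atTop 1] with N hN hN1
    refine le_trans ?_ hN.le
    have h2 : ((N : ℝ) + 1) ^ 2 ≤ 4 * (N : ℝ) ^ 2 := by
      have : (1 : ℝ) ≤ N := by exact_mod_cast hN1
      nlinarith
    calc ((N : ℝ) + 1) ^ 2 * (K * r ^ N) ≤ 4 * (N : ℝ) ^ 2 * (K * r ^ N) := by gcongr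
      _ = _ := by ring
  -- This makes `‖φ‖ ≥ 4`, while the projection onto the kernel has norm at most `2`; so at least
  -- half of the norm survives.
  have hbig : ∀ᶠ N : ℕ in atTop, 16 ≤ c * ((N : ℝ) + 1) ^ 2 := by
    have h1 : Tendsto (fun N : ℕ => c * (N : ℝ)) atTop atTop :=
      tendsto_natCast_atTop_atTop.const_mul_atTop hc
    filter_upwards [h1.eventually (eventually_ge_atTop 16)] with N hN
    have : (0 : ℝ) ≤ N := Nat.cast_nonneg N
    nlinarith
  refine ⟨c / 4, by positivity, ?_⟩
  filter_upwards [nrm _ hA, nrm _ hB, hcross, hε, hbig, eventually_ge_atTop N₀,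
    eventually_ge_atTop 1] with N h1 h2 h3 h4 h5 h6 h7
  set φ := trialState A B P N with hφ
  set U := LinearMap.ker (uncle A B P (6 * N + 1) :
        ChainSpace d (6 * N + 1) →ₗ[ℂ] ChainSpace d (6 * N + 1)) with hU
  have hmem : U.starProjection φ ∈ U := Submodule.starProjection_apply_mem _ _
  obtain ⟨a, b, hab⟩ := exists_eq_of_uncle_eq_zero hd hP (by omega) (LinearMap.mem_ker.1 hmem)
  have hself : inner ℂ (U.starProjection φ) (U.starProjection φ) =
      (inner ℂ (U.starProjection φ) φ : ℂ) := by
    have h8 : inner ℂ (U.starProjection φ) (φ - U.starProjection φ) = (0 : ℂ) :=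
      Submodule.inner_right_of_mem_orthogonal hmem (Submodule.sub_starProjection_mem_orthogonal φ)
    rw [inner_sub_right, sub_eq_zero] at h8
    exact h8.symm
  have hproj := norm_le_of_almost_orthonormal h1 h2 h3 hab hself
    ((hov N h7).1.trans h4) ((hov N h7).2.trans h4)
  have hφ4 : 4 ≤ ‖φ‖ := by
    refine le_of_sq_le_sq ?_ (norm_nonneg _)
    refine le_trans ?_ (hlow N h6)
    linarith
  have hsub : ‖φ‖ / 2 ≤ ‖φ - U.starProjection φ‖ := by
    have := norm_sub_norm_le φ (U.starProjection φ)
    linarith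
  calc c / 4 * ((N : ℝ) + 1) ^ 2 = (c * ((N : ℝ) + 1) ^ 2) / 4 := by ring
    _ ≤ ‖φ‖ ^ 2 / 4 := by gcongr; exact hlow N h6
    _ = (‖φ‖ / 2) ^ 2 := by ring
    _ ≤ _ := by gcongr

theorem isGapless_uncle (hAB : IsStandardForm A B) (hd : 2 < d)
    (hP : IsInjectivePerturbation A B P) : IsGapless (uncle A B P) := by
  -- `t` is the smallest positive eigenvalue; at `N = 0` its value is irrelevant.
  have hex : ∀ N : ℕ, ∃ t : ℝ, 1 ≤ N → 0 < t ∧ t ∈ realEigenvalues (uncle A B P (6 * N + 1)) ∧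
      ∀ ψ, t * ‖ψ - (LinearMap.ker (uncle A B P (6 * N + 1) :
        ChainSpace d (6 * N + 1) →ₗ[ℂ] ChainSpace d (6 * N + 1))).starProjection ψ‖ ^ 2 ≤
          RCLike.re (inner ℂ ψ (uncle A B P (6 * N + 1) ψ)) := by
    intro N
    by_cases hN : 1 ≤ N
    · obtain ⟨t, ht⟩ := exists_first_excited (uncle A B P (6 * N + 1) :
        ChainSpace d (6 * N + 1) →ₗ[ℂ] ChainSpace d (6 * N + 1))
        (ringHamiltonian_isSymmetric _ (by omega) (by omega))
        (fun ψ => re_inner_uncle_nonneg (by omega) (by omega) ψ)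
        (fun h0 => uncle_ne_zero hd hP (n := 6 * N + 1) (by omega)
          (ContinuousLinearMap.ext fun ψ => LinearMap.congr_fun h0 ψ))
      exact ⟨t, fun _ => ht⟩
    · exact ⟨0, fun h => absurd h hN⟩
  choose t ht using hex
  obtain ⟨K, hK, hen⟩ := exists_energy_le hAB (by omega) P
  obtain ⟨c, hc, hlow⟩ := eventually_le_norm_sub_starProjection hAB (by omega) hP
  -- The extra vanishing term makes the inequality `t N < δ N` strict.
  refine ⟨fun N => t N + 1 / ((N : ℝ) + 1), ?_, fun N hN => ⟨isLeast_realEigenvalues hAB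
    (by omega) (by omega), t N, (ht N hN).2.1, (ht N hN).1, ?_⟩⟩
  · have hlim := tendsto_one_div_add_atTop_nhds_zero_nat (𝕜 := ℝ)
    have h0 : Tendsto t atTop (𝓝 0) := by
      refine squeeze_zero' ?_ ?_ ((mul_zero (K / c)) ▸ hlim.const_mul (K / c))
      · filter_upwards [eventually_ge_atTop 1] with N hN
        exact (ht N hN).1.le
      · filter_upwards [eventually_ge_atTop 1, hlow] with N hN h1
        have h2 := (ht N hN).2.2 (trialState A B P N)
        have h3 := h2.trans ((RCLike.re_le_norm _).trans (hen N hN))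
        have h4 : t N * (c * ((N : ℝ) + 1) ^ 2) ≤ K * (N + 1) :=
          (mul_le_mul_of_nonneg_left h1 (ht N hN).1.le).trans h3
        have hN0 : (0 : ℝ) < (N : ℝ) + 1 := by positivity
        rw [div_mul_div_comm, mul_one, le_div_iff₀ (by positivity)]
        refine le_of_mul_le_mul_right (a := (N : ℝ) + 1) ?_ hN0
        calc _ = t N * (c * ((N : ℝ) + 1) ^ 2) := by ring
          _ ≤ _ := h4
    simpa using h0.add hlim
  · have : (0 : ℝ) < 1 / ((N : ℝ) + 1) := by positivity
    linarith

theorem isTheta_trialState (hAB : IsStandardForm A B) (hP : IsInjectivePerturbation A B P) :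
    (fun N : ℕ => ‖trialState A B P N‖ ^ 2) =Θ[atTop] (fun N : ℕ => (N : ℝ) ^ 2) := by
  obtain ⟨K, hK, hup⟩ := exists_norm_trialState_le hAB P
  obtain ⟨c, N₀, hc, hlow⟩ := exists_le_norm_trialState hAB hP
  constructor
  · refine IsBigO.of_bound (4 * K) ?_
    filter_upwards [eventually_ge_atTop 1] with N hN
    rw [Real.norm_of_nonneg (by positivity), Real.norm_of_nonneg (by positivity)]
    refine (hup N hN).trans ?_
    have : (1 : ℝ) ≤ N := by exact_mod_cast hN
    have h2 : ((N : ℝ) + 1) ^ 2 ≤ 4 * (N : ℝ) ^ 2 := by nlinarith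
    calc K * ((N : ℝ) + 1) ^ 2 ≤ K * (4 * (N : ℝ) ^ 2) := by gcongr
      _ = _ := by ring
  · refine IsBigO.of_bound c⁻¹ ?_
    filter_upwards [eventually_ge_atTop N₀] with N hN
    rw [Real.norm_of_nonneg (by positivity), Real.norm_of_nonneg (by positivity),
      le_inv_mul_iff₀ hc]
    refine le_trans ?_ (hlow N hN)
    gcongr
    linarith

theorem exists_isBigO_overlap (hAB : IsStandardForm A B)
    (P : Tensor (Fin d) (Fin l ⊕ Fin m)) : ∃ c : ℝ, 0 < c ∧
      (fun N : ℕ => inner ℂ (mpsState A (6 * N + 1)) (trialState A B P N))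
        =O[atTop] (fun N : ℕ => Real.exp (-c * N)) ∧
      (fun N : ℕ => inner ℂ (mpsState B (6 * N + 1)) (trialState A B P N))
        =O[atTop] (fun N : ℕ => Real.exp (-c * N)) := by
  obtain ⟨K, r, hK, hr0, hr1, hov⟩ := exists_overlap_le hAB P
  -- Any base strictly between `r` and `1` absorbs the polynomial factor; the decay rate is then
  -- `-log s`.
  set s := (r + 1) / 2 with hs
  have hs0 : 0 < s := by rw [hs]; linarith
  have hs1 : s < 1 := by rw [hs]; linarith
  have hrs : ‖r‖ < s := by rw [Real.norm_of_nonneg hr0.le, hs]; linarith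
  have hexp : (fun N : ℕ => Real.exp (-(-Real.log s) * N)) = fun N : ℕ => s ^ N := by
    funext N
    rw [neg_neg, mul_comm, Real.exp_nat_mul, Real.exp_log hs0]
  have hO := (isLittleO_pow_const_mul_const_pow_const_pow_of_norm_lt (R := ℝ) 2 hrs).isBigO
  refine ⟨-Real.log s, neg_pos.2 (Real.log_neg hs0 hs1), ?_⟩
  rw [hexp]
  have key : ∀ f : ℕ → ℂ, (∀ N : ℕ, 1 ≤ N → ‖f N‖ ≤ ((N : ℝ) + 1) ^ 2 * (K * r ^ N)) →
      f =O[atTop] fun N : ℕ => s ^ N := by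
    intro f hf
    refine IsBigO.trans (IsBigO.of_bound (4 * K) ?_) hO
    filter_upwards [eventually_ge_atTop 1] with N hN
    refine (hf N hN).trans ?_
    have : (1 : ℝ) ≤ N := by exact_mod_cast hN
    have h2 : ((N : ℝ) + 1) ^ 2 ≤ 4 * (N : ℝ) ^ 2 := by nlinarith
    rw [Real.norm_of_nonneg (by positivity)]
    calc ((N : ℝ) + 1) ^ 2 * (K * r ^ N) ≤ 4 * (N : ℝ) ^ 2 * (K * r ^ N) := by gcongr
      _ = _ := by ring
  exact ⟨key _ fun N hN => (hov N hN).1, key _ fun N hN => (hov N hN).2⟩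

theorem isBigO_energy (hAB : IsStandardForm A B) (hd : 0 < d)
    (P : Tensor (Fin d) (Fin l ⊕ Fin m)) :
    (fun N : ℕ => inner ℂ (trialState A B P N) (uncle A B P (6 * N + 1) (trialState A B P N)))
      =O[atTop] (fun N : ℕ => (N : ℝ)) := by
  obtain ⟨K, hK, hen⟩ := exists_energy_le hAB hd P
  refine IsBigO.of_bound (2 * K) ?_
  filter_upwards [eventually_ge_atTop 1] with N hN
  refine (hen N hN).trans ?_
  have : (1 : ℝ) ≤ N := by exact_mod_cast hN
  rw [Real.norm_of_nonneg (by positivity)]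
  nlinarith

end Gapless

end MPS

end

/-! ### Assembly of the main theorem -/

theorem mainTheorem3 {d l m : ℕ}
    (A : MPS.Tensor (Fin d) (Fin l)) (B : MPS.Tensor (Fin d) (Fin m))
    (hAB : MPS.IsStandardForm A B) (hd : (l + m) ^ 2 ≤ d) :
    MPS.ForAlmostEveryTensor fun P : MPS.Tensor (Fin d) (Fin l ⊕ Fin m) =>
      MPS.IsInjectivePerturbation A B P ∧
      ∃ H : ∀ n : ℕ, MPS.ChainOperator d n,
        (∀ n : ℕ, 2 ≤ n → MPS.IsUncleHamiltonian (MPS.directSum A B) P n (H n)) ∧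
        MPS.IsGapless H ∧
        (fun N : ℕ => ‖MPS.trialState A B P N‖ ^ 2) =Θ[atTop] (fun N : ℕ => (N : ℝ) ^ 2) ∧
        (∃ c : ℝ, 0 < c ∧
          (fun N : ℕ => inner ℂ (MPS.mpsState A (6 * N + 1)) (MPS.trialState A B P N))
            =O[atTop] (fun N : ℕ => Real.exp (-c * N)) ∧
          (fun N : ℕ => inner ℂ (MPS.mpsState B (6 * N + 1)) (MPS.trialState A B P N))
            =O[atTop] (fun N : ℕ => Real.exp (-c * N))) ∧
        (fun N : ℕ => inner ℂ (MPS.trialState A B P N) (H (6 * N + 1) (MPS.trialState A B P N)))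
          =O[atTop] (fun N : ℕ => (N : ℝ)) := by
  obtain ⟨Q, hQ, hQP⟩ := MPS.exists_polynomial_injectivePerturbation A B hAB.blockInjective hd
  refine MPS.forAlmostEveryTensor_of_polynomial Q hQ fun P hP => ?_
  have hinj := hQP P hP
  -- Both blocks are nonempty, since their fixed points have trace one; hence `d ≥ (1 + 1)² = 4`.
  have hd2 : 2 < d := by
    have hl := hAB.left.card_pos
    have hm := hAB.right.card_pos
    nlinarith
  exact ⟨hinj, MPS.uncle A B P, fun n _ => MPS.isUncleHamiltonian_ringHamiltonian A B hinj n,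
    MPS.isGapless_uncle hAB hd2 hinj, MPS.isTheta_trialState hAB hinj,
    MPS.exists_isBigO_overlap hAB P, MPS.isBigO_energy hAB (by omega) P⟩
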